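/- Let $r,t,h$ be smooth real functions of one variable $s$ on an open set $I\subseteq\mathbb R$, with $1-r't'\neq 0$ on $I$. On the space $\mathcal J$ with coordinates $(x,y,z,p,q,s)$, $s\in I$, put $$\omega_1=dq-s\,dx-t\,dy,\quad \omega_2=ds,\quad \omega_3=dz-p\,dx-q\,dy,\quad \omega_4=dp-r\,dx-s\,dy,\quad \omega_5=dx,\quad \omega_6=dy$$ (a coframe), and let $$g_0=2(1-r't')(dz-p\,dx-q\,dy)\,ds+t'(dp-r\,dx-s\,dy)^2-2(dp-r\,dx-s\,dy)(dq-s\,dx-t\,dy)+r'(dq-s\,dx-t\,dy)^2,$$ so that $$g=e^{2h}g_0=e^{2h}\big(2(1-r't')\omega_2\omega_3+r'\omega_1^2-2\omega_1\omega_4+t'\omega_4^2\big).$$ The form $g$ is the pull-back of a metric on the 4-dimensional space of leaves of the common kernel of $\omega_1,\dots,\omega_4$; it has split signature where $1-r't'>0$ and Lorentzian signature where $1-r't'<0$. Put $$Z_1=\frac{2(r't'-1)r'''-3r''(t'r')'}{4(1-r't')^2},\qquad Z_2=\frac{2(r't'-1)t'''-3t''(t'r')'}{4(1-r't')^2}.$$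 (1) There is exactly one Cartan normal conformal connection for $g$ on $\mathcal J$ in the gauge given by the metric $g$ and the horizontal coframe $(\omega_1,\dots,\omega_4)$, that is, a $6\times 6$ matrix of one-forms of the shape $$\mathcal A=\begin{pmatrix}0&\tau_j&0\\ \omega^i&\Gamma^i{}_j&g^{ik}\tau_k\\ 0&g_{jk}\omega^k&0\end{pmatrix}$$ with $\Gamma$ metric and torsion-free, $\tau_j$ horizontal, and the middle block of the curvature trace-free. Its curvature $\mathcal R=d\mathcal A+\mathcal A\wedge\mathcal A$ is $$\mathcal R=\begin{pmatrix} 0&0&0&0&0&0\\ 0&0&Z_2&0&0&0\\ 0&0&0&0&0&0\\ 0&\frac{-Z_2r'-Z_1t'}{2(1-r't')}&0&0&\frac{2Z_2+Z_1t'^2-Z_2r't'}{2(1-r't')}&0\\ 0&0&\tfrac12(Z_2r'-Z_1t')&0&0&0\\ 0&0&0&0&0&0\end{pmatrix}\omega_2\wedge\omega_4+\begin{pmatrix} 0&0&0&0&0&0\\ 0&0&\tfrac12(Z_2r'-Z_1t')&0&0&0\\ 0&0&0&0&0&0\\ 0&\frac{Z_1r't'-2Z_1-Z_2r'^2}{2(1-r't')}&0&0&\frac{Z_2r'+Z_1t'}{2(1-r't')}&0\\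 0&0&-Z_1&0&0&0\\ 0&0&0&0&0&0\end{pmatrix}\omega_1\wedge\omega_2 .$$ (2) The metric $g$ is conformally flat (locally $e^{2\varphi}$ times a metric with constant coefficients in suitable coordinates of the leaf space) if and only if $Z_1\equiv Z_2\equiv 0$ on $I$, i.e. if and only if $$r'''=\frac{-3r''(r't')'}{2(1-r't')}\quad\text{and}\quad t'''=\frac{-3t''(r't')'}{2(1-r't')}\quad\text{on } I.$$ (3) In general $g$ is of Petrov type $N\oplus N'$ in the split signature case and of type $N\oplus\bar N$ in the Lorentzian case. Precisely, let $D=(r'Z_2+t'Z_1)^2+4(1-r't')Z_1Z_2$. At every point of split signature each of the self-dual and anti-self-dual parts of the Weyl tensor is zero or of type $N$ (a nonzero operator on the corresponding two-forms with square zero), and both are of type $N$ exactly where $D\neq0$. At a point of Lorentzian signature the (complex conjugate) self-dual and anti-self-dual parts are of type $N$ exactly where $(Z_1,Z_2)\neq(0,0)$, equivalently where $D\ne 0$. The condition $D\neq 0$ is generic: for every $s_0\in I$ the set of $(c_1,c_2)\in\mathbb R^2$ such that $D(s_0)\neq0$ for the functions $r+c_1(s-s_0)^3$, $t+c_2(s-s_0)^3$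 is open and dense in $\mathbb R^2$. -/

import Mathlib

open scoped ContDiff

namespace ConfMetric

/-! ### One-forms, exterior derivative, wedge product -/

section Forms

variable {E : Type*} [NormedAddCommGroup E] [NormedSpace ℝ E]

/-- Exterior derivative of a one-form, evaluated at `x` on the pair `u, v`. -/
noncomputable def extD (α : E → E →L[ℝ] ℝ) (x u v : E) : ℝ :=
  fderiv ℝ α x u v - fderiv ℝ α x v u

/-- `extD` is the exterior derivative of Mathlib, one-forms being alternating maps in one
variable. -/
theorem extD_eq_extDeriv (α : E → E →L[ℝ] ℝ) (x u v : E) :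
    extD α x u v =
      extDeriv (fun y => ContinuousAlternatingMap.ofSubsingleton ℝ E ℝ (0 : Fin 1) (α y))
        x ![u, v] := by
  have key : fderiv ℝ
      (fun y => ContinuousAlternatingMap.ofSubsingleton ℝ E ℝ (0 : Fin 1) (α y)) x =
      ((ContinuousAlternatingMap.ofSubsingletonLIE (𝕜 := ℝ) (E := E) (F := ℝ)
        (0 : Fin 1)).toContinuousLinearEquiv : (E →L[ℝ] ℝ) →L[ℝ] _).comp (fderiv ℝ α x) :=
    (ContinuousAlternatingMap.ofSubsingletonLIE (𝕜 := ℝ) (E := E) (F := ℝ)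
      (0 : Fin 1)).toContinuousLinearEquiv.comp_fderiv
  rw [extDeriv, ContinuousAlternatingMap.alternatizeUncurryFin_apply, key]
  simp [Fin.sum_univ_two, extD, ContinuousAlternatingMap.ofSubsingletonLIE, Fin.removeNth,
    sub_eq_add_neg]

/-- Wedge product of two one-forms, `α ∧ β = α ⊗ β - β ⊗ α`. -/
def wedge (α β : E → E →L[ℝ] ℝ) (x u v : E) : ℝ :=
  α x u * β x v - α x v * β x u

/-- Symmetric product of two one-forms, `α β = (α ⊗ β + β ⊗ α) / 2`, as a bilinear form. -/
noncomputable def symProd (α β : E → E →L[ℝ] ℝ) (x u v : E) : ℝ :=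
  (α x u * β x v + α x v * β x u) / 2

/-- Curvature `d𝒜 + 𝒜 ∧ 𝒜` of a matrix of one-forms. -/
noncomputable def curvature (A : Matrix (Fin 6) (Fin 6) (E → E →L[ℝ] ℝ))
    (i j : Fin 6) (x u v : E) : ℝ :=
  extD (A i j) x u v + ∑ k, wedge (A i k) (A k j) x u v

/-- The middle index `i + 1` of a `6 × 6` matrix in block form `1 + 4 + 1`. -/
def mid (i : Fin 4) : Fin 6 := i.castSucc.succ

/-- The quadratic form `g_{ij} X^i X^j - 2 X^0 X^5` of `ℝ^6 = ℝ ⊕ ℝ^4 ⊕ ℝ`. -/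
def confForm (g : Matrix (Fin 4) (Fin 4) ℝ) : Matrix (Fin 6) (Fin 6) ℝ :=
  !![0, 0, 0, 0, 0, -1;
     0, g 0 0, g 0 1, g 0 2, g 0 3, 0;
     0, g 1 0, g 1 1, g 1 2, g 1 3, 0;
     0, g 2 0, g 2 1, g 2 2, g 2 3, 0;
     0, g 3 0, g 3 1, g 3 2, g 3 3, 0;
     -1, 0, 0, 0, 0, 0]

/-- The vectors `e 0, …, e 3` at `x` are dual to the one-forms `θ 0, …, θ 3`. -/
def IsDualFrame (θ : Fin 4 → E → E →L[ℝ] ℝ) (x : E) (e : Fin 4 → E) : Prop :=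
  ∀ i k, θ i x (e k) = if i = k then 1 else 0

/-- `A` is the Cartan normal conformal connection of the metric `g_{ij} θ^i θ^j`, written in the
gauge given by the metric and by the (not necessarily orthonormal) horizontal coframe `θ`.

The four forms `θ` may live on a space of dimension larger than four; then `g_{ij} θ^i θ^j` is
the pull-back of a metric on the 4-dimensional space of leaves of the common kernel of the `θ^i`,
and `A` is the pull-back of the Cartan connection of that metric along the lift to the Cartan
bundle determined by `θ`. In block form `1 + 4 + 1` the conditions force
`A = (0, τ_j, 0; θ^i, Γ^i_j, g^{ij} τ_j; 0, g_{jk} θ^k, 0)`,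
with `Γ` the Levi-Civita connection forms and `τ_j = -P_{jk} θ^k`, `P` being the Schouten
tensor. -/
structure IsNormalConformalConnection (U : Set E) (θ : Fin 4 → E → E →L[ℝ] ℝ)
    (g : E → Matrix (Fin 4) (Fin 4) ℝ)
    (A : Matrix (Fin 6) (Fin 6) (E → E →L[ℝ] ℝ)) : Prop where
  smooth : ∀ i j, ContDiffOn ℝ ∞ (A i j) U
  /-- `A` takes values in the Lie algebra of the conformal group: `dQ = Aᵀ Q + Q A`. -/
  conformal : ∀ x ∈ U, ∀ v : E, ∀ i j,
    fderiv ℝ (fun y => confForm (g y) i j) x v =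
      ∑ k, (A k i x v * confForm (g x) k j + confForm (g x) i k * A k j x v)
  /-- The soldering form is the given coframe. -/
  soldering : ∀ x ∈ U, ∀ i, A (mid i) 0 x = θ i x
  /-- The gauge is the one of the given metric in the conformal class. -/
  gauge : ∀ x ∈ U, A 0 0 x = 0
  /-- The remaining part of the connection is horizontal. -/
  horizontal : ∀ x ∈ U, ∀ v : E, (∀ i, θ i x v = 0) → ∀ j, A 0 (mid j) x v = 0
  /-- There is no torsion. -/
  torsion_free : ∀ x ∈ U, ∀ u v : E, ∀ i, curvature A (mid i) 0 x u v = 0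
  /-- Normality: the `co(g)`-part `K^i_{jkl}` of the curvature satisfies `K^i_{jil} = 0`. -/
  normal : ∀ x ∈ U, ∀ e : Fin 4 → E, IsDualFrame θ x e → ∀ v : E, ∀ j,
    ∑ i, curvature A (mid i) (mid j) x (e i) v = 0

/-- The Weyl tensor `W_{ijkl}` at `x`, the `co(g)`-part of the curvature of the normal conformal
connection, with components taken with respect to a frame `e` dual to the coframe. -/
noncomputable def weyl (A : Matrix (Fin 6) (Fin 6) (E → E →L[ℝ] ℝ))
    (g : Matrix (Fin 4) (Fin 4) ℝ) (x : E) (e : Fin 4 → E) (i j k l : Fin 4) : ℝ :=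
  ∑ a, g i a * curvature A (mid a) (mid j) x (e k) (e l)

/-- The field `G` of symmetric bilinear forms, which is a metric of rank four transversal to its
kernel, is conformally flat on `U`: around each point there are a function `φ` and coordinates
`y` of the space of leaves of the kernel with `G = e^{2φ} η_{ab} dy^a dy^b`, the `η_{ab}` being
constants. -/
def IsConformallyFlat (U : Set E) (G : E → E → E → ℝ) : Prop :=
  ∀ x ∈ U, ∃ V : Set E, IsOpen V ∧ x ∈ V ∧ V ⊆ U ∧
    ∃ (φ : E → ℝ) (y : Fin 4 → E → ℝ) (η : Matrix (Fin 4) (Fin 4) ℝ),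
      ContDiffOn ℝ ∞ φ V ∧ (∀ a, ContDiffOn ℝ ∞ (y a) V) ∧ η.IsSymm ∧ η.det ≠ 0 ∧
      ∀ w ∈ V, LinearIndependent ℝ (fun a => fderiv ℝ (y a) w) ∧
        ∀ u v : E, G w u v =
          Real.exp (2 * φ w) * ∑ a, ∑ b, η a b * (fderiv ℝ (y a) w u * fderiv ℝ (y b) w v)

end Forms

/-! ### Signature and Petrov types at a point -/

/-- Signature `(+,+,-,-)`. -/
def IsSplit (g : Matrix (Fin 4) (Fin 4) ℝ) : Prop :=
  ∃ S : Matrix (Fin 4) (Fin 4) ℝ, S.det ≠ 0 ∧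
    S.transpose * g * S = Matrix.diagonal ![1, 1, -1, -1]

/-- Signature `(+,+,+,-)` or `(-,-,-,+)`. -/
def IsLorentzian (g : Matrix (Fin 4) (Fin 4) ℝ) : Prop :=
  ∃ S : Matrix (Fin 4) (Fin 4) ℝ, S.det ≠ 0 ∧
    (S.transpose * g * S = Matrix.diagonal ![1, 1, 1, -1] ∨
      S.transpose * g * S = Matrix.diagonal ![-1, -1, -1, 1])

/-- The Levi-Civita symbol. -/
def leviCivita (i j k l : Fin 4) : ℝ :=
  (Matrix.of fun a b : Fin 4 => if ![i, j, k, l] a = b then (1 : ℝ) else 0).det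

section Petrov

variable {K : Type*} [RCLike K]

/-- Raising both indices of `F_{ij}`. -/
noncomputable def raise (g : Matrix (Fin 4) (Fin 4) ℝ) (F : Matrix (Fin 4) (Fin 4) K) :
    Matrix (Fin 4) (Fin 4) K :=
  fun k l => ∑ a, ∑ b, ((g⁻¹ k a * g⁻¹ l b : ℝ) : K) * F a b

/-- Hodge star on two-forms,
`(⋆F)_{ij} = (1/2) |det g|^{1/2} ε_{ijkl} F^{kl}`. -/
noncomputable def hodge (g : Matrix (Fin 4) (Fin 4) ℝ) (F : Matrix (Fin 4) (Fin 4) K) :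
    Matrix (Fin 4) (Fin 4) K :=
  fun i j => ((Real.sqrt |g.det| / 2 : ℝ) : K) *
    ∑ k, ∑ l, ((leviCivita i j k l : ℝ) : K) * raise g F k l

/-- The Weyl tensor as an operator on two-forms, `F_{ij} ↦ (1/2) W_{ijkl} F^{kl}`. -/
noncomputable def weylOp (g : Matrix (Fin 4) (Fin 4) ℝ) (W : Fin 4 → Fin 4 → Fin 4 → Fin 4 → ℝ)
    (F : Matrix (Fin 4) (Fin 4) K) : Matrix (Fin 4) (Fin 4) K :=
  fun i j => (1 / 2 : K) * ∑ k, ∑ l, ((W i j k l : ℝ) : K) * raise g F k l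

/-- The two-forms with `⋆F = c F`: the self-dual and the anti-self-dual ones are obtained for
`c = 1, -1` (`K = ℝ`) in split signature, and for `c = i, -i` (`K = ℂ`) in Lorentzian
signature. -/
def IsHodgeEigen (g : Matrix (Fin 4) (Fin 4) ℝ) (c : K) (F : Matrix (Fin 4) (Fin 4) K) : Prop :=
  F.transpose = -F ∧ hodge g F = c • F

/-- The part of the Weyl tensor acting on the two-forms with `⋆F = c F` vanishes. -/
def HalfTypeO (g : Matrix (Fin 4) (Fin 4) ℝ) (W : Fin 4 → Fin 4 → Fin 4 → Fin 4 → ℝ)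
    (c : K) : Prop :=
  ∀ F : Matrix (Fin 4) (Fin 4) K, IsHodgeEigen g c F → weylOp g W F = 0

/-- The part of the Weyl tensor acting on the two-forms with `⋆F = c F` is of Petrov type `N`:
it is a nonzero operator with square zero. -/
def HalfTypeN (g : Matrix (Fin 4) (Fin 4) ℝ) (W : Fin 4 → Fin 4 → Fin 4 → Fin 4 → ℝ)
    (c : K) : Prop :=
  (∃ F : Matrix (Fin 4) (Fin 4) K, IsHodgeEigen g c F ∧ weylOp g W F ≠ 0) ∧
    ∀ F : Matrix (Fin 4) (Fin 4) K, IsHodgeEigen g c F → weylOp g W (weylOp g W F) = 0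

end Petrov

/-- Petrov type `N ⊕ N'` in split signature: the self-dual and the anti-self-dual parts, which are
independent real objects, are both of type `N`. -/
def HasTypeNN' (g : Matrix (Fin 4) (Fin 4) ℝ) (W : Fin 4 → Fin 4 → Fin 4 → Fin 4 → ℝ) : Prop :=
  IsSplit g ∧ HalfTypeN g W (1 : ℝ) ∧ HalfTypeN g W (-1 : ℝ)

/-- Petrov type `N ⊕ N̄` in Lorentzian signature: the self-dual and the anti-self-dual parts, which
are complex conjugate to each other, are of type `N`. -/
def HasTypeNNbar (g : Matrix (Fin 4) (Fin 4) ℝ) (W : Fin 4 → Fin 4 → Fin 4 → Fin 4 → ℝ) : Prop :=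
  IsLorentzian g ∧ HalfTypeN g W Complex.I ∧ HalfTypeN g W (-Complex.I)

/-! ### The jet space and the metric -/

/-- The space with coordinates `(x, y, z, p, q, s)`, in this order. -/
abbrev Jet := Fin 6 → ℝ

/-- Differential of the `i`-th coordinate. -/
def dc (i : Fin 6) : Jet → Jet →L[ℝ] ℝ := fun _ => ContinuousLinearMap.proj i

/-- The part of the jet space on which `s` lies in `I`. -/
def jetDomain (I : Set ℝ) : Set Jet := {w | w 5 ∈ I}

/-- The coframe `ω_1 = dq - s dx - t dy`, `ω_2 = ds`, `ω_3 = dz - p dx - q dy`,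
`ω_4 = dp - r dx - s dy`, `ω_5 = dx`, `ω_6 = dy` (with indices starting at `0`). -/
def omega (r t : ℝ → ℝ) : Fin 6 → Jet → Jet →L[ℝ] ℝ :=
  ![fun w => dc 4 w - w 5 • dc 0 w - t (w 5) • dc 1 w,
    dc 5,
    fun w => dc 2 w - w 3 • dc 0 w - w 4 • dc 1 w,
    fun w => dc 3 w - r (w 5) • dc 0 w - w 5 • dc 1 w,
    dc 0,
    dc 1]

/-- The first four forms of the coframe. -/
def omega4 (r t : ℝ → ℝ) (i : Fin 4) : Jet → Jet →L[ℝ] ℝ := omega r t (i.castLE (by norm_num))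

/-- The bilinear form `g_0 = 2 (1 - r' t') (dz - p dx - q dy) ds + t' (dp - r dx - s dy)^2
- 2 (dp - r dx - s dy) (dq - s dx - t dy) + r' (dq - s dx - t dy)^2`. -/
noncomputable def gZero (r t : ℝ → ℝ) (w u v : Jet) : ℝ :=
  let lam : Jet → Jet →L[ℝ] ℝ := fun w => dc 2 w - w 3 • dc 0 w - w 4 • dc 1 w
  let nu₁ : Jet → Jet →L[ℝ] ℝ := fun w => dc 3 w - r (w 5) • dc 0 w - w 5 • dc 1 w
  let nu₂ : Jet → Jet →L[ℝ] ℝ := fun w => dc 4 w - w 5 • dc 0 w - t (w 5) • dc 1 w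
  2 * (1 - deriv r (w 5) * deriv t (w 5)) * symProd lam (dc 5) w u v
    + deriv t (w 5) * symProd nu₁ nu₁ w u v
    - 2 * symProd nu₁ nu₂ w u v
    + deriv r (w 5) * symProd nu₂ nu₂ w u v

/-- The metric `g = e^{2h} g_0`. -/
noncomputable def gConf (r t h : ℝ → ℝ) (w u v : Jet) : ℝ :=
  Real.exp (2 * h (w 5)) * gZero r t w u v

/-- The components of `g` in the coframe `ω_1, ω_2, ω_3, ω_4`. -/
noncomputable def gram (r t h : ℝ → ℝ) (w : Jet) : Matrix (Fin 4) (Fin 4) ℝ :=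
  let a := deriv r (w 5)
  let b := deriv t (w 5)
  Real.exp (2 * h (w 5)) •
    !![a, 0, 0, -1;
       0, 0, 1 - a * b, 0;
       0, 1 - a * b, 0, 0;
       -1, 0, 0, b]

/-- `(2 (r't' - 1) f''' - 3 f'' (t'r')') / (4 (1 - r't')^2)`. -/
noncomputable def zInv (f r t : ℝ → ℝ) (s : ℝ) : ℝ :=
  (2 * (deriv r s * deriv t s - 1) * iteratedDeriv 3 f s
      - 3 * iteratedDeriv 2 f s * deriv (fun σ => deriv t σ * deriv r σ) s)
    / (4 * (1 - deriv r s * deriv t s) ^ 2)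

/-- `Z_1`. -/
noncomputable def Z₁ (r t : ℝ → ℝ) (s : ℝ) : ℝ := zInv r r t s

/-- `Z_2`. -/
noncomputable def Z₂ (r t : ℝ → ℝ) (s : ℝ) : ℝ := zInv t r t s

/-- The coefficient of `ω_2 ∧ ω_4` in the curvature. -/
noncomputable def curvMatrix₂₄ (r t : ℝ → ℝ) (s : ℝ) : Matrix (Fin 6) (Fin 6) ℝ :=
  let a := deriv r s
  let b := deriv t s
  let z₁ := Z₁ r t s
  let z₂ := Z₂ r t s
  !![0, 0, 0, 0, 0, 0;
     0, 0, z₂, 0, 0, 0;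
     0, 0, 0, 0, 0, 0;
     0, (-z₂ * a - z₁ * b) / (2 * (1 - a * b)), 0, 0,
       (2 * z₂ + z₁ * b ^ 2 - z₂ * a * b) / (2 * (1 - a * b)), 0;
     0, 0, (z₂ * a - z₁ * b) / 2, 0, 0, 0;
     0, 0, 0, 0, 0, 0]

/-- The coefficient of `ω_1 ∧ ω_2` in the curvature. -/
noncomputable def curvMatrix₁₂ (r t : ℝ → ℝ) (s : ℝ) : Matrix (Fin 6) (Fin 6) ℝ :=
  let a := deriv r s
  let b := deriv t s
  let z₁ := Z₁ r t s
  let z₂ := Z₂ r t s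
  !![0, 0, 0, 0, 0, 0;
     0, 0, (z₂ * a - z₁ * b) / 2, 0, 0, 0;
     0, 0, 0, 0, 0, 0;
     0, (z₁ * a * b - 2 * z₁ - z₂ * a ^ 2) / (2 * (1 - a * b)), 0, 0,
       (z₂ * a + z₁ * b) / (2 * (1 - a * b)), 0;
     0, 0, -z₁, 0, 0, 0;
     0, 0, 0, 0, 0, 0]

/-- `(r' Z_2 + t' Z_1)^2 + 4 (1 - r't') Z_1 Z_2`. -/
noncomputable def genericity (r t : ℝ → ℝ) (s : ℝ) : ℝ :=
  (deriv r s * Z₂ r t s + deriv t s * Z₁ r t s) ^ 2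
    + 4 * (1 - deriv r s * deriv t s) * Z₁ r t s * Z₂ r t s

end ConfMetric

namespace ConfMetric

/-! In the coframe `omega` all coefficients depend on `s` alone, so the curvature and the Petrov
type are algebra in the jets of r, t, h. Write a = r', b = t', L = 1 - ab, m_f = f''/(2L), ρ = b m_r
+ a m_t. Then L' = -2Lρ and m_f' = -Z_f - m_f ρ: differentiation closes on these symbols, and Z₁, Z₂
alone carry the third derivatives of r and t. The connection `conn` is given explicitly in them, and
`curvature_algebra` computes its curvature as a rational identity. Uniqueness
(`IsNormalConformalConnection.eqOn`) is Koszul's argument for Γ, followed by a trace argument for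
the Schouten forms.

Conformal flatness, necessity: if g = e^{2φ} η(dy, dy), the map e^φ (1, y, η(y,y)/2) into the null
cone of ℝ^6 extends to a frame S with Gram matrix `confForm g`, and S⁻¹dS is a normal connection
without curvature (`exists_flat_connection`). By uniqueness the curvature of `conn` vanishes, and Z₂
and -Z₁ are among its entries.

Sufficiency: in terms of the first integrals `intP`, `intQ`, `intZ` of the kernel, g₀ is the plane
wave 2L ds dZ + b dP² - 2 dP dQ + a dQ². If Z₁ = Z₂ = 0, then m_r and m_t are locally constant
multiples of √|L|, so a and b are affine in one variable τ and L = 1 - ab becomes the equation of a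
conic. A rational parameter u of this conic makes a, b and L explicit enough to write flat
coordinates down (`exists_reparametrization`, `flat_coordinates_algebra`).

Petrov type: the Weyl tensor is a quadratic form in the two-forms ω₁∧ω₂ and ω₂∧ω₄. As an operator it
sees only two components of a two-form, and these vanish on its image, so its square is zero
(`weylOp_weylOp`). In these two components each of the two eigenspaces of the Hodge star is a line,
and the two lines are conjugate for the quadratic form. Hence both halves are nonzero exactly when
the form is nondegenerate; its determinant is LD/4. For L < 0, D is a definite form in (Z₁, Z₂). -/

theorem sum_fin_six {M : Type*} [AddCommMonoid M] (f : Fin 6 → M) :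
    ∑ k, f k = f 0 + ∑ i, f (mid i) + f 5 := by
  rw [Fin.sum_univ_succ, Fin.sum_univ_castSucc, ← add_assoc]
  rfl

theorem fin_six_cases (k : Fin 6) : k = 0 ∨ (∃ i, k = mid i) ∨ k = 5 := by
  fin_cases k
  · exact Or.inl rfl
  · exact Or.inr (Or.inl ⟨0, rfl⟩)
  · exact Or.inr (Or.inl ⟨1, rfl⟩)
  · exact Or.inr (Or.inl ⟨2, rfl⟩)
  · exact Or.inr (Or.inl ⟨3, rfl⟩)
  · exact Or.inr (Or.inr rfl)

/-! ### The quadratic form of ℝ ⊕ ℝ⁴ ⊕ ℝ in blocks. -/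

section confForm

variable (g : Matrix (Fin 4) (Fin 4) ℝ) (i j : Fin 4)

@[simp] theorem confForm_zero_zero : confForm g 0 0 = 0 := rfl
@[simp] theorem confForm_zero_five : confForm g 0 5 = -1 := rfl
@[simp] theorem confForm_five_zero : confForm g 5 0 = -1 := rfl
@[simp] theorem confForm_five_five : confForm g 5 5 = 0 := rfl
@[simp] theorem confForm_zero_mid : confForm g 0 (mid i) = 0 := by fin_cases i <;> rfl
@[simp] theorem confForm_five_mid : confForm g 5 (mid i) = 0 := by fin_cases i <;> rfl
@[simp] theorem confForm_mid_zero : confForm g (mid i) 0 = 0 := by fin_cases i <;> rfl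
@[simp] theorem confForm_mid_five : confForm g (mid i) 5 = 0 := by fin_cases i <;> rfl
@[simp] theorem confForm_mid_mid : confForm g (mid i) (mid j) = g i j := by
  fin_cases i <;> fin_cases j <;> rfl

end confForm

/-! ### Uniqueness of the normal conformal connection in a gauge. -/

section Unique

variable {E : Type*} [NormedAddCommGroup E] [NormedSpace ℝ E]

theorem IsNormalConformalConnection.mono {U V : Set E} {θ : Fin 4 → E → E →L[ℝ] ℝ}
    {g : E → Matrix (Fin 4) (Fin 4) ℝ} {A : Matrix (Fin 6) (Fin 6) (E → E →L[ℝ] ℝ)}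
    (hA : IsNormalConformalConnection U θ g A) (hVU : V ⊆ U) :
    IsNormalConformalConnection V θ g A where
  smooth i j := (hA.smooth i j).mono hVU
  conformal x hx := hA.conformal x (hVU hx)
  soldering x hx := hA.soldering x (hVU hx)
  gauge x hx := hA.gauge x (hVU hx)
  horizontal x hx := hA.horizontal x (hVU hx)
  torsion_free x hx := hA.torsion_free x (hVU hx)
  normal x hx := hA.normal x (hVU hx)

theorem extD_congr {α β : E → E →L[ℝ] ℝ} {U : Set E} (hU : IsOpen U) (h : Set.EqOn α β U)
    {x : E} (hx : x ∈ U) (u v : E) : extD α x u v = extD β x u v := by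
  have : α =ᶠ[nhds x] β := h.eventuallyEq_of_mem (hU.mem_nhds hx)
  simp only [extD, this.fderiv_eq]

theorem curvature_congr {A B : Matrix (Fin 6) (Fin 6) (E → E →L[ℝ] ℝ)} {U : Set E}
    (hU : IsOpen U) (h : ∀ i j, Set.EqOn (A i j) (B i j) U) {x : E} (hx : x ∈ U)
    (i j : Fin 6) (u v : E) : curvature A i j x u v = curvature B i j x u v := by
  simp only [curvature, wedge, extD_congr hU (h i j) hx, h _ _ hx]

/-- The shape of a conformal connection at a point. -/
theorem IsNormalConformalConnection.shape {U : Set E} {θ : Fin 4 → E → E →L[ℝ] ℝ}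
    {g : E → Matrix (Fin 4) (Fin 4) ℝ} {A : Matrix (Fin 6) (Fin 6) (E → E →L[ℝ] ℝ)}
    (hA : IsNormalConformalConnection U θ g A) {x : E} (hx : x ∈ U) :
    A 5 0 x = 0 ∧ A 0 5 x = 0 ∧ A 5 5 x = 0 ∧
      (∀ j v, A 5 (mid j) x v = ∑ i, θ i x v * g x i j) ∧
      (∀ j v, A 0 (mid j) x v = ∑ i, A (mid i) 5 x v * g x i j) ∧
      ∀ i j v, fderiv ℝ (fun y => g y i j) x v =
        ∑ k, (A (mid k) (mid i) x v * g x k j + g x i k * A (mid k) (mid j) x v) := by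
  have h := hA.conformal x hx
  refine ⟨?_, ?_, ?_, ?_, ?_, ?_⟩
  · ext v
    have := h v 0 0
    simp [sum_fin_six] at this
    simp; linarith
  · ext v
    have := h v 5 5
    simp [sum_fin_six] at this
    simp; linarith
  · ext v
    have := h v 0 5
    simp [sum_fin_six, hA.gauge x hx] at this
    simp; linarith
  · intro j v
    have := h v 0 (mid j)
    simp [sum_fin_six, hA.soldering x hx] at this
    linarith
  · intro j v
    have := h v 5 (mid j)
    simp [sum_fin_six] at this
    linarith
  · intro i j v
    have := h v (mid i) (mid j)
    simpa [sum_fin_six] using this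

/-- Koszul's argument: applying the two symmetries alternately, three times each, returns `c i j k`
with the opposite sign. -/
theorem eq_zero_of_skew_symm {ι : Type*} (c : ι → ι → ι → ℝ)
    (hskew : ∀ i j k, c i j k + c j i k = 0) (hsymm : ∀ i j k, c i j k = c i k j) (i j k : ι) :
    c i j k = 0 := by
  have h1 := hskew i j k
  have h2 := hsymm j i k
  have h3 := hskew j k i
  have h4 := hsymm k j i
  have h5 := hskew k i j
  have h6 := hsymm i k j
  linarith

theorem eq_zero_of_gram {G : Matrix (Fin 4) (Fin 4) ℝ} (hG : IsUnit G.det) (σ : Fin 4 → ℝ)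
    (h : ∀ j, ∑ i, G j i * σ i = 0) (i : Fin 4) : σ i = 0 := by
  have h0 : G.mulVec σ = 0 := funext h
  exact congrFun (Matrix.eq_zero_of_mulVec_eq_zero hG.ne_zero h0) i

/-- The normal conformal connection in a given gauge is unique. -/
theorem IsNormalConformalConnection.eqOn {U : Set E} (hU : IsOpen U)
    {θ : Fin 4 → E → E →L[ℝ] ℝ} {g : E → Matrix (Fin 4) (Fin 4) ℝ}
    (hsymm : ∀ x ∈ U, ∀ i j, g x i j = g x j i) (hdet : ∀ x ∈ U, IsUnit (g x).det)
    (hframe : ∀ x ∈ U, ∃ e, IsDualFrame θ x e)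
    {A B : Matrix (Fin 6) (Fin 6) (E → E →L[ℝ] ℝ)}
    (hA : IsNormalConformalConnection U θ g A) (hB : IsNormalConformalConnection U θ g B)
    (i j : Fin 6) : Set.EqOn (B i j) (A i j) U := by
  have hmid : ∀ i j : Fin 4, Set.EqOn (B (mid i) (mid j)) (A (mid i) (mid j)) U := by
    intro i j x hx
    obtain ⟨e, he⟩ := hframe x hx
    obtain ⟨hA50, hA05, hA55, hA5, hA0, hAg⟩ := hA.shape hx
    obtain ⟨hB50, hB05, hB55, hB5, hB0, hBg⟩ := hB.shape hx
    -- Equal soldering forms have equal exterior derivatives, so the difference of the torsion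
    -- equations is purely algebraic: (Γ_B - Γ_A) ∧ θ = 0.
    have htor : ∀ i u v, ∑ j, (B (mid i) (mid j) x u - A (mid i) (mid j) x u) * θ j x v =
        ∑ j, (B (mid i) (mid j) x v - A (mid i) (mid j) x v) * θ j x u := by
      intro i u v
      have h1 := hA.torsion_free x hx u v i
      have h2 := hB.torsion_free x hx u v i
      have h3 : extD (B (mid i) 0) x u v = extD (A (mid i) 0) x u v :=
        extD_congr hU (fun y hy => by rw [hA.soldering y hy, hB.soldering y hy]) hx u v
      simp only [curvature, sum_fin_six, wedge, hA.gauge x hx, hB.gauge x hx, hA50, hB50,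
        hA.soldering x hx, hB.soldering x hx, h3, zero_apply, mul_zero,
        zero_add, add_zero, Finset.sum_sub_distrib] at h1 h2
      simp only [sub_mul, Finset.sum_sub_distrib]
      linarith
    set d : Fin 4 → Fin 4 → E → ℝ := fun i j v =>
      ∑ k, g x i k * (B (mid k) (mid j) x v - A (mid k) (mid j) x v) with hd
    have hskew : ∀ i j v, d i j v + d j i v = 0 := by
      intro i j v
      have h1 := hAg i j v
      have h2 := hBg i j v
      simp only [hd, mul_sub, Finset.sum_sub_distrib]
      simp only [Finset.sum_add_distrib] at h1 h2
      have e1 : ∑ k, g x j k * B (mid k) (mid i) x v = ∑ k, B (mid k) (mid i) x v * g x k j :=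
        Finset.sum_congr rfl fun k _ => by rw [hsymm x hx j k, mul_comm]
      have e2 : ∑ k, g x j k * A (mid k) (mid i) x v = ∑ k, A (mid k) (mid i) x v * g x k j :=
        Finset.sum_congr rfl fun k _ => by rw [hsymm x hx j k, mul_comm]
      linarith
    have hsy : ∀ i u v, ∑ j, d i j u * θ j x v = ∑ j, d i j v * θ j x u := by
      intro i u v
      simp only [hd, Finset.sum_mul, mul_assoc]
      rw [Finset.sum_comm, Finset.sum_comm (f := fun j k => g x i k * _)]
      simp only [← Finset.mul_sum]
      exact Finset.sum_congr rfl fun k _ => by rw [htor k u v]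
    -- Inserting a frame vector shows that the difference of the Γ is horizontal; the axioms demand
    -- this only of the top row.
    have hdk : ∀ i k u, d i k u = ∑ j, d i j (e k) * θ j x u := by
      intro i k u
      rw [← hsy i u (e k)]
      simp [he _ _]
    have hd0 : ∀ i k u, d i k u = 0 := by
      intro i k u
      rw [hdk]
      refine Finset.sum_eq_zero fun j _ => ?_
      rw [eq_zero_of_skew_symm (fun i j k => d i j (e k)) (fun i j k => hskew i j _)
        (fun i j k => ?_) i j k, zero_mul]
      rw [hdk i k (e j)]
      simp [he _ _]
    ext v
    have := eq_zero_of_gram (hdet x hx)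
      (fun k => B (mid k) (mid j) x v - A (mid k) (mid j) x v) (fun k => hd0 k j v) i
    simpa [sub_eq_zero] using this
  have hrow : ∀ x ∈ U, ∀ v j, B (mid j) 5 x v = A (mid j) 5 x v := by
    intro x hx
    obtain ⟨e, he⟩ := hframe x hx
    obtain ⟨hA50, hA05, hA55, hA5, hA0, hAg⟩ := hA.shape hx
    obtain ⟨hB50, hB05, hB55, hB5, hB0, hBg⟩ := hB.shape hx
    set σ : Fin 4 → E → ℝ := fun i v => B (mid i) 5 x v - A (mid i) 5 x v with hσ
    set P : Fin 4 → E → ℝ := fun j v => B 0 (mid j) x v - A 0 (mid j) x v with hP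
    have hPσ : ∀ j v, P j v = ∑ i, σ i v * g x i j := by
      intro j v
      simp only [hP, hσ, hA0, hB0, sub_mul, Finset.sum_sub_distrib]
    -- The Γ agree on the open set `U`, hence so do their exterior derivatives. Subtracting the
    -- normality conditions leaves an expression linear in the difference of the Schouten forms.
    have hnorm : ∀ j v, ∑ i, (θ i x (e i) * P j v - θ i x v * P j (e i) +
        (σ i (e i) * (∑ k, θ k x v * g x k j) - σ i v * ∑ k, θ k x (e i) * g x k j)) = 0 := by
      intro j v
      have h1 := hA.normal x hx e he v j
      have h2 := hB.normal x hx e he v j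
      rw [← sub_eq_zero.2 (h2.trans h1.symm), ← Finset.sum_sub_distrib]
      refine Finset.sum_congr rfl fun i _ => ?_
      have h3 : extD (B (mid i) (mid j)) x (e i) v = extD (A (mid i) (mid j)) x (e i) v :=
        extD_congr hU (hmid i j) hx _ _
      simp only [curvature, sum_fin_six, h3, wedge, hmid _ _ hx, hA.soldering x hx,
        hB.soldering x hx, hA5, hB5, hP, hσ]
      ring
    set tr := ∑ i, σ i (e i) with htr
    -- Here the dimension enters: of the four contractions, one gives 4P, two give -P and one gives
    -- tr · g, so 2P + tr · g = 0.
    have h2P : ∀ j l, P j (e l) = -(tr / 2) * g x l j := by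
      intro j l
      have := hnorm j (e l)
      simp only [he _ _, Finset.sum_add_distrib, Finset.sum_sub_distrib, if_true, ite_mul,
        one_mul, zero_mul, Finset.sum_ite_eq', Finset.mem_univ,
        ← Finset.sum_mul, ← htr, ← hPσ, Finset.sum_const, Finset.card_univ, Fintype.card_fin,
        nsmul_eq_mul] at this
      push_cast at this
      linarith
    have hσe : ∀ l i, σ i (e l) = -(tr / 2) * if i = l then 1 else 0 := by
      intro l i
      rw [← sub_eq_zero]
      refine eq_zero_of_gram (hdet x hx)
        (fun i => σ i (e l) - -(tr / 2) * if i = l then 1 else 0) (fun j => ?_) i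
      have h1 := h2P j l
      rw [hPσ] at h1
      simp only [mul_sub, Finset.sum_sub_distrib, mul_ite, mul_one, mul_zero,
        Finset.sum_ite_eq', Finset.mem_univ, if_true]
      rw [hsymm x hx j l]
      have : ∑ i, g x j i * σ i (e l) = ∑ i, σ i (e l) * g x i j :=
        Finset.sum_congr rfl fun k _ => by rw [hsymm x hx j k, mul_comm]
      rw [this, h1]; ring
    -- Tracing over four indices gives tr = -2 tr.
    have htr0 : tr = 0 := by
      have : tr = ∑ i : Fin 4, -(tr / 2) := by
        rw [htr]
        exact Finset.sum_congr rfl fun i _ => by rw [hσe]; simp [htr]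
      simp at this
      linarith
    have hPe : ∀ j l, P j (e l) = 0 := fun j l => by rw [h2P, htr0]; simp
    have hP0 : ∀ j v, P j v = 0 := by
      intro j v
      -- The frame spans only a complement of the kernel; on the kernel component the horizontality
      -- axiom decides.
      have hker : ∀ i, θ i x (v - ∑ l, θ l x v • e l) = 0 := by
        intro i
        simp [he _ _]
      have h1 := hA.horizontal x hx _ hker j
      have h2 := hB.horizontal x hx _ hker j
      have h3 : P j v = P j (v - ∑ l, θ l x v • e l) + ∑ l, θ l x v * P j (e l) := by
        simp only [hP, map_sub, map_sum, map_smul, smul_eq_mul, mul_sub, Finset.sum_sub_distrib]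
        ring
      rw [h3]
      simp only [hPe, mul_zero, Finset.sum_const_zero, add_zero]
      simp only [hP, h1, h2, sub_zero]
    intro v j
    have := eq_zero_of_gram (hdet x hx) (fun i => σ i v) (fun j => by
      rw [← hP0 j v, hPσ]
      exact Finset.sum_congr rfl fun k _ => by rw [hsymm x hx j k, mul_comm]) j
    simpa [hσ, sub_eq_zero] using this
  intro x hx
  obtain ⟨hA50, hA05, hA55, hA5, hA0, hAg⟩ := hA.shape hx
  obtain ⟨hB50, hB05, hB55, hB5, hB0, hBg⟩ := hB.shape hx
  rcases fin_six_cases i with rfl | ⟨i, rfl⟩ | rfl <;>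
    rcases fin_six_cases j with rfl | ⟨j, rfl⟩ | rfl
  · rw [hA.gauge x hx, hB.gauge x hx]
  · ext v
    simp only [hA0, hB0, hrow x hx]
  · rw [hA05, hB05]
  · rw [hA.soldering x hx, hB.soldering x hx]
  · exact hmid i j hx
  · ext v
    exact hrow x hx v i
  · rw [hA50, hB50]
  · ext v
    rw [hA5, hB5]
  · rw [hA55, hB55]

end Unique

/-! ### The flat connection S⁻¹dS. -/

section PureGauge

variable {E : Type*} [NormedAddCommGroup E] [NormedSpace ℝ E]

theorem contDiffOn_det {n : ℕ} {U : Set E} {M : E → Matrix (Fin n) (Fin n) ℝ}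
    (hM : ∀ i j, ContDiffOn ℝ ∞ (fun x => M x i j) U) : ContDiffOn ℝ ∞ (fun x => (M x).det) U := by
  simp only [Matrix.det_apply]
  exact ContDiffOn.sum fun σ _ =>
    ContDiffOn.const_smul _ (contDiffOn_prod fun i _ => hM _ _)

/-- Cramer's rule writes the entries as quotients of determinants. -/
theorem contDiffOn_inv {n : ℕ} {U : Set E} {M : E → Matrix (Fin n) (Fin n) ℝ}
    (hM : ∀ i j, ContDiffOn ℝ ∞ (fun x => M x i j) U) (hdet : ∀ x ∈ U, (M x).det ≠ 0)
    (i j : Fin n) : ContDiffOn ℝ ∞ (fun x => (M x)⁻¹ i j) U := by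
  have h : ∀ x, (M x)⁻¹ i j = ((M x).det)⁻¹ * ((M x).updateRow j (Pi.single i 1)).det := by
    intro x
    rw [Matrix.inv_def, Matrix.smul_apply, Matrix.adjugate_apply, Ring.inverse_eq_inv', smul_eq_mul]
  simp only [h]
  refine ((contDiffOn_det hM).inv hdet).mul (contDiffOn_det fun a b => ?_)
  simp only [Matrix.updateRow_apply]
  split_ifs
  · exact contDiffOn_const
  · exact hM a b

/-- The matrix of one-forms `S⁻¹ dS`. -/
noncomputable def pureGauge (S : E → Matrix (Fin 6) (Fin 6) ℝ) :
    Matrix (Fin 6) (Fin 6) (E → E →L[ℝ] ℝ) :=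
  Matrix.of fun i j x => ∑ k, (S x)⁻¹ i k • fderiv ℝ (fun y => S y k j) x

variable {U : Set E} {S : E → Matrix (Fin 6) (Fin 6) ℝ}

theorem contDiffOn_pureGauge (hU : IsOpen U) (hS : ∀ i j, ContDiffOn ℝ ∞ (fun x => S x i j) U)
    (hdet : ∀ x ∈ U, (S x).det ≠ 0) (i j : Fin 6) : ContDiffOn ℝ ∞ (pureGauge S i j) U := by
  unfold pureGauge
  simp only [Matrix.of_apply]
  refine ContDiffOn.sum fun k _ => ContDiffOn.smul (contDiffOn_inv hS hdet i k) ?_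
  exact (hS k j).fderiv_of_isOpen hU (by simp)

theorem mul_pureGauge {x : E} (hdet : (S x).det ≠ 0) (i j : Fin 6) (v : E) :
    ∑ l, S x i l * pureGauge S l j x v = fderiv ℝ (fun y => S y i j) x v := by
  have h1 : S x * (S x)⁻¹ = 1 := Matrix.mul_nonsing_inv _ (isUnit_iff_ne_zero.2 hdet)
  have h2 : S x * ((S x)⁻¹ * Matrix.of fun k j => fderiv ℝ (fun y => S y k j) x v) =
      Matrix.of fun k j => fderiv ℝ (fun y => S y k j) x v := by
    rw [← Matrix.mul_assoc, h1, Matrix.one_mul]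
  have h3 := congrFun (congrFun h2 i) j
  simpa [Matrix.mul_apply, pureGauge] using h3

theorem eq_of_mul_eq {n : ℕ} {M : Matrix (Fin n) (Fin n) ℝ} (hM : M.det ≠ 0) {a b : Fin n → ℝ}
    (h : ∀ i, ∑ l, M i l * a l = ∑ l, M i l * b l) : a = b := by
  have h0 : M.mulVec (a - b) = 0 := by
    ext i
    simp only [Matrix.mulVec, dotProduct, Pi.sub_apply, mul_sub, Finset.sum_sub_distrib, h i,
      sub_self, Pi.zero_apply]
  exact sub_eq_zero.1 (Matrix.eq_zero_of_mulVec_eq_zero hM h0)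

/-- Differentiate dS = SA once more: symmetry of the second derivatives of S gives S(dA + A∧A) = 0,
and S is invertible. -/
theorem curvature_pureGauge (hU : IsOpen U) (hS : ∀ i j, ContDiffOn ℝ ∞ (fun x => S x i j) U)
    (hdet : ∀ x ∈ U, (S x).det ≠ 0) {x : E} (hx : x ∈ U) (i j : Fin 6) (u v : E) :
    curvature (pureGauge S) i j x u v = 0 := by
  have hdS : ∀ i j, DifferentiableAt ℝ (fun y => S y i j) x := fun i j =>
    ((hS i j).contDiffAt (hU.mem_nhds hx)).differentiableAt (by simp)
  have hdA : ∀ i j, DifferentiableAt ℝ (pureGauge S i j) x := fun i j =>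
    ((contDiffOn_pureGauge hU hS hdet i j).contDiffAt (hU.mem_nhds hx)).differentiableAt (by simp)
  have hd : ∀ i j u v, fderiv ℝ (fderiv ℝ (fun y => S y i j)) x u v =
      ∑ l, (S x i l * fderiv ℝ (pureGauge S l j) x u v +
        fderiv ℝ (fun y => S y i l) x u * pureGauge S l j x v) := by
    intro i j u v
    have h1 : fderiv ℝ (fun y => S y i j) =ᶠ[nhds x]
        fun y => ∑ l, S y i l • pureGauge S l j y := by
      filter_upwards [hU.mem_nhds hx] with y hy
      ext v
      rw [← mul_pureGauge (hdet y hy)]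
      simp
    have h2 : HasFDerivAt (fun y => ∑ l, S y i l • pureGauge S l j y)
        (∑ l, (S x i l • fderiv ℝ (pureGauge S l j) x +
          (fderiv ℝ (fun y => S y i l) x).smulRight (pureGauge S l j x))) x :=
      HasFDerivAt.fun_sum fun l _ => (hdS i l).hasFDerivAt.smul (hdA l j).hasFDerivAt
    rw [h1.fderiv_eq, h2.fderiv]
    simp
  have hsym : ∀ i j, fderiv ℝ (fderiv ℝ (fun y => S y i j)) x u v =
      fderiv ℝ (fderiv ℝ (fun y => S y i j)) x v u := fun i j =>
    (((hS i j).contDiffAt (hU.mem_nhds hx)).isSymmSndFDerivAt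
      (by rw [minSmoothness_of_isRCLikeNormedField]; exact WithTop.coe_le_coe.2 (le_top : (2 : ℕ∞) ≤ ⊤))) u v
  have key : (fun l => curvature (pureGauge S) l j x u v) = fun _ => 0 := by
    refine eq_of_mul_eq (hdet x hx) fun i => ?_
    have h := hsym i j
    rw [hd, hd] at h
    simp only [← mul_pureGauge (hdet x hx) i, Finset.sum_add_distrib] at h
    have e : ∀ u v, ∑ l, (∑ m, S x i m * pureGauge S m l x u) * pureGauge S l j x v =
        ∑ m, S x i m * ∑ l, pureGauge S m l x u * pureGauge S l j x v := by
      intro u v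
      simp only [Finset.sum_mul, Finset.mul_sum, mul_assoc]
      exact Finset.sum_comm
    rw [e, e] at h
    simp only [curvature, extD, wedge, mul_add, mul_sub, Finset.sum_add_distrib,
      Finset.sum_sub_distrib, mul_zero, Finset.sum_const_zero]
    linarith
  exact congrFun key i

/-- Since Q is constant, differentiating SᵀQS = q and replacing dS by SA yields dq = Aᵀq + qA. -/
theorem conformal_pureGauge (hU : IsOpen U) (hS : ∀ i j, ContDiffOn ℝ ∞ (fun x => S x i j) U)
    (hdet : ∀ x ∈ U, (S x).det ≠ 0) (Q : Matrix (Fin 6) (Fin 6) ℝ)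
    (q : E → Matrix (Fin 6) (Fin 6) ℝ)
    (hq : ∀ x ∈ U, ∀ i j, ∑ k, ∑ l, S x k i * Q k l * S x l j = q x i j)
    {x : E} (hx : x ∈ U) (v : E) (i j : Fin 6) :
    fderiv ℝ (fun y => q y i j) x v =
      ∑ k, (pureGauge S k i x v * q x k j + q x i k * pureGauge S k j x v) := by
  have hdS : ∀ i j, DifferentiableAt ℝ (fun y => S y i j) x := fun i j =>
    ((hS i j).contDiffAt (hU.mem_nhds hx)).differentiableAt (by simp)
  have h1 : (fun y => q y i j) =ᶠ[nhds x] fun y => ∑ k, ∑ l, S y k i * Q k l * S y l j := by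
    filter_upwards [hU.mem_nhds hx] with y hy
    rw [hq y hy]
  have h2 : HasFDerivAt (fun y => ∑ k, ∑ l, S y k i * Q k l * S y l j)
      (∑ k, ∑ l, ((S x k i * Q k l) • fderiv ℝ (fun y => S y l j) x +
        S x l j • (Q k l • fderiv ℝ (fun y => S y k i) x))) x :=
    HasFDerivAt.fun_sum fun k _ => HasFDerivAt.fun_sum fun l _ =>
      (((hdS k i).hasFDerivAt.mul_const (Q k l))).mul (hdS l j).hasFDerivAt
  rw [h1.fderiv_eq, h2.fderiv]
  simp only [← hq x hx, sum_apply, add_apply, smul_apply, smul_eq_mul,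
    ← mul_pureGauge (hdet x hx), Finset.sum_add_distrib]
  rw [add_comm]
  congr 1
  · simp only [Finset.mul_sum]
    conv_rhs => rw [Finset.sum_comm]
    refine Finset.sum_congr rfl fun a _ => ?_
    conv_rhs => rw [Finset.sum_comm]
    refine Finset.sum_congr rfl fun b _ => Finset.sum_congr rfl fun m _ => ?_
    ring
  · simp only [Finset.mul_sum, Finset.sum_mul]
    conv_rhs => rw [Finset.sum_comm]
    refine Finset.sum_congr rfl fun a _ => ?_
    conv_rhs => rw [Finset.sum_comm]
    refine Finset.sum_congr rfl fun b _ => Finset.sum_congr rfl fun m _ => ?_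
    ring

end PureGauge

/-! ### Development of a conformally flat metric into the light cone. -/

section Development

/-- The element of `ℝ ⊕ ℝ^4 ⊕ ℝ` with the given components. -/
def blockVec {α : Type*} (a : α) (b : Fin 4 → α) (c : α) : Fin 6 → α :=
  ![a, b 0, b 1, b 2, b 3, c]

section

variable {α : Type*} (a : α) (b : Fin 4 → α) (c : α)

@[simp] theorem blockVec_zero : blockVec a b c 0 = a := rfl
@[simp] theorem blockVec_five : blockVec a b c 5 = c := rfl
@[simp] theorem blockVec_mid (i : Fin 4) : blockVec a b c (mid i) = b i := by
  fin_cases i <;> rfl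

end

variable {E : Type*} [NormedAddCommGroup E] [NormedSpace ℝ E]

/-- Derivatives in the direction of a constant dual frame, of a function which is constant along
the kernel of the coframe. -/
theorem fderiv_fderiv_of_ker {U : Set E} (hU : IsOpen U) {θ : Fin 4 → E → E →L[ℝ] ℝ}
    (hθ : ∀ i, ContDiffOn ℝ ∞ (θ i) U) {e : Fin 4 → E} (he : ∀ x ∈ U, IsDualFrame θ x e)
    {F : E → ℝ} (hF : ContDiffOn ℝ ∞ F U)
    (hker : ∀ x ∈ U, ∀ v, (∀ i, θ i x v = 0) → fderiv ℝ F x v = 0)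
    {x : E} (hx : x ∈ U) {v : E} (hv : ∀ i, θ i x v = 0) (w : E) :
    fderiv ℝ (fun y => fderiv ℝ F y w) x v =
      ∑ i, fderiv ℝ (θ i) x w v * fderiv ℝ F x (e i) := by
  have hdF : DifferentiableAt ℝ (fderiv ℝ F) x :=
    ((hF.fderiv_of_isOpen hU (m := ∞) (by simp)).contDiffAt (hU.mem_nhds hx)).differentiableAt
      (by simp)
  have hdθ : ∀ i, DifferentiableAt ℝ (θ i) x := fun i =>
    ((hθ i).contDiffAt (hU.mem_nhds hx)).differentiableAt (by simp)
  have hsym := ((hF.contDiffAt (hU.mem_nhds hx)).isSymmSndFDerivAt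
      (by rw [minSmoothness_of_isRCLikeNormedField]
          exact WithTop.coe_le_coe.2 (le_top : (2 : ℕ∞) ≤ ⊤)))
  -- Since dF kills the kernel at all nearby points, its value on the fixed vector v expands in the
  -- frame. The coefficients θ^i(v) vanish at x, so only their derivatives survive; symmetry of the
  -- second derivative then exchanges v and w.
  have h1 : (fun y => fderiv ℝ F y v) =ᶠ[nhds x]
      fun y => ∑ i, θ i y v * fderiv ℝ F y (e i) := by
    filter_upwards [hU.mem_nhds hx] with y hy
    have h0 := hker y hy (v - ∑ i, θ i y v • e i) (fun k => by simp [he y hy _ _])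
    rw [map_sub, map_sum, sub_eq_zero] at h0
    simpa using h0
  have h2 : HasFDerivAt (fun y => ∑ i, θ i y v * fderiv ℝ F y (e i))
      (∑ i, (θ i x v • (fderiv ℝ (fderiv ℝ F) x).flip (e i) +
        fderiv ℝ F x (e i) • (fderiv ℝ (θ i) x).flip v)) x := by
    refine HasFDerivAt.fun_sum fun i _ => HasFDerivAt.mul ?_ ?_
    · simpa using (hdθ i).hasFDerivAt.clm_apply (hasFDerivAt_const v x)
    · simpa using hdF.hasFDerivAt.clm_apply (hasFDerivAt_const (e i) x)
  have h3 : ∀ z : E, HasFDerivAt (fun y => fderiv ℝ F y z) ((fderiv ℝ (fderiv ℝ F) x).flip z) x :=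
    fun z => by simpa using hdF.hasFDerivAt.clm_apply (hasFDerivAt_const z x)
  rw [(h3 w).fderiv, ContinuousLinearMap.flip_apply, hsym v w,
    ← ContinuousLinearMap.flip_apply, ← (h3 v).fderiv, h1.fderiv_eq, h2.fderiv]
  simp [hv, mul_comm]

/-- A vector killed by S is killed by SᵀQS = `confForm g`, which is nondegenerate because g is. -/
theorem det_ne_zero_of_gram {S Q : Matrix (Fin 6) (Fin 6) ℝ} {g : Matrix (Fin 4) (Fin 4) ℝ}
    (hg : g.det ≠ 0) (h : ∀ i j, ∑ k, ∑ l, S k i * Q k l * S l j = confForm g i j) :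
    S.det ≠ 0 := by
  intro h0
  obtain ⟨c, hc, hSc⟩ := Matrix.exists_mulVec_eq_zero_iff.2 h0
  have h1 : ∀ i, ∑ j, confForm g i j * c j = 0 := by
    intro i
    have h2 : ∀ l, ∑ j, S l j * c j = 0 := fun l => congrFun hSc l
    calc ∑ j, confForm g i j * c j = ∑ j, ∑ k, ∑ l, S k i * Q k l * (S l j * c j) := by
          simp only [← h, Finset.sum_mul, mul_assoc]
      _ = ∑ k, ∑ l, S k i * Q k l * ∑ j, S l j * c j := by
          rw [Finset.sum_comm]
          refine Finset.sum_congr rfl fun k _ => ?_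
          rw [Finset.sum_comm]
          simp only [Finset.mul_sum]
      _ = 0 := by simp only [h2, mul_zero, Finset.sum_const_zero]
  have h5 := h1 0
  have h00 := h1 5
  simp [sum_fin_six] at h5 h00
  have hm : ∀ i, c (mid i) = 0 := by
    refine eq_zero_of_gram (isUnit_iff_ne_zero.2 hg) (fun i => c (mid i)) fun j => ?_
    have := h1 (mid j)
    simpa [sum_fin_six] using this
  refine hc (funext fun k => ?_)
  rcases fin_six_cases k with rfl | ⟨i, rfl⟩ | rfl
  · exact h00
  · exact hm i
  · exact h5

/-- Position vector in the light cone, before scaling. -/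
noncomputable def conePoint (η : Matrix (Fin 4) (Fin 4) ℝ) (y : Fin 4 → ℝ) : Fin 6 → ℝ :=
  blockVec 1 y (2⁻¹ * ∑ a, ∑ b, η a b * (y a * y b))

/-- Derivative of the position vector. -/
def coneTangent (η : Matrix (Fin 4) (Fin 4) ℝ) (y z : Fin 4 → ℝ) : Fin 6 → ℝ :=
  blockVec 0 z (∑ a, ∑ b, η a b * (y a * z b))

theorem confForm_apply_blockVec (η : Matrix (Fin 4) (Fin 4) ℝ) (a a' c c' : ℝ)
    (b b' : Fin 4 → ℝ) :
    Matrix.toBilin' (confForm η) (blockVec a b c) (blockVec a' b' c') =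
      -(a * c') - c * a' + ∑ i, ∑ j, η i j * (b i * b' j) := by
  rw [Matrix.toBilin'_apply]
  simp only [sum_fin_six, blockVec_zero, blockVec_five, blockVec_mid, confForm_zero_zero,
    confForm_zero_five, confForm_five_zero, confForm_five_five, confForm_zero_mid,
    confForm_five_mid, confForm_mid_zero, confForm_mid_five, confForm_mid_mid]
  have : ∀ i j, b i * η i j * b' j = η i j * (b i * b' j) := fun i j => by ring
  simp only [this]
  simp
  ring

/-- A null frame completing the derivatives of the scaled position vector. -/
theorem confForm_frame {η g : Matrix (Fin 4) (Fin 4) ℝ} (hη : η.IsSymm) {y : Fin 4 → ℝ} {f : ℝ}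
    (hf : f ≠ 0) {Υ β : Fin 4 → ℝ} {z : Fin 4 → Fin 4 → ℝ}
    (hg : ∀ i j, g i j = f ^ 2 * ∑ a, ∑ b, η a b * (z i a * z j b))
    (hβ : ∀ i, ∑ j, g i j * β j = Υ i) {S₀ S₅ : Fin 6 → ℝ} {S : Fin 4 → Fin 6 → ℝ}
    (h₀ : S₀ = f • conePoint η y)
    (hS : ∀ i, S i = f • (Υ i • conePoint η y + coneTangent η y (z i)))
    (h₅ : S₅ = f⁻¹ • blockVec 0 (fun _ => 0) 1 + ∑ i, β i • S i - (2⁻¹ * ∑ i, Υ i * β i) • S₀)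
    (i j : Fin 6) :
    Matrix.toBilin' (confForm η) (blockVec S₀ S S₅ i) (blockVec S₀ S S₅ j) = confForm g i j := by
  set B := Matrix.toBilin' (confForm η) with hB
  have hη' : ∀ a b, η a b = η b a := fun a b => (hη.apply b a)
  have hBsymm : ∀ u v, B u v = B v u := by
    intro u v
    rw [hB, Matrix.toBilin'_apply, Matrix.toBilin'_apply, Finset.sum_comm]
    have : ∀ k l, confForm η k l = confForm η l k := by
      intro k l
      rcases fin_six_cases k with rfl | ⟨k, rfl⟩ | rfl <;>
        rcases fin_six_cases l with rfl | ⟨l, rfl⟩ | rfl <;> simp [hη' _ _]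
    refine Finset.sum_congr rfl fun k _ => Finset.sum_congr rfl fun l _ => ?_
    rw [this l k]; ring
  -- N is the point at infinity of the cone: null, of product -1 with every cone point and 0 with
  -- every cone tangent. In `S₅`, the terms in `S i`, with β the index-raised Υ, make f⁻¹N
  -- orthogonal to the `S i`, and the term in `S₀` makes it null again.
  set N : Fin 6 → ℝ := blockVec 0 (fun _ => 0) 1 with hN
  have hYY : B (conePoint η y) (conePoint η y) = 0 := by
    rw [hB, conePoint, confForm_apply_blockVec]; ring
  have hYD : ∀ w, B (conePoint η y) (coneTangent η y w) = 0 := fun w => by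
    rw [hB, conePoint, coneTangent, confForm_apply_blockVec]; ring
  have hDY : ∀ w, B (coneTangent η y w) (conePoint η y) = 0 := fun w => by
    rw [hBsymm, hYD]
  have hDD : ∀ w w', B (coneTangent η y w) (coneTangent η y w') =
      ∑ a, ∑ b, η a b * (w a * w' b) := fun w w' => by
    rw [hB, coneTangent, coneTangent, confForm_apply_blockVec]; ring
  have hNN : B N N = 0 := by
    rw [hB, hN, confForm_apply_blockVec]; simp
  have hNY : B N (conePoint η y) = -1 := by
    rw [hB, hN, conePoint, confForm_apply_blockVec]; simp
  have hND : ∀ w, B N (coneTangent η y w) = 0 := fun w => by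
    rw [hB, hN, coneTangent, confForm_apply_blockVec]; simp
  have b00 : B S₀ S₀ = 0 := by simp [h₀, hYY]
  have b0 : ∀ i, B S₀ (S i) = 0 := fun i => by simp [h₀, hS, hYY, hYD]
  have b0' : ∀ i, B (S i) S₀ = 0 := fun i => by rw [hBsymm, b0]
  have bS : ∀ i j, B (S i) (S j) = g i j := fun i j => by
    simp only [hS, map_smul, map_add, LinearMap.smul_apply, LinearMap.add_apply, hYY, hYD, hDY, hDD, smul_eq_mul, hg]
    ring
  have bN0 : B N S₀ = -f := by simp [h₀, hNY]
  have bN : ∀ i, B N (S i) = -f * Υ i := fun i => by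
    simp only [hS, map_smul, map_add, hNY, hND, smul_eq_mul]
    ring
  have b5 : ∀ v, B S₅ v = f⁻¹ * B N v + ∑ i, β i * B (S i) v - (2⁻¹ * ∑ i, Υ i * β i) * B S₀ v := by
    intro v
    rw [h₅]
    simp only [map_sub, map_add, map_sum, map_smul, LinearMap.sub_apply, LinearMap.add_apply,
      LinearMap.sum_apply, LinearMap.smul_apply,
      smul_eq_mul]
  have b50 : B S₅ S₀ = -1 := by
    rw [b5, bN0, b00]
    simp only [b0', mul_zero, Finset.sum_const_zero]
    field_simp
    ring
  have hgs : ∀ i j, g i j = g j i := fun i j => by rw [← bS, hBsymm, bS]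
  have b5S : ∀ j, B S₅ (S j) = 0 := by
    intro j
    rw [b5, bN, b0]
    have : ∑ i, β i * B (S i) (S j) = Υ j := by
      rw [← hβ]
      exact Finset.sum_congr rfl fun i _ => by rw [bS, hgs i j, mul_comm]
    rw [this]
    field_simp
    ring
  have b5N : B S₅ N = -f * (2⁻¹ * ∑ i, Υ i * β i) := by
    rw [b5, hNN, hBsymm S₀, bN0]
    have : ∑ i, β i * B (S i) N = -f * ∑ i, Υ i * β i := by
      rw [Finset.mul_sum]
      exact Finset.sum_congr rfl fun i _ => by rw [hBsymm, bN]; ring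
    rw [this]
    ring
  have b55 : B S₅ S₅ = 0 := by
    conv_lhs => arg 2; rw [h₅]
    simp only [map_sub, map_add, map_sum, map_smul, b5N, b5S, b50, smul_eq_mul, mul_zero,
      Finset.sum_const_zero]
    field_simp
    ring
  rcases fin_six_cases i with rfl | ⟨i, rfl⟩ | rfl <;>
    rcases fin_six_cases j with rfl | ⟨j, rfl⟩ | rfl <;>
    simp [b00, b0, b0', bS, b50, b5S, b55]
  · rw [hBsymm, b50]
  · rw [hBsymm, b5S]

variable (η : Matrix (Fin 4) (Fin 4) ℝ) (φ : E → ℝ) (y : Fin 4 → E → ℝ)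

/-- The position vector in the light cone, scaled by `exp φ`. -/
noncomputable def scaledPoint (w : E) : Fin 6 → ℝ :=
  Real.exp (φ w) • conePoint η (fun a => y a w)

variable {η φ y} {U : Set E}

theorem contDiffOn_scaledPoint (hφ : ContDiffOn ℝ ∞ φ U) (hy : ∀ a, ContDiffOn ℝ ∞ (y a) U)
    (k : Fin 6) : ContDiffOn ℝ ∞ (fun w => scaledPoint η φ y w k) U := by
  simp only [scaledPoint, Pi.smul_apply, smul_eq_mul]
  refine hφ.exp.mul ?_
  rcases fin_six_cases k with rfl | ⟨k, rfl⟩ | rfl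
  · simpa [conePoint] using contDiffOn_const
  · simpa [conePoint] using hy k
  · simp only [conePoint, blockVec_five]
    exact contDiffOn_const.mul (ContDiffOn.sum fun a _ => ContDiffOn.sum fun b _ =>
      contDiffOn_const.mul ((hy a).mul (hy b)))

theorem fderiv_scaledPoint (hη : η.IsSymm) {x : E} (hφ : DifferentiableAt ℝ φ x)
    (hy : ∀ a, DifferentiableAt ℝ (y a) x) (k : Fin 6) (v : E) :
    fderiv ℝ (fun w => scaledPoint η φ y w k) x v =
      (Real.exp (φ x) • (fderiv ℝ φ x v • conePoint η (fun a => y a x) +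
        coneTangent η (fun a => y a x) (fun a => fderiv ℝ (y a) x v))) k := by
  have hc : HasFDerivAt (fun w => conePoint η (fun a => y a w) k)
      (blockVec 0 (fun a => fderiv ℝ (y a) x)
        (∑ a, ∑ b, (η a b * y a x) • fderiv ℝ (y b) x) k) x := by
    rcases fin_six_cases k with rfl | ⟨k, rfl⟩ | rfl
    · simpa [conePoint] using hasFDerivAt_const _ _
    · simpa [conePoint] using (hy k).hasFDerivAt
    · simp only [conePoint, blockVec_five]
      have h : HasFDerivAt (fun w => 2⁻¹ * ∑ a, ∑ b, η a b * (y a w * y b w))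
          ((2⁻¹ : ℝ) • ∑ a, ∑ b, η a b •
            (y a x • fderiv ℝ (y b) x + y b x • fderiv ℝ (y a) x)) x :=
        (HasFDerivAt.fun_sum fun a _ => HasFDerivAt.fun_sum fun b _ =>
          ((hy a).hasFDerivAt.mul (hy b).hasFDerivAt).const_mul _).const_mul _
      convert h using 1
      -- By symmetry of η the two halves of the product rule coincide, which cancels the factor 2⁻¹.
      have e1 : ∑ a, ∑ b, η a b • (y b x • fderiv ℝ (y a) x) =
          ∑ a, ∑ b, (η a b * y a x) • fderiv ℝ (y b) x := by
        rw [Finset.sum_comm]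
        refine Finset.sum_congr rfl fun a _ => Finset.sum_congr rfl fun b _ => ?_
        rw [hη.apply, smul_smul]
      simp only [smul_add, Finset.sum_add_distrib, e1]
      simp only [smul_smul]
      rw [← two_smul ℝ, smul_smul]
      norm_num
  have h : HasFDerivAt (fun w => Real.exp (φ w) * conePoint η (fun a => y a w) k) _ x :=
    hφ.hasFDerivAt.exp.mul hc
  have h2 : (fun w => scaledPoint η φ y w k) =
      fun w => Real.exp (φ w) * conePoint η (fun a => y a w) k := rfl
  rw [h2, h.fderiv]
  simp only [add_apply, smul_apply, smul_eq_mul, Pi.smul_apply, Pi.add_apply]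
  have e : blockVec 0 (fun a => fderiv ℝ (y a) x)
        (∑ a, ∑ b, (η a b * y a x) • fderiv ℝ (y b) x) k v =
      coneTangent η (fun a => y a x) (fun a => fderiv ℝ (y a) x v) k := by
    rcases fin_six_cases k with rfl | ⟨k, rfl⟩ | rfl
    · simp [coneTangent]
    · simp [coneTangent]
    · simp [coneTangent, mul_assoc]
  rw [e]
  ring

/-- A conformally flat metric has a normal conformal connection with vanishing curvature. -/
theorem exists_flat_connection (hU : IsOpen U) {θ : Fin 4 → E → E →L[ℝ] ℝ}
    (hθ : ∀ i, ContDiffOn ℝ ∞ (θ i) U) {e : Fin 4 → E} (he : ∀ x ∈ U, IsDualFrame θ x e)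
    {g : E → Matrix (Fin 4) (Fin 4) ℝ} (hgs : ∀ i j, ContDiffOn ℝ ∞ (fun x => g x i j) U)
    (hdet : ∀ x ∈ U, (g x).det ≠ 0) (hη : η.IsSymm) (hφ : ContDiffOn ℝ ∞ φ U)
    (hy : ∀ a, ContDiffOn ℝ ∞ (y a) U)
    (hφker : ∀ x ∈ U, ∀ v, (∀ i, θ i x v = 0) → fderiv ℝ φ x v = 0)
    (hyker : ∀ x ∈ U, ∀ v, (∀ i, θ i x v = 0) → ∀ a, fderiv ℝ (y a) x v = 0)
    (hg : ∀ x ∈ U, ∀ i j, g x i j = Real.exp (2 * φ x) *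
      ∑ a, ∑ b, η a b * (fderiv ℝ (y a) x (e i) * fderiv ℝ (y b) x (e j))) :
    ∃ B, IsNormalConformalConnection U θ g B ∧
      ∀ x ∈ U, ∀ i j u v, curvature B i j x u v = 0 := by
  set X : E → Fin 6 → ℝ := scaledPoint η φ y with hX
  set β : E → Fin 4 → ℝ := fun x i => ∑ j, (g x)⁻¹ i j * fderiv ℝ φ x (e j) with hβ
  set T : E → Fin 4 → Fin 6 → ℝ := fun x i k => fderiv ℝ (fun w => X w k) x (e i) with hT
  set X₅ : E → Fin 6 → ℝ := fun x => (Real.exp (φ x))⁻¹ • blockVec 0 (fun _ => 0) 1 +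
    ∑ i, β x i • T x i - (2⁻¹ * ∑ i, fderiv ℝ φ x (e i) * β x i) • X x with hX₅
  -- The columns are the scaled cone point, its derivatives along the frame, and the null vector
  -- that completes them to a frame with Gram matrix `confForm g`.
  set S : E → Matrix (Fin 6) (Fin 6) ℝ := fun x =>
    Matrix.of fun k j => blockVec (X x) (T x) (X₅ x) j k with hS
  have hφd : ∀ x ∈ U, DifferentiableAt ℝ φ x := fun x hx =>
    (hφ.contDiffAt (hU.mem_nhds hx)).differentiableAt (by simp)
  have hyd : ∀ x ∈ U, ∀ a, DifferentiableAt ℝ (y a) x := fun x hx a =>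
    ((hy a).contDiffAt (hU.mem_nhds hx)).differentiableAt (by simp)
  have hXs : ∀ k, ContDiffOn ℝ ∞ (fun x => X x k) U := contDiffOn_scaledPoint hφ hy
  have hTs : ∀ i k, ContDiffOn ℝ ∞ (fun x => T x i k) U := fun i k =>
    ((hXs k).fderiv_of_isOpen hU (m := ∞) (by simp)).clm_apply contDiffOn_const
  have hφs : ∀ i, ContDiffOn ℝ ∞ (fun x => fderiv ℝ φ x (e i)) U := fun i =>
    (hφ.fderiv_of_isOpen hU (m := ∞) (by simp)).clm_apply contDiffOn_const
  have hβs : ∀ i, ContDiffOn ℝ ∞ (fun x => β x i) U := fun i =>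
    ContDiffOn.sum fun j _ => (contDiffOn_inv hgs hdet i j).mul (hφs j)
  have hX₅s : ∀ k, ContDiffOn ℝ ∞ (fun x => X₅ x k) U := by
    intro k
    simp only [hX₅, Pi.sub_apply, Pi.add_apply, Finset.sum_apply, Pi.smul_apply, smul_eq_mul]
    refine ((ContDiffOn.mul (hφ.exp.inv fun x _ => (Real.exp_pos _).ne') contDiffOn_const).add
      (ContDiffOn.sum fun i _ => (hβs i).mul (hTs i k))).sub
      ((contDiffOn_const.mul (ContDiffOn.sum fun i _ => (hφs i).mul (hβs i))).mul (hXs k))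
  have hSs : ∀ k j, ContDiffOn ℝ ∞ (fun x => S x k j) U := by
    intro k j
    rcases fin_six_cases j with rfl | ⟨j, rfl⟩ | rfl
    · simpa [hS] using hXs k
    · simpa [hS] using hTs j k
    · simpa [hS] using hX₅s k
  have hgram : ∀ x ∈ U, ∀ i j,
      ∑ k, ∑ l, S x k i * confForm η k l * S x l j = confForm (g x) i j := by
    intro x hx i j
    rw [← confForm_frame (g := g x) hη (Real.exp_pos (φ x)).ne'
      (y := fun a => y a x) (Υ := fun i => fderiv ℝ φ x (e i)) (β := β x)
      (z := fun i a => fderiv ℝ (y a) x (e i))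
      (fun i j => by rw [hg x hx, two_mul, Real.exp_add, sq]) (fun i => ?_) rfl
      (S := T x) (fun i => funext fun k => fderiv_scaledPoint hη (hφd x hx) (hyd x hx) k (e i))
      (S₅ := X₅ x) rfl i j, Matrix.toBilin'_apply]
    · rfl
    · have h1 : g x * (g x)⁻¹ = 1 := Matrix.mul_nonsing_inv _ (isUnit_iff_ne_zero.2 (hdet x hx))
      have h2 : (g x).mulVec ((g x)⁻¹.mulVec fun j => fderiv ℝ φ x (e j)) =
          fun j => fderiv ℝ φ x (e j) := by
        rw [Matrix.mulVec_mulVec, h1, Matrix.one_mulVec]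
      exact congrFun h2 i
  have hSdet : ∀ x ∈ U, (S x).det ≠ 0 := fun x hx =>
    det_ne_zero_of_gram (hdet x hx) (hgram x hx)
  have hXker : ∀ k, ∀ x ∈ U, ∀ v, (∀ i, θ i x v = 0) → fderiv ℝ (fun w => X w k) x v = 0 := by
    intro k x hx v hv
    rw [hX, fderiv_scaledPoint hη (hφd x hx) (hyd x hx), hφker x hx v hv]
    simp only [hyker x hx v hv]
    rcases fin_six_cases k with rfl | ⟨k, rfl⟩ | rfl <;> simp [coneTangent]
  -- X is constant along the kernel, so dX = Σ θ^i T_i. Read in the frame S, this makes (0, θ, 0)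
  -- the first column of S⁻¹dS, which is both the gauge and the soldering condition.
  have hX0 : ∀ x ∈ U, ∀ v, (fun l => pureGauge S l 0 x v) = blockVec 0 (fun i => θ i x v) 0 := by
    intro x hx v
    refine eq_of_mul_eq (hSdet x hx) fun k => ?_
    rw [mul_pureGauge (hSdet x hx)]
    have h0 := hXker k x hx (v - ∑ i, θ i x v • e i) (fun k => by simp [he x hx _ _])
    rw [map_sub, map_sum, sub_eq_zero] at h0
    simpa [sum_fin_six, hS, hT, mul_comm] using h0
  -- Along the kernel each T_j moves within the span of the T_i, with no component on X: this is
  -- horizontality of the top row.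
  have hXj : ∀ x ∈ U, ∀ v, (∀ i, θ i x v = 0) → ∀ j,
      (fun l => pureGauge S l (mid j) x v) = blockVec 0 (fun i => fderiv ℝ (θ i) x (e j) v) 0 := by
    intro x hx v hv j
    refine eq_of_mul_eq (hSdet x hx) fun k => ?_
    rw [mul_pureGauge (hSdet x hx)]
    have h0 := fderiv_fderiv_of_ker hU hθ he (hXs k) (hXker k) hx hv (e j)
    simpa [sum_fin_six, hS, hT, mul_comm] using h0
  have hcurv : ∀ x ∈ U, ∀ i j u v, curvature (pureGauge S) i j x u v = 0 :=
    fun x hx => curvature_pureGauge hU hSs hSdet hx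
  refine ⟨pureGauge S, ⟨contDiffOn_pureGauge hU hSs hSdet, fun x hx v i j =>
    conformal_pureGauge hU hSs hSdet (confForm η) (fun x => confForm (g x)) hgram hx v i j,
    fun x hx i => ?_, fun x hx => ?_, fun x hx v hv j => ?_, fun x hx u v i => hcurv x hx _ _ u v,
    fun x hx e _ v j => ?_⟩, hcurv⟩
  · ext v
    simpa using congrFun (hX0 x hx v) (mid i)
  · ext v
    simpa using congrFun (hX0 x hx v) 0
  · simpa using congrFun (hXj x hx v hv j) 0
  · exact Finset.sum_eq_zero fun i _ => hcurv x hx _ _ _ _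

end Development

/-! ### Calculus on the jet space: functions of `s` and structure equations. -/

theorem forall_fin_six {p : Fin 6 → Prop} (h0 : p 0) (h1 : p 1) (h2 : p 2) (h3 : p 3) (h4 : p 4)
    (h5 : p 5) (k : Fin 6) : p k := by
  fin_cases k <;> assumption

theorem isOpen_jetDomain {I : Set ℝ} (hI : IsOpen I) : IsOpen (jetDomain I) :=
  hI.preimage (continuous_apply 5)

theorem hasFDerivAt_comp_five {F : ℝ → ℝ} {w : Jet} (hF : DifferentiableAt ℝ F (w 5)) :
    HasFDerivAt (fun y : Jet => F (y 5)) (deriv F (w 5) • dc 5 w) w :=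
  hF.hasDerivAt.comp_hasFDerivAt w (ContinuousLinearMap.proj (R := ℝ) (φ := fun _ => ℝ) 5).hasFDerivAt

theorem contDiffOn_comp_five {I : Set ℝ} {F : ℝ → ℝ} (hF : ContDiffOn ℝ ∞ F I) :
    ContDiffOn ℝ ∞ (fun y : Jet => F (y 5)) (jetDomain I) :=
  hF.comp (contDiff_apply ℝ ℝ (5 : Fin 6)).contDiffOn fun _ hw => hw

theorem extD_sum_smul {E : Type*} [NormedAddCommGroup E] [NormedSpace ℝ E] {ι : Type*} [Fintype ι]
    {f : ι → E → ℝ} {α : ι → E → E →L[ℝ] ℝ} {x : E} (hf : ∀ k, DifferentiableAt ℝ (f k) x)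
    (hα : ∀ k, DifferentiableAt ℝ (α k) x) (u v : E) :
    extD (fun y => ∑ k, f k y • α k y) x u v =
      ∑ k, (fderiv ℝ (f k) x u * α k x v - fderiv ℝ (f k) x v * α k x u +
        f k x * extD (α k) x u v) := by
  have h : HasFDerivAt (fun y => ∑ k, f k y • α k y)
      (∑ k, (f k x • fderiv ℝ (α k) x + (fderiv ℝ (f k) x).smulRight (α k x))) x :=
    HasFDerivAt.fun_sum fun k _ => (hf k).hasFDerivAt.smul (hα k).hasFDerivAt
  rw [extD, h.fderiv]
  simp only [extD, sum_apply, add_apply, smul_apply, ContinuousLinearMap.smulRight_apply,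
    smul_eq_mul, ← Finset.sum_sub_distrib]
  exact Finset.sum_congr rfl fun k _ => by ring

section Jet

variable {I : Set ℝ} {r t h : ℝ → ℝ}

theorem omega_apply_zero (w u : Jet) : omega r t 0 w u = u 4 - w 5 * u 0 - t (w 5) * u 1 := rfl
theorem omega_apply_one (w u : Jet) : omega r t 1 w u = u 5 := rfl
theorem omega_apply_two (w u : Jet) : omega r t 2 w u = u 2 - w 3 * u 0 - w 4 * u 1 := rfl
theorem omega_apply_three (w u : Jet) : omega r t 3 w u = u 3 - r (w 5) * u 0 - w 5 * u 1 := rfl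
theorem omega_apply_four (w u : Jet) : omega r t 4 w u = u 0 := rfl
theorem omega_apply_five (w u : Jet) : omega r t 5 w u = u 1 := rfl

theorem contDiffOn_omega (hr : ContDiffOn ℝ ∞ r I) (ht : ContDiffOn ℝ ∞ t I) (k : Fin 6) :
    ContDiffOn ℝ ∞ (omega r t k) (jetDomain I) := by
  have hc : ∀ i, ContDiffOn ℝ ∞ (dc i) (jetDomain I) := fun i => contDiffOn_const
  have hp : ∀ i : Fin 6, ContDiffOn ℝ ∞ (fun w : Jet => w i) (jetDomain I) := fun i =>
    (contDiff_apply ℝ ℝ i).contDiffOn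
  have hr' := contDiffOn_comp_five hr
  have ht' := contDiffOn_comp_five ht
  revert k
  refine forall_fin_six ?_ (hc 5) ?_ ?_ (hc 0) (hc 1)
  · exact ((hc 4).sub ((hp 5).smul (hc 0))).sub (ht'.smul (hc 1))
  · exact ((hc 2).sub ((hp 3).smul (hc 0))).sub ((hp 4).smul (hc 1))
  · exact ((hc 3).sub (hr'.smul (hc 0))).sub ((hp 5).smul (hc 1))

theorem hasFDerivAt_coord (i : Fin 6) (w : Jet) :
    HasFDerivAt (fun y : Jet => y i) (dc i w) w :=
  (ContinuousLinearMap.proj (R := ℝ) (φ := fun _ => ℝ) i).hasFDerivAt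

theorem hasFDerivAt_contact {f₁ f₂ : Jet → ℝ} {f₁' f₂' : Jet →L[ℝ] ℝ} {w : Jet}
    (h₁ : HasFDerivAt f₁ f₁' w) (h₂ : HasFDerivAt f₂ f₂' w) (i : Fin 6) :
    HasFDerivAt (fun y => dc i y - f₁ y • dc 0 y - f₂ y • dc 1 y)
      (-f₁'.smulRight (dc 0 w) - f₂'.smulRight (dc 1 w)) w := by
  have h := ((hasFDerivAt_const (dc i w) w).sub (h₁.smul_const (dc 0 w))).sub
    (h₂.smul_const (dc 1 w))
  rw [zero_sub] at h
  exact h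

theorem fderiv_omega_zero {w : Jet} (ht : DifferentiableAt ℝ t (w 5)) (u v : Jet) :
    fderiv ℝ (omega r t 0) w u v = -(u 5 * v 0) - deriv t (w 5) * u 5 * v 1 := by
  have h : HasFDerivAt (omega r t 0) _ w :=
    hasFDerivAt_contact (hasFDerivAt_coord 5 w) (hasFDerivAt_comp_five ht) 4
  rw [h.fderiv]
  simp [dc]

theorem fderiv_omega_one (w u v : Jet) : fderiv ℝ (omega r t 1) w u v = 0 := by
  have h : HasFDerivAt (omega r t 1) (0 : Jet →L[ℝ] Jet →L[ℝ] ℝ) w :=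
      hasFDerivAt_const (dc 5 w) w
  rw [h.fderiv]
  simp

theorem fderiv_omega_two (w u v : Jet) :
    fderiv ℝ (omega r t 2) w u v = -(u 3 * v 0) - u 4 * v 1 := by
  have h : HasFDerivAt (omega r t 2) _ w :=
    hasFDerivAt_contact (hasFDerivAt_coord 3 w) (hasFDerivAt_coord 4 w) 2
  rw [h.fderiv]
  simp [dc]

theorem fderiv_omega_three {w : Jet} (hr : DifferentiableAt ℝ r (w 5)) (u v : Jet) :
    fderiv ℝ (omega r t 3) w u v = -(deriv r (w 5) * u 5 * v 0) - u 5 * v 1 := by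
  have h : HasFDerivAt (omega r t 3) _ w :=
    hasFDerivAt_contact (hasFDerivAt_comp_five hr) (hasFDerivAt_coord 5 w) 3
  rw [h.fderiv]
  simp [dc]

/-- The structure equations of the coframe. -/
theorem extD_omega {w : Jet} (hr : DifferentiableAt ℝ r (w 5)) (ht : DifferentiableAt ℝ t (w 5))
    (u v : Jet) :
    (fun k => extD (omega r t k) w u v) =
      ![-wedge (omega r t 1) (omega r t 4) w u v
          - deriv t (w 5) * wedge (omega r t 1) (omega r t 5) w u v,
        0,
        -wedge (omega r t 3) (omega r t 4) w u v - wedge (omega r t 0) (omega r t 5) w u v,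
        -(deriv r (w 5) * wedge (omega r t 1) (omega r t 4) w u v)
          - wedge (omega r t 1) (omega r t 5) w u v, 0, 0] := by
  funext k
  revert k
  refine forall_fin_six ?_ ?_ ?_ ?_ ?_ ?_
  · simp only [extD, fderiv_omega_zero ht, wedge, omega_apply_one, omega_apply_four,
      omega_apply_five, Matrix.cons_val]
    ring
  · simp only [extD, fderiv_omega_one, Matrix.cons_val, sub_self]
  · simp only [extD, fderiv_omega_two, wedge, omega_apply_zero, omega_apply_three,
      omega_apply_four, omega_apply_five, Matrix.cons_val]
    ring
  · simp only [extD, fderiv_omega_three hr, wedge, omega_apply_one, omega_apply_four,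
      omega_apply_five, Matrix.cons_val]
    ring
  · have h : HasFDerivAt (omega r t 4) (0 : Jet →L[ℝ] Jet →L[ℝ] ℝ) w :=
      hasFDerivAt_const (dc 0 w) w
    simp [extD, h.fderiv]
  · have h : HasFDerivAt (omega r t 5) (0 : Jet →L[ℝ] Jet →L[ℝ] ℝ) w :=
      hasFDerivAt_const (dc 1 w) w
    simp [extD, h.fderiv]

variable (r t) in
/-- The combination of the coframe with coefficients depending on `s` only. -/
noncomputable def combo (c : Fin 6 → ℝ → ℝ) : Jet → Jet →L[ℝ] ℝ :=
  fun w => ∑ k, c k (w 5) • omega r t k w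

theorem combo_apply (c : Fin 6 → ℝ → ℝ) (w u : Jet) :
    combo r t c w u = ∑ k, c k (w 5) * omega r t k w u := by
  simp [combo]

theorem contDiffOn_combo (hr : ContDiffOn ℝ ∞ r I) (ht : ContDiffOn ℝ ∞ t I)
    {c : Fin 6 → ℝ → ℝ} (hc : ∀ k, ContDiffOn ℝ ∞ (c k) I) :
    ContDiffOn ℝ ∞ (combo r t c) (jetDomain I) :=
  ContDiffOn.sum fun k _ => (contDiffOn_comp_five (hc k)).smul (contDiffOn_omega hr ht k)

/-- The coefficients are functions of `s` and ω₂ = ds, so their differentials contribute only wedges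
with `omega r t 1`. -/
theorem extD_combo (hI : IsOpen I) (hr : ContDiffOn ℝ ∞ r I) (ht : ContDiffOn ℝ ∞ t I)
    {c : Fin 6 → ℝ → ℝ} (hc : ∀ k, ContDiffOn ℝ ∞ (c k) I) {w : Jet} (hw : w ∈ jetDomain I)
    (u v : Jet) :
    extD (combo r t c) w u v =
      ∑ k, (deriv (c k) (w 5) * wedge (omega r t 1) (omega r t k) w u v +
        c k (w 5) * extD (omega r t k) w u v) := by
  have hd : ∀ {f : ℝ → ℝ}, ContDiffOn ℝ ∞ f I → DifferentiableAt ℝ f (w 5) := fun hf =>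
    (hf.contDiffAt (hI.mem_nhds hw)).differentiableAt (by simp)
  have h := extD_sum_smul (f := fun k (y : Jet) => c k (y 5)) (α := omega r t) (x := w)
    (fun k => (hasFDerivAt_comp_five (hd (hc k))).differentiableAt)
    (fun k => ((contDiffOn_omega hr ht k).contDiffAt
      ((isOpen_jetDomain hI).mem_nhds hw)).differentiableAt (by simp)) u v
  refine h.trans (Finset.sum_congr rfl fun k _ => ?_)
  rw [(hasFDerivAt_comp_five (hd (hc k))).fderiv]
  simp [wedge, omega_apply_one, dc]
  ring

end Jet

/-! ### The functions of `s` entering the connection, and their derivatives. -/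

section Connection

variable (r t h : ℝ → ℝ)

/-- `1 - r't'`. -/
noncomputable def lamFun (s : ℝ) : ℝ := 1 - deriv r s * deriv t s

/-- `f'' / (2 (1 - r't'))`. -/
noncomputable def halfSnd (f : ℝ → ℝ) (s : ℝ) : ℝ := deriv (deriv f) s / (2 * lamFun r t s)

/-- `-(1 - r't')' / (2 (1 - r't'))`. -/
noncomputable def logRate (s : ℝ) : ℝ :=
  deriv t s * halfSnd r t r s + deriv r s * halfSnd r t t s

/-- The only component of the Schouten tensor, up to sign. -/
noncomputable def schoutenFun (s : ℝ) : ℝ :=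
  (deriv r s * Z₂ r t s + deriv t s * Z₁ r t s) / 2 + deriv (deriv h) s - deriv h s ^ 2
    + 2 * logRate r t s * deriv h s - lamFun r t s * halfSnd r t r s * halfSnd r t t s

/-- `h' / (1 - r't')`. -/
noncomputable def etaFun (s : ℝ) : ℝ := deriv h s / lamFun r t s

/-- `e^{2h}`. -/
noncomputable def scaleFun (s : ℝ) : ℝ := Real.exp (2 * h s)

/-- Coefficients of the normal conformal connection in the coframe `omega`. -/
noncomputable def connCoef : Matrix (Fin 6) (Fin 6) (Fin 6 → ℝ → ℝ) :=
  !![0, 0, ![0, schoutenFun r t h, 0, 0, 0, 0], 0, 0, 0;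
     ![1, 0, 0, 0, 0, 0],
       ![0, fun s => deriv h s - deriv t s * halfSnd r t r s, 0, 0, 0, 0],
       ![fun s => deriv h s - deriv t s * halfSnd r t r s, 0, 0, fun s => -halfSnd r t t s,
         fun _ => -1, fun s => -deriv t s],
       0, ![0, fun s => -halfSnd r t t s, 0, 0, 0, 0], 0;
     ![0, 1, 0, 0, 0, 0], 0,
       ![0, fun s => 2 * deriv h s - 2 * logRate r t s, 0, 0, 0, 0], 0, 0, 0;
     ![0, 0, 1, 0, 0, 0],
       ![fun s => -halfSnd r t r s - deriv r s * etaFun r t h s, 0, 0, etaFun r t h, 0,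
         fun _ => -1],
       0, 0,
       ![etaFun r t h, 0, 0, fun s => -halfSnd r t t s - deriv t s * etaFun r t h s,
         fun _ => -1, 0],
       ![0, fun s => schoutenFun r t h s / (scaleFun h s * lamFun r t s), 0, 0, 0, 0];
     ![0, 0, 0, 1, 0, 0], ![0, fun s => -halfSnd r t r s, 0, 0, 0, 0],
       ![fun s => -halfSnd r t r s, 0, 0, fun s => deriv h s - deriv r s * halfSnd r t t s,
         fun s => -deriv r s, fun _ => -1],
       0, ![0, fun s => deriv h s - deriv r s * halfSnd r t t s, 0, 0, 0, 0], 0;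
     0, ![fun s => scaleFun h s * deriv r s, 0, 0, fun s => -scaleFun h s, 0, 0],
       ![0, 0, fun s => scaleFun h s * lamFun r t s, 0, 0, 0],
       ![0, fun s => scaleFun h s * lamFun r t s, 0, 0, 0, 0],
       ![fun s => -scaleFun h s, 0, 0, fun s => scaleFun h s * deriv t s, 0, 0], 0]

/-- The normal conformal connection. -/
noncomputable def conn : Matrix (Fin 6) (Fin 6) (Jet → Jet →L[ℝ] ℝ) :=
  Matrix.of fun i j => combo r t (connCoef r t h i j)

variable {r t h} {I : Set ℝ}

/-- The hypotheses on `r`, `t`, `h`. -/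
structure Admissible (I : Set ℝ) (r t h : ℝ → ℝ) : Prop where
  isOpen : IsOpen I
  smooth_r : ContDiffOn ℝ ∞ r I
  smooth_t : ContDiffOn ℝ ∞ t I
  smooth_h : ContDiffOn ℝ ∞ h I
  lam : ∀ s ∈ I, lamFun r t s ≠ 0

namespace Admissible

theorem contDiffOn_deriv {f : ℝ → ℝ} (hI : IsOpen I) (hf : ContDiffOn ℝ ∞ f I) :
    ContDiffOn ℝ ∞ (deriv f) I := hf.deriv_of_isOpen hI (by simp)

theorem differentiableAt {f : ℝ → ℝ} (hI : IsOpen I) (hf : ContDiffOn ℝ ∞ f I) {s : ℝ}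
    (hs : s ∈ I) : DifferentiableAt ℝ f s :=
  (hf.contDiffAt (hI.mem_nhds hs)).differentiableAt (by simp)

theorem r' (H : Admissible I r t h) : ContDiffOn ℝ ∞ (deriv r) I := contDiffOn_deriv H.isOpen H.smooth_r
theorem t' (H : Admissible I r t h) : ContDiffOn ℝ ∞ (deriv t) I := contDiffOn_deriv H.isOpen H.smooth_t
theorem h' (H : Admissible I r t h) : ContDiffOn ℝ ∞ (deriv h) I := contDiffOn_deriv H.isOpen H.smooth_h
theorem h'' (H : Admissible I r t h) : ContDiffOn ℝ ∞ (deriv (deriv h)) I :=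
  contDiffOn_deriv H.isOpen H.h'

theorem contDiffOn_lamFun (H : Admissible I r t h) : ContDiffOn ℝ ∞ (lamFun r t) I :=
  contDiffOn_const.sub (H.r'.mul H.t')

theorem contDiffOn_halfSnd (H : Admissible I r t h) {f : ℝ → ℝ} (hf : ContDiffOn ℝ ∞ f I) :
    ContDiffOn ℝ ∞ (halfSnd r t f) I :=
  (contDiffOn_deriv H.isOpen (contDiffOn_deriv H.isOpen hf)).div
    (contDiffOn_const.mul H.contDiffOn_lamFun) fun s hs => mul_ne_zero two_ne_zero (H.lam s hs)

theorem contDiffOn_logRate (H : Admissible I r t h) : ContDiffOn ℝ ∞ (logRate r t) I :=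
  (H.t'.mul (H.contDiffOn_halfSnd H.smooth_r)).add (H.r'.mul (H.contDiffOn_halfSnd H.smooth_t))

theorem contDiffOn_etaFun (H : Admissible I r t h) : ContDiffOn ℝ ∞ (etaFun r t h) I :=
  H.h'.div H.contDiffOn_lamFun H.lam

theorem contDiffOn_scaleFun (H : Admissible I r t h) : ContDiffOn ℝ ∞ (scaleFun h) I :=
  (contDiffOn_const.mul H.smooth_h).exp

theorem deriv_deriv_r {s : ℝ} (H : Admissible I r t h) (hs : s ∈ I) :
    deriv (deriv r) s = 2 * lamFun r t s * halfSnd r t r s := by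
  have := H.lam s hs
  rw [halfSnd]; field_simp

theorem deriv_deriv_t {s : ℝ} (H : Admissible I r t h) (hs : s ∈ I) :
    deriv (deriv t) s = 2 * lamFun r t s * halfSnd r t t s := by
  have := H.lam s hs
  rw [halfSnd]; field_simp

theorem hasDerivAt_lamFun {s : ℝ} (H : Admissible I r t h) (hs : s ∈ I) :
    HasDerivAt (lamFun r t) (-2 * lamFun r t s * logRate r t s) s := by
  have h1 := ((differentiableAt H.isOpen H.r' hs).hasDerivAt.mul
    (differentiableAt H.isOpen H.t' hs).hasDerivAt).const_sub 1
  refine h1.congr_deriv ?_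
  rw [H.deriv_deriv_r hs, H.deriv_deriv_t hs, logRate]
  ring

/-- This trades third derivatives for Z, so that later identities are rational in the symbols L,
m_r, m_t, Z₁, Z₂. -/
theorem zInv_eq {s : ℝ} (H : Admissible I r t h) (hs : s ∈ I) (f : ℝ → ℝ) :
    zInv f r t s = -(deriv (deriv (deriv f)) s / (2 * lamFun r t s))
      - 3 * halfSnd r t f s * logRate r t s := by
  have h0 := H.lam s hs
  have h1 : deriv (fun σ => deriv t σ * deriv r σ) s =
      2 * lamFun r t s * logRate r t s := by
    have h2 : HasDerivAt (fun σ => deriv t σ * deriv r σ) _ s :=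
      (differentiableAt H.isOpen H.t' hs).hasDerivAt.mul
        (differentiableAt H.isOpen H.r' hs).hasDerivAt
    rw [h2.deriv, H.deriv_deriv_r hs,
      H.deriv_deriv_t hs, logRate]
    ring
  have h2 : deriv (deriv f) s = 2 * lamFun r t s * halfSnd r t f s := by
    rw [halfSnd]; field_simp
  rw [zInv, h1]
  simp only [iteratedDeriv_succ, iteratedDeriv_zero]
  rw [h2]
  have h3 : 1 - deriv r s * deriv t s = lamFun r t s := rfl
  have h4 : deriv r s * deriv t s - 1 = -lamFun r t s := by rw [lamFun]; ring
  rw [h3, h4]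
  field_simp
  ring

/-- Differentiating 1/L contributes +2 times m_f ρ, with ρ = `logRate`, against the -3 in `zInv_eq`,
leaving -1. Consequently Z_f = 0 means that m_f solves the same linear equation y' = -ρy as √|L|. -/
theorem hasDerivAt_halfSnd {s : ℝ} (H : Admissible I r t h) (hs : s ∈ I) {f : ℝ → ℝ}
    (hf : ContDiffOn ℝ ∞ f I) :
    HasDerivAt (halfSnd r t f) (-zInv f r t s - halfSnd r t f s * logRate r t s) s := by
  have h0 := H.lam s hs
  have h1 := (differentiableAt H.isOpen (contDiffOn_deriv H.isOpen
    (contDiffOn_deriv H.isOpen hf)) hs).hasDerivAt.div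
    ((H.hasDerivAt_lamFun hs).const_mul 2) (mul_ne_zero two_ne_zero h0)
  refine h1.congr_deriv ?_
  have h2 : deriv (deriv f) s = 2 * lamFun r t s * halfSnd r t f s := by
    rw [halfSnd]; field_simp
  rw [H.zInv_eq hs, h2]
  field_simp
  ring

/-- Solving the derivative formula for Z gives smoothness without iterated derivatives. -/
theorem contDiffOn_zInv (H : Admissible I r t h) {f : ℝ → ℝ} (hf : ContDiffOn ℝ ∞ f I) :
    ContDiffOn ℝ ∞ (zInv f r t) I := by
  have h1 : ContDiffOn ℝ ∞ (fun s => -deriv (halfSnd r t f) s - halfSnd r t f s * logRate r t s) I :=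
    (contDiffOn_deriv H.isOpen (H.contDiffOn_halfSnd hf)).neg.sub
      ((H.contDiffOn_halfSnd hf).mul H.contDiffOn_logRate)
  refine h1.congr fun s hs => ?_
  rw [(H.hasDerivAt_halfSnd hs hf).deriv]
  ring

theorem contDiffOn_schoutenFun (H : Admissible I r t h) : ContDiffOn ℝ ∞ (schoutenFun r t h) I :=
  (((((H.r'.mul (H.contDiffOn_zInv H.smooth_t)).add (H.t'.mul (H.contDiffOn_zInv H.smooth_r))).div_const 2).add
    H.h'').sub (H.h'.pow 2)).add ((contDiffOn_const.mul H.contDiffOn_logRate).mul H.h')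
    |>.sub ((H.contDiffOn_lamFun.mul (H.contDiffOn_halfSnd H.smooth_r)).mul (H.contDiffOn_halfSnd H.smooth_t))

theorem hasDerivAt_etaFun {s : ℝ} (H : Admissible I r t h) (hs : s ∈ I) :
    HasDerivAt (etaFun r t h)
      (deriv (deriv h) s / lamFun r t s + 2 * etaFun r t h s * logRate r t s) s := by
  have h0 := H.lam s hs
  refine ((differentiableAt H.isOpen H.h' hs).hasDerivAt.div
    (H.hasDerivAt_lamFun hs) h0).congr_deriv ?_
  rw [etaFun]
  field_simp
  ring

theorem hasDerivAt_scaleFun {s : ℝ} (H : Admissible I r t h) (hs : s ∈ I) :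
    HasDerivAt (scaleFun h) (2 * deriv h s * scaleFun h s) s := by
  refine ((differentiableAt H.isOpen H.smooth_h hs).hasDerivAt.const_mul 2).exp.congr_deriv ?_
  rw [scaleFun]
  ring

theorem contDiffOn_connCoef (H : Admissible I r t h) :
    ∀ i j k, ContDiffOn ℝ ∞ (connCoef r t h i j k) I := by
  have hc : ∀ c : ℝ, ContDiffOn ℝ ∞ (fun _ : ℝ => c) I := fun c => contDiffOn_const
  have c0 : ContDiffOn ℝ ∞ (0 : ℝ → ℝ) I := contDiffOn_const
  have c1 : ContDiffOn ℝ ∞ (1 : ℝ → ℝ) I := contDiffOn_const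
  have h0 : ∀ k, ContDiffOn ℝ ∞ ((0 : Fin 6 → ℝ → ℝ) k) I := fun _ => contDiffOn_const
  have hT := H.contDiffOn_schoutenFun
  have hr2 := H.contDiffOn_halfSnd H.smooth_r
  have ht2 := H.contDiffOn_halfSnd H.smooth_t
  have hη := H.contDiffOn_etaFun
  have hE := H.contDiffOn_scaleFun
  have hL := H.contDiffOn_lamFun
  have hk1 := H.h'.sub (H.t'.mul hr2)
  have hk2 := H.h'.sub (H.r'.mul ht2)
  refine forall_fin_six
    (forall_fin_six h0 h0 (forall_fin_six c0 hT c0 c0 c0 c0) h0 h0 h0)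
    (forall_fin_six (forall_fin_six c1 c0 c0 c0 c0 c0) (forall_fin_six c0 hk1 c0 c0 c0 c0)
      (forall_fin_six hk1 c0 c0 ht2.neg (hc _) H.t'.neg) h0
      (forall_fin_six c0 ht2.neg c0 c0 c0 c0) h0)
    (forall_fin_six (forall_fin_six c0 c1 c0 c0 c0 c0) h0 (forall_fin_six c0
      ((contDiffOn_const.mul H.h').sub (contDiffOn_const.mul H.contDiffOn_logRate)) c0 c0 c0 c0)
      h0 h0 h0)
    (forall_fin_six (forall_fin_six c0 c0 c1 c0 c0 c0)
      (forall_fin_six (hr2.neg.sub (H.r'.mul hη)) c0 c0 hη c0 (hc _)) h0 h0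
      (forall_fin_six hη c0 c0 (ht2.neg.sub (H.t'.mul hη)) (hc _) c0)
      (forall_fin_six c0 (hT.div (hE.mul hL) fun s hs =>
        mul_ne_zero (Real.exp_pos _).ne' (H.lam s hs)) c0 c0 c0 c0))
    (forall_fin_six (forall_fin_six c0 c0 c0 c1 c0 c0) (forall_fin_six c0 hr2.neg c0 c0 c0 c0)
      (forall_fin_six hr2.neg c0 c0 hk2 H.r'.neg (hc _)) h0
      (forall_fin_six c0 hk2 c0 c0 c0 c0) h0)
    (forall_fin_six h0 (forall_fin_six (hE.mul H.r') c0 c0 hE.neg c0 c0)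
      (forall_fin_six c0 c0 (hE.mul hL) c0 c0 c0) (forall_fin_six c0 (hE.mul hL) c0 c0 c0 c0)
      (forall_fin_six hE.neg c0 c0 (hE.mul H.t') c0 c0) h0)

end Admissible

end Connection

/-! ### Curvature of the explicit connection. -/

/-- The values of the connection forms in terms of the values `U` of the coframe. -/
noncomputable def connVal (a b L m₁ m₂ h₁ η T κ E : ℝ) (U : Fin 6 → ℝ) :
    Matrix (Fin 6) (Fin 6) ℝ :=
  !![0, 0, T * U 1, 0, 0, 0;
     U 0, (h₁ - b * m₁) * U 1, (h₁ - b * m₁) * U 0 - m₂ * U 3 - U 4 - b * U 5, 0, -m₂ * U 1, 0;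
     U 1, 0, (2 * h₁ - 2 * (b * m₁ + a * m₂)) * U 1, 0, 0, 0;
     U 2, (-m₁ - a * η) * U 0 + η * U 3 - U 5, 0, 0, η * U 0 + (-m₂ - b * η) * U 3 - U 4, κ * U 1;
     U 3, -m₁ * U 1, -m₁ * U 0 + (h₁ - a * m₂) * U 3 - a * U 4 - U 5, 0, (h₁ - a * m₂) * U 1, 0;
     0, E * a * U 0 - E * U 3, E * L * U 2, E * L * U 1, -E * U 0 + E * b * U 3, 0]

/-- The values of the exterior derivatives of the connection forms; `W k l` are the values of the
wedge products and `D k` those of the exterior derivatives of the coframe. -/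
noncomputable def dconnVal (a b L m₁ m₂ h₁ η E dk₁ dk₂ dm₁ dm₂ dη : ℝ) (W : Fin 6 → ℝ)
    (D : Fin 6 → ℝ) : Matrix (Fin 6) (Fin 6) ℝ :=
  !![0, 0, 0, 0, 0, 0;
     D 0, 0, dk₁ * W 0 + (h₁ - b * m₁) * D 0 - dm₂ * W 3 - m₂ * D 3 - 2 * L * m₂ * W 5, 0, 0, 0;
     0, 0, 0, 0, 0, 0;
     D 2, (-dm₁ - 2 * L * m₁ * η - a * dη) * W 0 + (-m₁ - a * η) * D 0 + dη * W 3 + η * D 3, 0, 0,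
       dη * W 0 + η * D 0 + (-dm₂ - 2 * L * m₂ * η - b * dη) * W 3 + (-m₂ - b * η) * D 3, 0;
     D 3, 0, -dm₁ * W 0 - m₁ * D 0 + dk₂ * W 3 + (h₁ - a * m₂) * D 3 - 2 * L * m₁ * W 4, 0, 0, 0;
     0, (2 * h₁ * E * a + E * (2 * L * m₁)) * W 0 + E * a * D 0 - 2 * h₁ * E * W 3 - E * D 3,
       (2 * h₁ * E * L - E * (2 * L * (b * m₁ + a * m₂))) * W 2 + E * L * D 2, 0,
       -2 * h₁ * E * W 0 - E * D 0 + (2 * h₁ * E * b + E * (2 * L * m₂)) * W 3 + E * b * D 3, 0]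

variable {I : Set ℝ} {r t h : ℝ → ℝ}

theorem combo_zero (w u : Jet) : combo r t 0 w u = 0 := by simp [combo_apply]

theorem conn_apply (w u : Jet) (i j : Fin 6) : conn r t h i j w u =
    connVal (deriv r (w 5)) (deriv t (w 5)) (lamFun r t (w 5)) (halfSnd r t r (w 5))
      (halfSnd r t t (w 5)) (deriv h (w 5)) (etaFun r t h (w 5)) (schoutenFun r t h (w 5))
      (schoutenFun r t h (w 5) / (scaleFun h (w 5) * lamFun r t (w 5))) (scaleFun h (w 5))
      (fun k => omega r t k w u) i j := by
  have h0 := combo_zero (r := r) (t := t) w u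
  revert i j
  refine forall_fin_six ?_ ?_ ?_ ?_ ?_ ?_ <;> refine forall_fin_six ?_ ?_ ?_ ?_ ?_ ?_
  all_goals
    first
    | exact h0
    | (simp [conn, combo_apply, connCoef, connVal, Fin.sum_univ_six, logRate]; try ring1)

namespace Admissible

/-- Forms f(s) ds are closed, whence the many zero entries of `dconnVal`. The rules collected inside
rewrite derivatives of composite coefficients in the symbols used by the algebraic identity. -/
theorem extD_conn (H : Admissible I r t h) {w : Jet} (hw : w ∈ jetDomain I) (u v : Jet)
    (i j : Fin 6) : extD (conn r t h i j) w u v =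
    dconnVal (deriv r (w 5)) (deriv t (w 5)) (lamFun r t (w 5)) (halfSnd r t r (w 5))
      (halfSnd r t t (w 5)) (deriv h (w 5)) (etaFun r t h (w 5)) (scaleFun h (w 5))
      (deriv (fun s => deriv h s - deriv t s * halfSnd r t r s) (w 5))
      (deriv (fun s => deriv h s - deriv r s * halfSnd r t t s) (w 5))
      (deriv (halfSnd r t r) (w 5)) (deriv (halfSnd r t t) (w 5)) (deriv (etaFun r t h) (w 5))
      (fun k => wedge (omega r t 1) (omega r t k) w u v)
      (fun k => extD (omega r t k) w u v) i j := by
  have hd : ∀ {f : ℝ → ℝ}, ContDiffOn ℝ ∞ f I → HasDerivAt f (deriv f (w 5)) (w 5) := fun hf =>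
    (Admissible.differentiableAt H.isOpen hf hw).hasDerivAt
  have h1 := fun i j => extD_combo H.isOpen H.smooth_r H.smooth_t (H.contDiffOn_connCoef i j) hw u v
  have e1 : deriv (fun s => -halfSnd r t r s - deriv r s * etaFun r t h s) (w 5) =
      -deriv (halfSnd r t r) (w 5) - 2 * lamFun r t (w 5) * halfSnd r t r (w 5) *
        etaFun r t h (w 5) - deriv r (w 5) * deriv (etaFun r t h) (w 5) := by
    have h2 : HasDerivAt (fun s => -halfSnd r t r s - deriv r s * etaFun r t h s) _ (w 5) :=
      (hd (H.contDiffOn_halfSnd H.smooth_r)).neg.sub ((hd H.r').mul (hd H.contDiffOn_etaFun))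
    rw [h2.deriv, H.deriv_deriv_r hw]; ring
  have e2 : deriv (fun s => -halfSnd r t t s - deriv t s * etaFun r t h s) (w 5) =
      -deriv (halfSnd r t t) (w 5) - 2 * lamFun r t (w 5) * halfSnd r t t (w 5) *
        etaFun r t h (w 5) - deriv t (w 5) * deriv (etaFun r t h) (w 5) := by
    have h2 : HasDerivAt (fun s => -halfSnd r t t s - deriv t s * etaFun r t h s) _ (w 5) :=
      (hd (H.contDiffOn_halfSnd H.smooth_t)).neg.sub ((hd H.t').mul (hd H.contDiffOn_etaFun))
    rw [h2.deriv, H.deriv_deriv_t hw]; ring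
  have hE := H.hasDerivAt_scaleFun hw
  have e3 : deriv (fun s => scaleFun h s * deriv r s) (w 5) =
      2 * deriv h (w 5) * scaleFun h (w 5) * deriv r (w 5) +
        scaleFun h (w 5) * (2 * lamFun r t (w 5) * halfSnd r t r (w 5)) := by
    have h2 : HasDerivAt (fun s => scaleFun h s * deriv r s) _ (w 5) := hE.mul (hd H.r')
    rw [h2.deriv, H.deriv_deriv_r hw]
  have e4 : deriv (fun s => scaleFun h s * deriv t s) (w 5) =
      2 * deriv h (w 5) * scaleFun h (w 5) * deriv t (w 5) +
        scaleFun h (w 5) * (2 * lamFun r t (w 5) * halfSnd r t t (w 5)) := by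
    have h2 : HasDerivAt (fun s => scaleFun h s * deriv t s) _ (w 5) := hE.mul (hd H.t')
    rw [h2.deriv, H.deriv_deriv_t hw]
  have e5 : deriv (fun s => scaleFun h s * lamFun r t s) (w 5) =
      2 * deriv h (w 5) * scaleFun h (w 5) * lamFun r t (w 5) -
        scaleFun h (w 5) * (2 * lamFun r t (w 5) * logRate r t (w 5)) := by
    have h2 : HasDerivAt (fun s => scaleFun h s * lamFun r t s) _ (w 5) :=
      hE.mul (H.hasDerivAt_lamFun hw)
    rw [h2.deriv]; ring
  have e6 : deriv (fun s => -scaleFun h s) (w 5) = -(2 * deriv h (w 5) * scaleFun h (w 5)) :=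
    hE.neg.deriv
  have e7 : deriv (fun s => -halfSnd r t r s) (w 5) = -deriv (halfSnd r t r) (w 5) :=
    (hd (H.contDiffOn_halfSnd H.smooth_r)).neg.deriv
  have e8 : deriv (fun s => -halfSnd r t t s) (w 5) = -deriv (halfSnd r t t) (w 5) :=
    (hd (H.contDiffOn_halfSnd H.smooth_t)).neg.deriv
  have e9 : deriv (fun s => -deriv r s) (w 5) = -(2 * lamFun r t (w 5) * halfSnd r t r (w 5)) := by
    rw [← H.deriv_deriv_r hw]; exact (hd H.r').neg.deriv
  have e10 : deriv (fun s => -deriv t s) (w 5) = -(2 * lamFun r t (w 5) * halfSnd r t t (w 5)) := by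
    rw [← H.deriv_deriv_t hw]; exact (hd H.t').neg.deriv
  have e11 : ∀ c : ℝ, deriv (fun _ : ℝ => c) (w 5) = 0 := fun c => deriv_const _ _
  have e12 : deriv (0 : ℝ → ℝ) (w 5) = 0 := e11 0
  have e13 : deriv (1 : ℝ → ℝ) (w 5) = 0 := e11 1
  have hw11 : wedge (omega r t 1) (omega r t 1) w u v = 0 := by rw [wedge]; ring
  have hstr := extD_omega (Admissible.differentiableAt H.isOpen H.smooth_r hw)
    (Admissible.differentiableAt H.isOpen H.smooth_t hw) u v
  have hD1 : extD (omega r t 1) w u v = 0 := congrFun hstr 1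
  have hD4 : extD (omega r t 4) w u v = 0 := congrFun hstr 4
  have hD5 : extD (omega r t 5) w u v = 0 := congrFun hstr 5
  have h0 : extD (combo r t 0) w u v = 0 := by
    have : combo r t 0 = fun _ => 0 := by
      funext w
      ext u
      simp [combo_apply]
    simp [this, extD]
  revert i j
  refine forall_fin_six ?_ ?_ ?_ ?_ ?_ ?_ <;> refine forall_fin_six ?_ ?_ ?_ ?_ ?_ ?_
  all_goals
    first
    | exact h0
    | (refine (h1 _ _).trans ?_
       simp [connCoef, dconnVal, Fin.sum_univ_six, e1, e2, e3, e4, e5, e6, e7, e8, e9, e10, e12,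
         e13, hw11, hD1, hD4, hD5, logRate]
       try ring1)

end Admissible

variable {I : Set ℝ} {r t h : ℝ → ℝ}

/-- The curvature of the explicit connection, as an identity between polynomials in the jets. -/
theorem curvature_algebra (a b m₁ m₂ z₁ z₂ h₁ h₂ E : ℝ) (hL : 1 - a * b ≠ 0) (hE : E ≠ 0)
    (U V : Fin 6 → ℝ) (i j : Fin 6) :
    let L := 1 - a * b
    let P := b * m₁ + a * m₂
    let η := h₁ / L
    let T := (a * z₂ + b * z₁) / 2 + h₂ - h₁ ^ 2 + 2 * P * h₁ - L * m₁ * m₂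
    let W := fun k l => U k * V l - V k * U l
    dconnVal a b L m₁ m₂ h₁ η E (h₂ - 2 * L * m₂ * m₁ - b * (-z₁ - m₁ * P))
        (h₂ - 2 * L * m₁ * m₂ - a * (-z₂ - m₂ * P)) (-z₁ - m₁ * P) (-z₂ - m₂ * P)
        (h₂ / L + 2 * η * P) (W 1)
        ![-W 1 4 - b * W 1 5, 0, -W 3 4 - W 0 5, -(a * W 1 4) - W 1 5, 0, 0] i j +
      ∑ k, (connVal a b L m₁ m₂ h₁ η T (T / (E * L)) E U i k *
        connVal a b L m₁ m₂ h₁ η T (T / (E * L)) E V k j -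
        connVal a b L m₁ m₂ h₁ η T (T / (E * L)) E V i k *
        connVal a b L m₁ m₂ h₁ η T (T / (E * L)) E U k j) =
    !![0, 0, 0, 0, 0, 0;
     0, 0, z₂, 0, 0, 0;
     0, 0, 0, 0, 0, 0;
     0, (-z₂ * a - z₁ * b) / (2 * (1 - a * b)), 0, 0,
       (2 * z₂ + z₁ * b ^ 2 - z₂ * a * b) / (2 * (1 - a * b)), 0;
     0, 0, (z₂ * a - z₁ * b) / 2, 0, 0, 0;
     0, 0, 0, 0, 0, (0 : ℝ)] i j * W 1 3 +
    !![0, 0, 0, 0, 0, 0;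
     0, 0, (z₂ * a - z₁ * b) / 2, 0, 0, 0;
     0, 0, 0, 0, 0, 0;
     0, (z₁ * a * b - 2 * z₁ - z₂ * a ^ 2) / (2 * (1 - a * b)), 0, 0,
       (z₂ * a + z₁ * b) / (2 * (1 - a * b)), 0;
     0, 0, -z₁, 0, 0, 0;
     0, 0, 0, 0, 0, (0 : ℝ)] i j * W 0 1 := by
  intro L P η T W
  -- D keeps 1 - ab atomic while denominators are cleared; the polynomial identity afterwards needs
  -- it expanded again.
  obtain ⟨D, hD⟩ : ∃ D, D = 1 - a * b := ⟨_, rfl⟩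
  rw [← hD] at hL
  revert i j
  refine forall_fin_six ?_ ?_ ?_ ?_ ?_ ?_ <;> refine forall_fin_six ?_ ?_ ?_ ?_ ?_ ?_
  all_goals
    simp only [Fin.sum_univ_six, connVal, dconnVal, Matrix.of_apply, Matrix.cons_val, L, P, η, T, W, ← hD]
    field_simp
    subst hD
    ring

namespace Admissible

/-- The curvature of the normal conformal connection. -/
theorem curvature_conn (H : Admissible I r t h) {w : Jet} (hw : w ∈ jetDomain I) (u v : Jet)
    (i j : Fin 6) : curvature (conn r t h) i j w u v =
      curvMatrix₂₄ r t (w 5) i j * wedge (omega r t 1) (omega r t 3) w u v +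
        curvMatrix₁₂ r t (w 5) i j * wedge (omega r t 0) (omega r t 1) w u v := by
  have hd : ∀ {f : ℝ → ℝ}, ContDiffOn ℝ ∞ f I → HasDerivAt f (deriv f (w 5)) (w 5) := fun hf =>
    (Admissible.differentiableAt H.isOpen hf hw).hasDerivAt
  have hm₁ := H.hasDerivAt_halfSnd hw H.smooth_r
  have hm₂ := H.hasDerivAt_halfSnd hw H.smooth_t
  have d1 : HasDerivAt (fun s => deriv h s - deriv t s * halfSnd r t r s) _ (w 5) :=
    (hd H.h').sub ((hd H.t').mul hm₁)
  have d2 : HasDerivAt (fun s => deriv h s - deriv r s * halfSnd r t t s) _ (w 5) :=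
    (hd H.h').sub ((hd H.r').mul hm₂)
  have hstr := extD_omega (Admissible.differentiableAt H.isOpen H.smooth_r hw)
    (Admissible.differentiableAt H.isOpen H.smooth_t hw) u v
  have key := curvature_algebra (deriv r (w 5)) (deriv t (w 5)) (halfSnd r t r (w 5))
    (halfSnd r t t (w 5)) (Z₁ r t (w 5)) (Z₂ r t (w 5)) (deriv h (w 5)) (deriv (deriv h) (w 5))
    (scaleFun h (w 5)) (H.lam _ hw) (Real.exp_pos _).ne' (fun k => omega r t k w u)
    (fun k => omega r t k w v) i j
  refine Eq.trans ?_ key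
  simp only [curvature, wedge, H.extD_conn hw, conn_apply, hstr, d1.deriv, d2.deriv, hm₁.deriv,
    hm₂.deriv, (H.hasDerivAt_etaFun hw).deriv, H.deriv_deriv_r hw, H.deriv_deriv_t hw]
  simp only [lamFun, etaFun, schoutenFun, logRate, Z₁, Z₂, sub_sub]

end Admissible

/-! ### The explicit connection is normal. -/

theorem forall_fin_four {p : Fin 4 → Prop} (h0 : p 0) (h1 : p 1) (h2 : p 2) (h3 : p 3)
    (k : Fin 4) : p k := by
  fin_cases k <;> assumption

theorem mid_zero : mid 0 = 1 := rfl
theorem mid_one : mid 1 = 2 := rfl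
theorem mid_two : mid 2 = 3 := rfl
theorem mid_three : mid 3 = 4 := rfl

/-- A constant frame dual to `omega4`. -/
def jetFrame : Fin 4 → Jet := ![Pi.single 4 1, Pi.single 5 1, Pi.single 2 1, Pi.single 3 1]

variable {I : Set ℝ} {r t h : ℝ → ℝ}

theorem isDualFrame_jetFrame (w : Jet) : IsDualFrame (omega4 r t) w jetFrame := by
  have h0 : ∀ u, omega4 r t 0 w u = u 4 - w 5 * u 0 - t (w 5) * u 1 := fun _ => rfl
  have h1 : ∀ u, omega4 r t 1 w u = u 5 := fun _ => rfl
  have h2 : ∀ u, omega4 r t 2 w u = u 2 - w 3 * u 0 - w 4 * u 1 := fun _ => rfl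
  have h3 : ∀ u, omega4 r t 3 w u = u 3 - r (w 5) * u 0 - w 5 * u 1 := fun _ => rfl
  refine forall_fin_four ?_ ?_ ?_ ?_ <;> refine forall_fin_four ?_ ?_ ?_ ?_ <;>
    simp [h0, h1, h2, h3, jetFrame]

theorem gram_eq (w : Jet) : gram r t h w = scaleFun h (w 5) •
    !![deriv r (w 5), 0, 0, -1; 0, 0, lamFun r t (w 5), 0; 0, lamFun r t (w 5), 0, 0;
      -1, 0, 0, deriv t (w 5)] := rfl

theorem gram_symm (w : Jet) (i j : Fin 4) : gram r t h w i j = gram r t h w j i := by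
  revert i j
  refine forall_fin_four ?_ ?_ ?_ ?_ <;> refine forall_fin_four ?_ ?_ ?_ ?_ <;> rfl

theorem det_gram (w : Jet) :
    (gram r t h w).det = scaleFun h (w 5) ^ 4 * lamFun r t (w 5) ^ 3 := by
  rw [gram_eq, Matrix.det_smul]
  simp [Matrix.det_succ_row_zero, Fin.sum_univ_succ, Fin.succAbove]
  rw [lamFun]
  ring_nf
  simp

theorem linearIndependent_omega (w : Jet) : LinearIndependent ℝ (fun i => omega r t i w) := by
  rw [Fintype.linearIndependent_iff]
  intro c hc
  have h1 : ∀ u : Jet, ∑ i, c i * omega r t i w u = 0 := fun u => by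
    simpa using congrArg (fun f : Jet →L[ℝ] ℝ => f u) hc
  simp only [Fin.sum_univ_six, omega_apply_zero, omega_apply_one, omega_apply_two,
    omega_apply_three, omega_apply_four, omega_apply_five] at h1
  have c1 : c 1 = 0 := by simpa using h1 (Pi.single 5 1)
  have c2 : c 2 = 0 := by simpa using h1 (Pi.single 2 1)
  have c3 : c 3 = 0 := by simpa using h1 (Pi.single 3 1)
  have c0 : c 0 = 0 := by simpa using h1 (Pi.single 4 1)
  have c4 : c 4 = 0 := by simpa [c0, c2, c3] using h1 (Pi.single 0 1)
  have c5 : c 5 = 0 := by simpa [c0, c2, c3] using h1 (Pi.single 1 1)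
  exact forall_fin_six c0 c1 c2 c3 c4 c5

theorem gConf_eq (w u v : Jet) : gConf r t h w u v =
    ∑ i, ∑ j, gram r t h w i j * (omega4 r t i w u * omega4 r t j w v) := by
  have h0 : ∀ u, omega4 r t 0 w u = u 4 - w 5 * u 0 - t (w 5) * u 1 := fun _ => rfl
  have h1 : ∀ u, omega4 r t 1 w u = u 5 := fun _ => rfl
  have h2 : ∀ u, omega4 r t 2 w u = u 2 - w 3 * u 0 - w 4 * u 1 := fun _ => rfl
  have h3 : ∀ u, omega4 r t 3 w u = u 3 - r (w 5) * u 0 - w 5 * u 1 := fun _ => rfl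
  simp only [Fin.sum_univ_four, h0, h1, h2, h3, gram_eq, gConf, gZero, symProd]
  simp [dc, scaleFun, lamFun]
  ring

theorem contDiffOn_omega4 (hr : ContDiffOn ℝ ∞ r I) (ht : ContDiffOn ℝ ∞ t I) (k : Fin 4) :
    ContDiffOn ℝ ∞ (omega4 r t k) (jetDomain I) := contDiffOn_omega hr ht _

namespace Admissible

theorem det_gram_ne_zero (H : Admissible I r t h) {w : Jet} (hw : w ∈ jetDomain I) :
    (gram r t h w).det ≠ 0 := by
  rw [det_gram]
  exact mul_ne_zero (pow_ne_zero _ (Real.exp_pos _).ne') (pow_ne_zero _ (H.lam _ hw))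

theorem contDiffOn_gram (H : Admissible I r t h) (i j : Fin 4) :
    ContDiffOn ℝ ∞ (fun w => gram r t h w i j) (jetDomain I) := by
  have hE := contDiffOn_comp_five H.contDiffOn_scaleFun
  have hL := contDiffOn_comp_five H.contDiffOn_lamFun
  have hr := contDiffOn_comp_five H.r'
  have ht := contDiffOn_comp_five H.t'
  have h0 : ContDiffOn ℝ ∞ (fun w => scaleFun h (w 5) * 0) (jetDomain I) :=
    hE.mul contDiffOn_const
  have h1 : ContDiffOn ℝ ∞ (fun w => scaleFun h (w 5) * -1) (jetDomain I) :=
    hE.mul contDiffOn_const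
  revert i j
  exact forall_fin_four (forall_fin_four (hE.mul hr) h0 h0 h1)
    (forall_fin_four h0 h0 (hE.mul hL) h0) (forall_fin_four h0 (hE.mul hL) h0 h0)
    (forall_fin_four h1 h0 h0 (hE.mul ht))

theorem fderiv_gram (H : Admissible I r t h) {w : Jet} (hw : w ∈ jetDomain I) (v : Jet)
    (i j : Fin 4) : fderiv ℝ (fun y => gram r t h y i j) w v =
      (scaleFun h (w 5) • !![2 * deriv h (w 5) * deriv r (w 5)
            + 2 * lamFun r t (w 5) * halfSnd r t r (w 5), 0, 0, -2 * deriv h (w 5);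
        0, 0, 2 * deriv h (w 5) * lamFun r t (w 5) - 2 * lamFun r t (w 5) * logRate r t (w 5), 0;
        0, 2 * deriv h (w 5) * lamFun r t (w 5) - 2 * lamFun r t (w 5) * logRate r t (w 5), 0, 0;
        -2 * deriv h (w 5), 0, 0, 2 * deriv h (w 5) * deriv t (w 5)
            + 2 * lamFun r t (w 5) * halfSnd r t t (w 5)]) i j * v 5 := by
  have hE := H.hasDerivAt_scaleFun hw
  have hL := H.hasDerivAt_lamFun hw
  have hr := (Admissible.differentiableAt H.isOpen H.r' hw).hasDerivAt
  have ht := (Admissible.differentiableAt H.isOpen H.t' hw).hasDerivAt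
  rw [H.deriv_deriv_r hw] at hr
  rw [H.deriv_deriv_t hw] at ht
  have key : ∀ {F : ℝ → ℝ} {F' : ℝ}, HasDerivAt F F' (w 5) →
      fderiv ℝ (fun y : Jet => F (y 5)) w v = F' * v 5 := by
    intro F F' hF
    rw [(hasFDerivAt_comp_five hF.differentiableAt).fderiv, hF.deriv]
    simp [dc]
  have key' : ∀ {F : ℝ → ℝ} {F' : ℝ}, HasDerivAt F F' (w 5) →
      fderiv ℝ (fun y : Jet => scaleFun h (y 5) * F (y 5)) w v =
        (2 * deriv h (w 5) * scaleFun h (w 5) * F (w 5) + scaleFun h (w 5) * F') * v 5 :=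
    fun hF => key (hE.mul hF)
  have h0 := key' (hasDerivAt_const (w 5) (0 : ℝ))
  have h1 := key' (hasDerivAt_const (w 5) (-1 : ℝ))
  have h2 := key' hr
  have h3 := key' ht
  have h4 := key' hL
  revert i j
  refine forall_fin_four
    (forall_fin_four (h2.trans ?_) (h0.trans ?_) (h0.trans ?_) (h1.trans ?_))
    (forall_fin_four (h0.trans ?_) (h0.trans ?_) (h4.trans ?_) (h0.trans ?_))
    (forall_fin_four (h0.trans ?_) (h4.trans ?_) (h0.trans ?_) (h0.trans ?_))
    (forall_fin_four (h1.trans ?_) (h0.trans ?_) (h0.trans ?_) (h3.trans ?_))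
  all_goals
    congr 1
    simp
    try ring1

/-- The explicit connection is the normal conformal connection. -/
theorem isNormalConformalConnection (H : Admissible I r t h) :
    IsNormalConformalConnection (jetDomain I) (omega4 r t) (gram r t h) (conn r t h) where
  smooth i j := contDiffOn_combo H.smooth_r H.smooth_t (H.contDiffOn_connCoef i j)
  conformal := by
    intro w hw v i j
    have hU : omega r t 1 w v = v 5 := rfl
    have hL : lamFun r t (w 5) ≠ 0 := H.lam _ hw
    have hE : scaleFun h (w 5) ≠ 0 := (Real.exp_pos _).ne'
    have hη : etaFun r t h (w 5) = deriv h (w 5) / lamFun r t (w 5) := rfl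
    have hab : lamFun r t (w 5) = 1 - deriv r (w 5) * deriv t (w 5) := rfl
    have hc : ∀ c : ℝ, fderiv ℝ (fun _ : Jet => c) w v = 0 := fun c => by simp
    rcases fin_six_cases i with rfl | ⟨i, rfl⟩ | rfl <;>
      rcases fin_six_cases j with rfl | ⟨j, rfl⟩ | rfl
    all_goals
      simp only [confForm_zero_zero, confForm_zero_five, confForm_five_zero, confForm_five_five,
        confForm_zero_mid, confForm_five_mid, confForm_mid_zero, confForm_mid_five,
        confForm_mid_mid, hc, H.fderiv_gram hw, sum_fin_six, conn_apply, ← hU]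
    all_goals try revert i
    all_goals try revert j
    · simp [connVal]
    · refine forall_fin_four ?_ ?_ ?_ ?_ <;>
        simp [connVal, Fin.sum_univ_four, mid_zero, mid_one, mid_two, mid_three, gram_eq] <;> ring1
    · simp [connVal]
    · refine forall_fin_four ?_ ?_ ?_ ?_ <;>
        simp [connVal, Fin.sum_univ_four, mid_zero, mid_one, mid_two, mid_three, gram_eq] <;> ring1
    · refine forall_fin_four ?_ ?_ ?_ ?_ <;> refine forall_fin_four ?_ ?_ ?_ ?_
      all_goals
        simp [connVal, Fin.sum_univ_four, mid_zero, mid_one, mid_two, mid_three, gram_eq, logRate,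
          hη]
        try (first | ring1 | (field_simp; first | ring1 | (rw [hab]; ring1)))
    · refine forall_fin_four ?_ ?_ ?_ ?_ <;>
        simp [connVal, Fin.sum_univ_four, mid_zero, mid_one, mid_two, mid_three, gram_eq]
      field_simp
      ring1
    · simp [connVal]
    · refine forall_fin_four ?_ ?_ ?_ ?_ <;>
        simp [connVal, Fin.sum_univ_four, mid_zero, mid_one, mid_two, mid_three, gram_eq]
      field_simp
      ring1
    · simp [connVal]
  soldering := by
    intro w hw i
    ext u
    rw [conn_apply]
    revert i
    refine forall_fin_four ?_ ?_ ?_ ?_ <;> rfl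
  gauge := by
    intro w hw
    ext u
    rw [conn_apply]
    rfl
  horizontal := by
    intro w hw v hv j
    have hU : omega r t 1 w v = 0 := hv 1
    rw [conn_apply]
    revert j
    refine forall_fin_four ?_ ?_ ?_ ?_ <;>
      simp [connVal, mid_zero, mid_one, mid_two, mid_three, hU]
  torsion_free := by
    intro w hw u v i
    rw [H.curvature_conn hw]
    revert i
    refine forall_fin_four ?_ ?_ ?_ ?_ <;>
      simp [curvMatrix₂₄, curvMatrix₁₂, mid_zero, mid_one, mid_two, mid_three]
  normal := by
    intro w hw e he v j
    have h0 : ∀ k, omega r t 0 w (e k) = if 0 = k then 1 else 0 := fun k => he 0 k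
    have h1 : ∀ k, omega r t 1 w (e k) = if 1 = k then 1 else 0 := fun k => he 1 k
    have h3 : ∀ k, omega r t 3 w (e k) = if 3 = k then 1 else 0 := fun k => he 3 k
    simp only [H.curvature_conn hw, wedge, h0, h1, h3, Fin.sum_univ_four]
    revert j
    refine forall_fin_four ?_ ?_ ?_ ?_ <;>
      simp [curvMatrix₂₄, curvMatrix₁₂, mid_zero, mid_one, mid_two, mid_three]

/-- Open subsets are allowed because conformal flatness supplies a competing connection only
locally. -/
theorem connection_eqOn (H : Admissible I r t h) {V : Set Jet} (hV : IsOpen V)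
    (hVI : V ⊆ jetDomain I) {B : Matrix (Fin 6) (Fin 6) (Jet → Jet →L[ℝ] ℝ)}
    (hB : IsNormalConformalConnection V (omega4 r t) (gram r t h) B) (i j : Fin 6) :
    Set.EqOn (B i j) (conn r t h i j) V :=
  IsNormalConformalConnection.eqOn hV (fun w _ => gram_symm w)
    (fun _ hw => isUnit_iff_ne_zero.2 (H.det_gram_ne_zero (hVI hw)))
    (fun w _ => ⟨jetFrame, isDualFrame_jetFrame w⟩) (H.isNormalConformalConnection.mono hVI) hB i j

end Admissible

/-! ### Conformal flatness forces Z₁ = Z₂ = 0. -/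

variable {I : Set ℝ} {r t h : ℝ → ℝ}

theorem gConf_jetFrame (w : Jet) (i j : Fin 4) :
    gConf r t h w (jetFrame i) (jetFrame j) = gram r t h w i j := by
  rw [gConf_eq]
  simp [isDualFrame_jetFrame w _ _]

/-- Through `fderiv_fderiv_of_ker` this says how frame derivatives of first integrals vary along the
kernel: the one along e₁ changes by those along e₀ and e₃, while the one along e₂ does not change.
-/
theorem fderiv_omega4_jetFrame_one {w : Jet} (hr : DifferentiableAt ℝ r (w 5))
    (ht : DifferentiableAt ℝ t (w 5)) (v : Jet) :
    (fun i => fderiv ℝ (omega4 r t i) w (jetFrame 1) v) =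
      ![-v 0 - deriv t (w 5) * v 1, 0, 0, -(deriv r (w 5) * v 0) - v 1] := by
  funext i
  revert i
  refine forall_fin_four ?_ ?_ ?_ ?_
  · exact (fderiv_omega_zero ht _ _).trans (by simp [jetFrame])
  · exact fderiv_omega_one _ _ _
  · exact (fderiv_omega_two _ _ _).trans (by simp [jetFrame])
  · exact (fderiv_omega_three hr _ _).trans (by simp [jetFrame])

theorem fderiv_omega4_jetFrame_two {w : Jet} (hr : DifferentiableAt ℝ r (w 5))
    (ht : DifferentiableAt ℝ t (w 5)) (v : Jet) (i : Fin 4) :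
    fderiv ℝ (omega4 r t i) w (jetFrame 2) v = 0 := by
  revert i
  refine forall_fin_four ?_ ?_ ?_ ?_
  · exact (fderiv_omega_zero ht _ _).trans (by simp [jetFrame])
  · exact fderiv_omega_one _ _ _
  · exact (fderiv_omega_two _ _ _).trans (by simp [jetFrame])
  · exact (fderiv_omega_three hr _ _).trans (by simp [jetFrame])

namespace Admissible

/-- Flat coordinates give a normal connection without curvature, which uniqueness identifies with
`conn`. The flat development also requires φ and the coordinates to be constant along the kernel;
both facts have to be extracted from the shape of the metric. -/
theorem zInv_eq_zero_of_flat (H : Admissible I r t h)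
    (hflat : IsConformallyFlat (jetDomain I) (gConf r t h)) {s : ℝ} (hs : s ∈ I) :
    Z₁ r t s = 0 ∧ Z₂ r t s = 0 := by
  have hw : (Pi.single 5 s : Jet) ∈ jetDomain I := by simpa [jetDomain] using hs
  obtain ⟨V, hV, hwV, hVI, φ, y, η, hφ, hy, hη, hηdet, hG⟩ := hflat _ hw
  have hθ : ∀ i, ContDiffOn ℝ ∞ (omega4 r t i) V := fun i =>
    (contDiffOn_omega4 H.smooth_r H.smooth_t i).mono hVI
  have hg : ∀ x ∈ V, ∀ i j, gram r t h x i j = Real.exp (2 * φ x) * ∑ a, ∑ b, η a b *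
      (fderiv ℝ (y a) x (jetFrame i) * fderiv ℝ (y b) x (jetFrame j)) := fun x hx i j => by
    rw [← gConf_jetFrame, (hG x hx).2]
  -- For v in the kernel, G(v, ·) = 0; independence of the dy^a and invertibility of η then force
  -- dy(v) = 0.
  have hyker : ∀ x ∈ V, ∀ v, (∀ i, omega4 r t i x v = 0) → ∀ a, fderiv ℝ (y a) x v = 0 := by
    intro x hx v hv
    have h1 : ∀ u, ∑ b, (∑ a, η b a * fderiv ℝ (y a) x v) * fderiv ℝ (y b) x u = 0 := by
      intro u
      have h2 := (hG x hx).2 v u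
      rw [gConf_eq] at h2
      simp only [hv, zero_mul, mul_zero, Finset.sum_const_zero] at h2
      have h3 := (mul_eq_zero.1 h2.symm).resolve_left (Real.exp_pos _).ne'
      rw [Finset.sum_comm] at h3
      rw [← h3]
      refine Finset.sum_congr rfl fun b _ => ?_
      rw [Finset.sum_mul]
      refine Finset.sum_congr rfl fun a _ => ?_
      rw [hη.apply]
      ring
    have h2 := Fintype.linearIndependent_iff.1 (hG x hx).1
      (fun b => ∑ a, η b a * fderiv ℝ (y a) x v) (by
        ext u
        simpa using h1 u)
    exact eq_zero_of_gram (isUnit_iff_ne_zero.2 hηdet) (fun a => fderiv ℝ (y a) x v) h2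
  -- Flatness as defined does not make φ a function on the leaf space. The product g(e₁, e₂) depends
  -- on `s` only, so its derivative along v vanishes. The variation of dy(e₁) lies in the span of
  -- dy(e₀) and dy(e₃), both orthogonal to dy(e₂), and dy(e₂) does not vary. What remains is 2 dφ(v)
  -- g(e₁, e₂) = 0, where g(e₁, e₂) ≠ 0.
  have hφker : ∀ x ∈ V, ∀ v, (∀ i, omega4 r t i x v = 0) → fderiv ℝ φ x v = 0 := by
    intro x hx v hv
    have hxI := hVI hx
    have hdr := Admissible.differentiableAt H.isOpen H.smooth_r hxI
    have hdt := Admissible.differentiableAt H.isOpen H.smooth_t hxI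
    have hv5 : v 5 = 0 := hv 1
    have h0 := H.fderiv_gram hxI v 1 2
    rw [hv5, mul_zero] at h0
    have hφd : DifferentiableAt ℝ φ x := (hφ.contDiffAt (hV.mem_nhds hx)).differentiableAt (by simp)
    have hyd : ∀ a j, DifferentiableAt ℝ (fun z => fderiv ℝ (y a) z (jetFrame j)) x := fun a j =>
      ((((hy a).fderiv_of_isOpen hV (m := ∞) (by simp)).clm_apply
        contDiffOn_const).contDiffAt (hV.mem_nhds hx)).differentiableAt (by simp)
    have hd1 : ∀ a, fderiv ℝ (fun z => fderiv ℝ (y a) z (jetFrame 1)) x v =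
        (-v 0 - deriv t (x 5) * v 1) * fderiv ℝ (y a) x (jetFrame 0) +
          (-(deriv r (x 5) * v 0) - v 1) * fderiv ℝ (y a) x (jetFrame 3) := by
      intro a
      have h1 := congrFun (fderiv_omega4_jetFrame_one hdr hdt v)
      rw [fderiv_fderiv_of_ker hV hθ (fun x _ => isDualFrame_jetFrame x) (hy a)
        (fun x hx v hv => hyker x hx v hv a) hx hv]
      simp only [h1, Fin.sum_univ_four, Matrix.cons_val]
      ring
    have hd2 : ∀ a, fderiv ℝ (fun z => fderiv ℝ (y a) z (jetFrame 2)) x v = 0 := by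
      intro a
      rw [fderiv_fderiv_of_ker hV hθ (fun x _ => isDualFrame_jetFrame x) (hy a)
        (fun x hx v hv => hyker x hx v hv a) hx hv]
      simp [fderiv_omega4_jetFrame_two hdr hdt]
    have h1 : HasFDerivAt (fun z => Real.exp (2 * φ z) * ∑ a, ∑ b, η a b *
        (fderiv ℝ (y a) z (jetFrame 1) * fderiv ℝ (y b) z (jetFrame 2))) _ x :=
      (hφd.hasFDerivAt.const_mul 2).exp.mul (HasFDerivAt.fun_sum fun a _ =>
        HasFDerivAt.fun_sum fun b _ =>
          ((hyd a 1).hasFDerivAt.mul (hyd b 2).hasFDerivAt).const_mul (η a b))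
    have h2 : (fun z => gram r t h z 1 2) =ᶠ[nhds x] fun z => Real.exp (2 * φ z) *
        ∑ a, ∑ b, η a b * (fderiv ℝ (y a) z (jetFrame 1) * fderiv ℝ (y b) z (jetFrame 2)) := by
      filter_upwards [hV.mem_nhds hx] with z hz using hg z hz 1 2
    rw [h2.fderiv_eq, h1.fderiv] at h0
    simp only [add_apply, smul_apply, sum_apply, smul_eq_mul, hd1, hd2, mul_zero, zero_add] at h0
    have h02 : gram r t h x 0 2 = 0 := by simp [gram_eq]
    have h32 : gram r t h x 3 2 = 0 := by simp [gram_eq]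
    have h12 : gram r t h x 1 2 = scaleFun h (x 5) * lamFun r t (x 5) := by simp [gram_eq]
    rw [hg x hx] at h02 h32 h12
    set S := fun i j => ∑ a, ∑ b, η a b *
      (fderiv ℝ (y a) x (jetFrame i) * fderiv ℝ (y b) x (jetFrame j)) with hS
    have h3 : ∑ a, ∑ b, η a b * (fderiv ℝ (y b) x (jetFrame 2) *
        ((-v 0 - deriv t (x 5) * v 1) * fderiv ℝ (y a) x (jetFrame 0) +
          (-(deriv r (x 5) * v 0) - v 1) * fderiv ℝ (y a) x (jetFrame 3))) =
        (-v 0 - deriv t (x 5) * v 1) * S 0 2 + (-(deriv r (x 5) * v 0) - v 1) * S 3 2 := by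
      simp only [hS, Finset.mul_sum, ← Finset.sum_add_distrib]
      exact Finset.sum_congr rfl fun a _ => Finset.sum_congr rfl fun b _ => by ring
    rw [h3] at h0
    have h4 : Real.exp (2 * φ x) * S 1 2 ≠ 0 := by
      rw [h12]
      exact mul_ne_zero (Real.exp_pos _).ne' (H.lam _ hxI)
    change _ + S 1 2 * _ = 0 at h0
    have h5 : Real.exp (2 * φ x) * S 1 2 * fderiv ℝ φ x v = 0 := by
      linear_combination h0 / 2 - (-v 0 - deriv t (x 5) * v 1) / 2 * h02
        - (-(deriv r (x 5) * v 0) - v 1) / 2 * h32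
    exact (mul_eq_zero.1 h5).resolve_left h4
  obtain ⟨B, hB, hB0⟩ := exists_flat_connection hV hθ (fun x _ => isDualFrame_jetFrame x)
    (fun i j => (H.contDiffOn_gram i j).mono hVI) (fun x hx => H.det_gram_ne_zero (hVI hx))
    hη hφ hy hφker hyker hg
  have h1 : ∀ i j u v, curvature (conn r t h) i j (Pi.single 5 s) u v = 0 := fun i j u v => by
    rw [← hB0 _ hwV i j u v]
    exact curvature_congr hV (fun i j => (H.connection_eqOn hV hVI hB i j).symm) hwV i j u v
  -- The pairs ∂_s, ∂_p and ∂_q, ∂_s each see just one of the two wedge products; the entries chosen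
  -- are Z₂ and -Z₁.
  have h2 := h1 1 2 (Pi.single 5 1) (Pi.single 3 1)
  have h3 := h1 4 2 (Pi.single 4 1) (Pi.single 5 1)
  rw [H.curvature_conn hw] at h2 h3
  simp [wedge, omega_apply_zero, omega_apply_one, omega_apply_three, curvMatrix₂₄,
    curvMatrix₁₂] at h2 h3
  exact ⟨h3, h2⟩

end Admissible

/-! ### Flat coordinates when Z₁ = Z₂ = 0. -/

theorem exists_antiderivative_ball {f : ℝ → ℝ} {s₀ ε : ℝ} (hε : 0 < ε)
    (hf : ContinuousOn f (Metric.ball s₀ ε)) :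
    ∃ F : ℝ → ℝ, F s₀ = 0 ∧ ∀ s ∈ Metric.ball s₀ ε, HasDerivAt F (f s) s := by
  refine ⟨fun s => ∫ x in s₀..s, f x, by simp, fun s hs => ?_⟩
  refine intervalIntegral.integral_hasDerivAt_right (ContinuousOn.intervalIntegrable ?_)
    (hf.stronglyMeasurableAtFilter Metric.isOpen_ball s hs)
    (hf.continuousAt (Metric.isOpen_ball.mem_nhds hs))
  exact hf.mono ((convex_ball s₀ ε).ordConnected.uIcc_subset (Metric.mem_ball_self hε) hs)

theorem eqOn_ball_of_hasDerivAt {f f' g : ℝ → ℝ} {s₀ ε : ℝ} (hε : 0 < ε)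
    (hf : ∀ s ∈ Metric.ball s₀ ε, HasDerivAt f (f' s) s)
    (hg : ∀ s ∈ Metric.ball s₀ ε, HasDerivAt g (f' s) s) (h0 : f s₀ = g s₀) {s : ℝ}
    (hs : s ∈ Metric.ball s₀ ε) : f s = g s :=
  Metric.isOpen_ball.eqOn_of_deriv_eq (convex_ball s₀ ε).isPreconnected
    (fun s hs => (hf s hs).differentiableAt.differentiableWithinAt)
    (fun s hs => (hg s hs).differentiableAt.differentiableWithinAt)
    (fun s hs => by rw [(hf s hs).deriv, (hg s hs).deriv]) (Metric.mem_ball_self hε) h0 hs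

variable {I : Set ℝ} {r t h : ℝ → ℝ}

namespace Admissible

/-- With δ = √(L/L₀), vanishing Z makes r' and t' affine in an antiderivative τ of δ³. Then L = 1 -
r't' puts (τ, δ) on a conic through (0, -1), and u = τ/(1+δ) is the slope parameter of lines through
that point. In u, the functions r' and t' have numerators of degree at most two over the common
denominator μ. -/
theorem exists_reparametrization (H : Admissible I r t h)
    (hZ : ∀ s ∈ I, Z₁ r t s = 0 ∧ Z₂ r t s = 0) {s₀ : ℝ} (hs₀ : s₀ ∈ I) :
    ∃ J : Set ℝ, IsOpen J ∧ s₀ ∈ J ∧ J ⊆ I ∧ ∃ (u μ : ℝ → ℝ) (a₀ b₀ c₁ c₂ : ℝ),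
      ContDiffOn ℝ ∞ u J ∧ ContDiffOn ℝ ∞ μ J ∧ 1 - a₀ * b₀ ≠ 0 ∧ ∀ s ∈ J, 0 < μ s ∧
        2 * (1 - a₀ * b₀) * deriv u s = μ s * lamFun r t s ∧
        μ s * deriv t s = b₀ - 2 * (1 - a₀ * b₀) * c₂ * u s
          - (1 - a₀ * b₀) * a₀ * c₂ ^ 2 * u s ^ 2 ∧
        μ s = 1 + (1 - a₀ * b₀) * c₁ * c₂ * u s ^ 2 ∧
        μ s * deriv r s = a₀ - 2 * (1 - a₀ * b₀) * c₁ * u s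
          - (1 - a₀ * b₀) * b₀ * c₁ ^ 2 * u s ^ 2 := by
  set L₀ := lamFun r t s₀ with hL₀
  have hL₀0 : L₀ ≠ 0 := H.lam _ hs₀
  have hq : ContDiffOn ℝ ∞ (fun s => lamFun r t s / L₀) I := H.contDiffOn_lamFun.div_const _
  have hO : IsOpen (I ∩ (fun s => lamFun r t s / L₀) ⁻¹' Set.Ioi 0) :=
    hq.continuousOn.isOpen_inter_preimage H.isOpen isOpen_Ioi
  have hs₀O : s₀ ∈ I ∩ (fun s => lamFun r t s / L₀) ⁻¹' Set.Ioi 0 :=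
    ⟨hs₀, by simp [← hL₀, div_self hL₀0]⟩
  obtain ⟨ε, hε, hball⟩ := Metric.isOpen_iff.1 hO s₀ hs₀O
  have hBI : Metric.ball s₀ ε ⊆ I := fun s hs => (hball hs).1
  have hpos : ∀ s ∈ Metric.ball s₀ ε, 0 < lamFun r t s / L₀ := fun s hs => (hball hs).2
  set δ : ℝ → ℝ := fun s => Real.sqrt (lamFun r t s / L₀) with hδ
  have hδpos : ∀ s ∈ Metric.ball s₀ ε, 0 < δ s := fun s hs => Real.sqrt_pos.2 (hpos s hs)
  have hδsq : ∀ s ∈ Metric.ball s₀ ε, lamFun r t s = L₀ * δ s ^ 2 := fun s hs => by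
    rw [hδ, Real.sq_sqrt (hpos s hs).le]
    field_simp
  have hδs : ContDiffOn ℝ ∞ δ (Metric.ball s₀ ε) := fun s hs =>
    ContDiffWithinAt.sqrt ((hq.mono hBI) s hs) (hpos s hs).ne'
  have hδ₀ : δ s₀ = 1 := by rw [hδ]; simp [← hL₀, div_self hL₀0]
  have hδ' : ∀ s ∈ Metric.ball s₀ ε, HasDerivAt δ (-(δ s * logRate r t s)) s := by
    intro s hs
    refine (((H.hasDerivAt_lamFun (hBI hs)).div_const L₀).sqrt (hpos s hs).ne').congr_deriv ?_
    have h1 := (hδpos s hs).ne'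
    change _ / (2 * δ s) = _
    rw [hδsq s hs]
    field_simp
  -- When Z_f = 0, m_f and δ satisfy the same linear equation, so their quotient is constant on the
  -- ball.
  have hhalf : ∀ f : ℝ → ℝ, ContDiffOn ℝ ∞ f I → (∀ s ∈ I, zInv f r t s = 0) →
      ∀ s ∈ Metric.ball s₀ ε, halfSnd r t f s = halfSnd r t f s₀ * δ s := by
    intro f hf hfz s hs
    have h1 : ∀ s ∈ Metric.ball s₀ ε,
        HasDerivAt (fun s => halfSnd r t f s / δ s) 0 s := fun s hs => by
      refine ((H.hasDerivAt_halfSnd (hBI hs) hf).div (hδ' s hs) (hδpos s hs).ne').congr_deriv ?_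
      rw [hfz s (hBI hs)]
      ring
    have h2 := eqOn_ball_of_hasDerivAt hε h1
      (fun s _ => hasDerivAt_const s (halfSnd r t f s₀)) (by rw [hδ₀, div_one]) hs
    rw [← h2]
    have := (hδpos s hs).ne'
    field_simp
  -- f'' = 2L m_f is a constant times δ³, for f = r and f = t alike.
  obtain ⟨τ, hτ₀, hτ⟩ := exists_antiderivative_ball (f := fun s => δ s ^ 3) hε (hδs.continuousOn.pow 3)
  have hτs : ContDiffOn ℝ ∞ τ (Metric.ball s₀ ε) :=
    (contDiffOn_infty_iff_deriv_of_isOpen Metric.isOpen_ball).2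
      ⟨fun s hs => (hτ s hs).differentiableAt.differentiableWithinAt,
        (hδs.pow 3).congr fun s hs => (hτ s hs).deriv⟩
  have hderiv : ∀ f : ℝ → ℝ, ContDiffOn ℝ ∞ f I → (∀ s ∈ I, zInv f r t s = 0) →
      ∀ s ∈ Metric.ball s₀ ε, deriv f s = deriv f s₀ + 2 * L₀ * halfSnd r t f s₀ * τ s := by
    intro f hf hfz s hs
    refine eqOn_ball_of_hasDerivAt hε (f' := deriv (deriv f)) (g := fun s => deriv f s₀ +
      2 * L₀ * halfSnd r t f s₀ * τ s) (fun s hs => (Admissible.differentiableAt H.isOpen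
        (contDiffOn_deriv H.isOpen hf) (hBI hs)).hasDerivAt) (fun s hs => ?_) ?_ hs
    · refine (((hτ s hs).const_mul _).const_add _).congr_deriv ?_
      have h1 : deriv (deriv f) s = 2 * lamFun r t s * halfSnd r t f s := by
        have := H.lam _ (hBI hs)
        rw [halfSnd]; field_simp
      rw [h1, hhalf f hf hfz s hs, hδsq s hs]
      ring
    · simp [hτ₀]
  set a₀ := deriv r s₀ with ha₀
  set b₀ := deriv t s₀ with hb₀
  set c₁ := -2 * halfSnd r t r s₀ with hc₁
  set c₂ := -2 * halfSnd r t t s₀ with hc₂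
  have hLab : L₀ = 1 - a₀ * b₀ := rfl
  have hr := hderiv r H.smooth_r fun s hs => (hZ s hs).1
  have ht := hderiv t H.smooth_t fun s hs => (hZ s hs).2
  -- This is the conic: L = 1 - r't' divided by L₀, after inserting the affine expressions.
  have hrel : ∀ s ∈ Metric.ball s₀ ε,
      δ s ^ 2 = 1 + τ s * (c₁ * b₀ + c₂ * a₀) - L₀ * c₁ * c₂ * τ s ^ 2 := by
    intro s hs
    have h1 : lamFun r t s = 1 - deriv r s * deriv t s := rfl
    rw [hδsq s hs, hr s hs, ht s hs] at h1
    apply mul_left_cancel₀ hL₀0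
    rw [h1, hc₁, hc₂]
    linear_combination (norm := (rw [← ha₀, ← hb₀]; ring)) -hLab
  have hm : ContDiffOn ℝ ∞ (fun s => 2 + 2 * δ s + τ s * (c₁ * b₀ + c₂ * a₀))
      (Metric.ball s₀ ε) :=
    (contDiffOn_const.add (contDiffOn_const.mul hδs)).add (hτs.mul contDiffOn_const)
  -- The numerator of μ equals 4 at s₀; J is where it stays positive, since log(2/μ) enters the
  -- conformal factor.
  set J := Metric.ball s₀ ε ∩
    (fun s => 2 + 2 * δ s + τ s * (c₁ * b₀ + c₂ * a₀)) ⁻¹' Set.Ioi 0 with hJ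
  have hJB : J ⊆ Metric.ball s₀ ε := Set.inter_subset_left
  have h1δ : ∀ s ∈ J, 1 + δ s ≠ 0 := fun s hs => by linarith [hδpos s (hJB hs)]
  refine ⟨J, hm.continuousOn.isOpen_inter_preimage Metric.isOpen_ball isOpen_Ioi,
    ⟨Metric.mem_ball_self hε, by simp [hδ₀, hτ₀]⟩, hJB.trans hBI,
    fun s => τ s / (1 + δ s),
    fun s => (2 + 2 * δ s + τ s * (c₁ * b₀ + c₂ * a₀)) / (1 + δ s) ^ 2, a₀, b₀, c₁, c₂,
    (hτs.mono hJB).div (contDiffOn_const.add (hδs.mono hJB)) h1δ,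
    (hm.mono hJB).div ((contDiffOn_const.add (hδs.mono hJB)).pow 2)
      (fun s hs => pow_ne_zero _ (h1δ s hs)), hLab ▸ hL₀0, fun s hs => ?_⟩
  have hsB := hJB hs
  have h1 := h1δ s hs
  have hrel' := hrel s hsB
  have hr' := hr s hsB
  have ht' := ht s hsB
  have hrc : deriv r s = a₀ - L₀ * c₁ * τ s := by rw [hr', hc₁]; ring
  have htc : deriv t s = b₀ - L₀ * c₂ * τ s := by rw [ht', hc₂]; ring
  rw [← hLab]
  refine ⟨div_pos hs.2 (by positivity), ?_, ?_, ?_, ?_⟩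
  · have hu : HasDerivAt (fun s => τ s / (1 + δ s)) _ s :=
      (hτ s hsB).div ((hδ' s hsB).const_add 1) h1
    have hrate : logRate r t s = -(δ s / 2 * (deriv t s * c₁ + deriv r s * c₂)) := by
      rw [logRate, hhalf r H.smooth_r (fun s hs => (hZ s hs).1) s hsB,
        hhalf t H.smooth_t (fun s hs => (hZ s hs).2) s hsB, hc₁, hc₂]
      ring
    rw [hu.deriv, hrate, hδsq s hsB, hrc, htc]
    have h2 := (hδpos s hsB).ne'
    field_simp
    linear_combination (2 : ℝ) * hrel'
  · rw [htc]
    field_simp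
    linear_combination (-b₀) * hrel'
  · field_simp
    linear_combination (-1 : ℝ) * hrel'
  · rw [hrc]
    field_simp
    linear_combination (-a₀) * hrel'

end Admissible

/-- The transverse part of μg₀ has coefficients quadratic in u and equals the pull-back of its value
at u = 0 by the linear map (P, Q) ↦ ξ, which is affine in u. Letting u vary produces extra terms in
du; the quadratic correction to z in the fourth coordinate absorbs them. The relation `hρ` turns μL
ds into 2(1 - a₀b₀) du. -/
theorem flat_coordinates_algebra (a b a₀ b₀ c₁ c₂ u ρ μ L P Q p q z s p' q' z' s' : ℝ)
    (hρ : 2 * (1 - a₀ * b₀) * ρ = μ * L)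
    (hb : μ * b = b₀ - 2 * (1 - a₀ * b₀) * c₂ * u - (1 - a₀ * b₀) * a₀ * c₂ ^ 2 * u ^ 2)
    (hμ : μ = 1 + (1 - a₀ * b₀) * c₁ * c₂ * u ^ 2)
    (ha : μ * a = a₀ - 2 * (1 - a₀ * b₀) * c₁ * u - (1 - a₀ * b₀) * b₀ * c₁ ^ 2 * u ^ 2) :
    let ξ₁ := P + u * (a₀ * c₂ * P + c₁ * Q)
    let ξ₂ := Q + u * (c₂ * P + b₀ * c₁ * Q)
    let dξ₁ := p + (u * (a₀ * c₂ * p + c₁ * q) + ρ * s * (a₀ * c₂ * P + c₁ * Q))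
    let dξ₂ := q + (u * (c₂ * p + b₀ * c₁ * q) + ρ * s * (c₂ * P + b₀ * c₁ * Q))
    let dv := (1 - a₀ * b₀) * (z + (c₂ * (P * dξ₁ + p * ξ₁) + c₁ * (Q * dξ₂ + q * ξ₂)) / 4)
    let dξ₁' := p' + (u * (a₀ * c₂ * p' + c₁ * q') + ρ * s' * (a₀ * c₂ * P + c₁ * Q))
    let dξ₂' := q' + (u * (c₂ * p' + b₀ * c₁ * q') + ρ * s' * (c₂ * P + b₀ * c₁ * Q))
    let dv' := (1 - a₀ * b₀) * (z' + (c₂ * (P * dξ₁' + p' * ξ₁) + c₁ * (Q * dξ₂' + q' * ξ₂)) / 4)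
    μ * (L * (s * z' + s' * z) + b * (p * p') - p * q' - q * p' + a * (q * q')) =
      2 * (ρ * s * dv' + ρ * s' * dv + b₀ / 2 * (dξ₁ * dξ₁') - 1 / 2 * (dξ₁ * dξ₂')
        - 1 / 2 * (dξ₂ * dξ₁') + a₀ / 2 * (dξ₂ * dξ₂')) := by
  intro ξ₁ ξ₂ dξ₁ dξ₂ dv dξ₁' dξ₂' dv'
  linear_combination (-(s * z' + s' * z)) * hρ + p * p' * hb - (p * q' + q * p') * hμ
    + q * q' * ha

variable {I : Set ℝ} {r t h : ℝ → ℝ}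

variable (r t) in
/-- First integral `p - r x - s y` of the kernel of the metric. -/
noncomputable def intP (w : Jet) : ℝ := w 3 - r (w 5) * w 0 - w 5 * w 1

variable (r t) in
/-- First integral `q - s x - t y` of the kernel of the metric. -/
noncomputable def intQ (w : Jet) : ℝ := w 4 - w 5 * w 0 - t (w 5) * w 1

variable (r t) in
/-- First integral `z - p x - q y + (r x² + 2 s x y + t y²) / 2` of the kernel of the metric. -/
noncomputable def intZ (w : Jet) : ℝ :=
  w 2 - w 3 * w 0 - w 4 * w 1
    + 2⁻¹ * (r (w 5) * w 0 ^ 2 + 2 * (w 5 * (w 0 * w 1)) + t (w 5) * w 1 ^ 2)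

section

variable {w : Jet}

theorem hasFDerivAt_intP (hr : DifferentiableAt ℝ r (w 5)) : HasFDerivAt (intP r)
    (dc 3 w - (r (w 5) • dc 0 w + w 0 • deriv r (w 5) • dc 5 w)
      - (w 5 • dc 1 w + w 1 • dc 5 w)) w :=
  ((hasFDerivAt_coord 3 w).sub ((hasFDerivAt_comp_five hr).mul (hasFDerivAt_coord 0 w))).sub
    ((hasFDerivAt_coord 5 w).mul (hasFDerivAt_coord 1 w))

theorem hasFDerivAt_intQ (ht : DifferentiableAt ℝ t (w 5)) : HasFDerivAt (intQ t)
    (dc 4 w - (w 5 • dc 0 w + w 0 • dc 5 w)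
      - (t (w 5) • dc 1 w + w 1 • deriv t (w 5) • dc 5 w)) w :=
  ((hasFDerivAt_coord 4 w).sub ((hasFDerivAt_coord 5 w).mul (hasFDerivAt_coord 0 w))).sub
    ((hasFDerivAt_comp_five ht).mul (hasFDerivAt_coord 1 w))

theorem fderiv_intZ (hr : DifferentiableAt ℝ r (w 5)) (ht : DifferentiableAt ℝ t (w 5)) :
    ∃ D : Jet →L[ℝ] ℝ, HasFDerivAt (intZ r t) D w ∧ ∀ v, D v =
      v 2 - (w 3 * v 0 + w 0 * v 3) - (w 4 * v 1 + w 1 * v 4) +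
      (deriv r (w 5) * w 0 ^ 2 + 2 * (w 0 * w 1) + deriv t (w 5) * w 1 ^ 2) / 2 * v 5 +
      (r (w 5) * w 0 + w 5 * w 1) * v 0 + (w 5 * w 0 + t (w 5) * w 1) * v 1 := by
  have c := fun i => hasFDerivAt_coord i w
  have h : HasFDerivAt (intZ r t) _ w :=
    (((c 2).sub ((c 3).mul (c 0))).sub ((c 4).mul (c 1))).add
      (((((hasFDerivAt_comp_five hr).mul ((c 0).pow 2)).add
        (((c 5).mul ((c 0).mul (c 1))).const_mul 2)).add
        ((hasFDerivAt_comp_five ht).mul ((c 1).pow 2))).const_mul 2⁻¹)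
  refine ⟨_, h, fun v => ?_⟩
  simp [dc]
  ring

end

theorem contDiffOn_ints (hr : ContDiffOn ℝ ∞ r I) (ht : ContDiffOn ℝ ∞ t I) :
    ContDiffOn ℝ ∞ (intP r) (jetDomain I) ∧ ContDiffOn ℝ ∞ (intQ t) (jetDomain I) ∧
      ContDiffOn ℝ ∞ (intZ r t) (jetDomain I) := by
  have c : ∀ i : Fin 6, ContDiffOn ℝ ∞ (fun w : Jet => w i) (jetDomain I) := fun i =>
    (contDiff_apply ℝ ℝ i).contDiffOn
  have hr' := contDiffOn_comp_five hr
  have ht' := contDiffOn_comp_five ht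
  exact ⟨((c 3).sub (hr'.mul (c 0))).sub ((c 5).mul (c 1)),
    ((c 4).sub ((c 5).mul (c 0))).sub (ht'.mul (c 1)),
    (((c 2).sub ((c 3).mul (c 0))).sub ((c 4).mul (c 1))).add
      (contDiffOn_const.mul (((hr'.mul ((c 0).pow 2)).add
        (contDiffOn_const.mul ((c 5).mul ((c 0).mul (c 1))))).add (ht'.mul ((c 1).pow 2))))⟩

/-- g = c DᵀηD for the matrix D of values of the α on the e, so det g ≠ 0 makes D invertible. -/
theorem linearIndependent_of_gram {E : Type*} [NormedAddCommGroup E] [NormedSpace ℝ E]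
    {g η : Matrix (Fin 4) (Fin 4) ℝ} (hg : g.det ≠ 0) {c : ℝ} {α : Fin 4 → E →L[ℝ] ℝ}
    {e : Fin 4 → E} (h : ∀ i j, g i j = c * ∑ a, ∑ b, η a b * (α a (e i) * α b (e j))) :
    LinearIndependent ℝ α := by
  set D : Matrix (Fin 4) (Fin 4) ℝ := Matrix.of fun a i => α a (e i) with hD
  have h1 : g = c • (D.transpose * η * D) := by
    ext i j
    rw [h]
    simp only [Matrix.smul_apply, Matrix.mul_apply, Matrix.transpose_apply, hD, Matrix.of_apply,
      smul_eq_mul, Finset.sum_mul]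
    rw [Finset.sum_comm]
    congr 1
    exact Finset.sum_congr rfl fun a _ => Finset.sum_congr rfl fun b _ => by ring
  have h2 : D.det ≠ 0 := by
    intro h0
    rw [h1, Matrix.det_smul, Matrix.det_mul, h0] at hg
    simp at hg
  rw [Fintype.linearIndependent_iff]
  intro x hx
  have h3 : Matrix.vecMul x D = 0 := by
    ext i
    simpa [Matrix.vecMul, dotProduct, hD] using congrArg (fun f : E →L[ℝ] ℝ => f (e i)) hx
  exact congrFun (Matrix.eq_zero_of_vecMul_eq_zero h2 h3)

namespace Admissible

theorem isConformallyFlat (H : Admissible I r t h)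
    (hZ : ∀ s ∈ I, Z₁ r t s = 0 ∧ Z₂ r t s = 0) :
    IsConformallyFlat (jetDomain I) (gConf r t h) := by
  intro x hx
  obtain ⟨J, hJ, hxJ, hJI, u, μ, a₀, b₀, c₁, c₂, hu, hμ, hL₀, hrel⟩ :=
    H.exists_reparametrization hZ (s₀ := x 5) hx
  have hVI : jetDomain J ⊆ jetDomain I := fun w hw => hJI hw
  obtain ⟨hP, hQ, hZc⟩ := contDiffOn_ints (H.smooth_r.mono hJI) (H.smooth_t.mono hJI)
  have hu' := contDiffOn_comp_five hu
  set ξ₁ : Jet → ℝ := fun w =>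
    intP r w + u (w 5) * (a₀ * c₂ * intP r w + c₁ * intQ t w) with hξ₁
  set ξ₂ : Jet → ℝ := fun w =>
    intQ t w + u (w 5) * (c₂ * intP r w + b₀ * c₁ * intQ t w) with hξ₂
  set z : Jet → ℝ := fun w => (1 - a₀ * b₀) *
    (intZ r t w + 4⁻¹ * (c₂ * (intP r w * ξ₁ w) + c₁ * (intQ t w * ξ₂ w))) with hz
  have hξ₁s : ContDiffOn ℝ ∞ ξ₁ (jetDomain J) :=
    hP.add (hu'.mul ((contDiffOn_const.mul hP).add (contDiffOn_const.mul hQ)))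
  have hξ₂s : ContDiffOn ℝ ∞ ξ₂ (jetDomain J) :=
    hQ.add (hu'.mul ((contDiffOn_const.mul hP).add (contDiffOn_const.mul hQ)))
  have hzs : ContDiffOn ℝ ∞ z (jetDomain J) := contDiffOn_const.mul (hZc.add
    (contDiffOn_const.mul
      ((contDiffOn_const.mul (hP.mul hξ₁s)).add (contDiffOn_const.mul (hQ.mul hξ₂s)))))
  set η : Matrix (Fin 4) (Fin 4) ℝ :=
    !![0, 0, 0, 1; 0, b₀ / 2, -1 / 2, 0; 0, -1 / 2, a₀ / 2, 0; 1, 0, 0, 0] with hη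
  set y : Fin 4 → Jet → ℝ := ![fun w => u (w 5), ξ₁, ξ₂, z] with hy
  -- The flat metric η(dy, dy) equals μg₀/2, so e^{2φ} has to be e^{2h} · 2/μ.
  set φ : Jet → ℝ := fun w => h (w 5) + Real.log (2 / μ (w 5)) / 2 with hφ
  have hφs : ContDiffOn ℝ ∞ φ (jetDomain J) := by
    refine (contDiffOn_comp_five (H.smooth_h.mono hJI)).add (ContDiffOn.div_const ?_ 2)
    exact (contDiffOn_const.div (contDiffOn_comp_five hμ) fun w hw => (hrel _ hw).1.ne').log
      fun w hw => (div_pos two_pos (hrel _ hw).1).ne'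
  have key : ∀ w ∈ jetDomain J, ∀ v v', gConf r t h w v v' = Real.exp (2 * φ w) *
      ∑ a, ∑ b, η a b * (fderiv ℝ (y a) w v * fderiv ℝ (y b) w v') := by
    intro w hw v v'
    obtain ⟨hμ0, hρ, hb, hμe, ha⟩ := hrel _ hw
    have dr := Admissible.differentiableAt H.isOpen H.smooth_r (hJI hw)
    have dt := Admissible.differentiableAt H.isOpen H.smooth_t (hJI hw)
    have du := hasFDerivAt_comp_five (Admissible.differentiableAt hJ hu hw)
    set p : Jet → ℝ := fun v => v 3 - (r (w 5) * v 0 + w 0 * (deriv r (w 5) * v 5))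
      - (w 5 * v 1 + w 1 * v 5) with hp
    set q : Jet → ℝ := fun v => v 4 - (w 5 * v 0 + w 0 * v 5)
      - (t (w 5) * v 1 + w 1 * (deriv t (w 5) * v 5)) with hq
    obtain ⟨DP, dP, hDP⟩ : ∃ D, HasFDerivAt (intP r) D w ∧ ∀ v, D v = p v :=
      ⟨_, hasFDerivAt_intP dr, fun v => by simp [dc, hp]⟩
    obtain ⟨DQ, dQ, hDQ⟩ : ∃ D, HasFDerivAt (intQ t) D w ∧ ∀ v, D v = q v :=
      ⟨_, hasFDerivAt_intQ dt, fun v => by simp [dc, hq]⟩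
    obtain ⟨DZ, dZ, hDZ⟩ := fderiv_intZ dr dt
    have d1 : HasFDerivAt ξ₁ _ w := dP.add (du.mul ((dP.const_mul (a₀ * c₂)).add (dQ.const_mul c₁)))
    have d2 : HasFDerivAt ξ₂ _ w := dQ.add (du.mul ((dP.const_mul c₂).add (dQ.const_mul (b₀ * c₁))))
    have d3 : HasFDerivAt z _ w := (dZ.add ((((dP.mul d1).const_mul c₂).add
      ((dQ.mul d2).const_mul c₁)).const_mul 4⁻¹)).const_mul (1 - a₀ * b₀)
    have hexp : Real.exp (2 * φ w) = Real.exp (2 * h (w 5)) * (2 / μ (w 5)) := by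
      have : 2 * φ w = 2 * h (w 5) + Real.log (2 / μ (w 5)) := by rw [hφ]; ring
      rw [this, Real.exp_add, Real.exp_log (div_pos two_pos hμ0)]
    have e0 : ∀ v, fderiv ℝ (y 0) w v = deriv u (w 5) * v 5 := fun v => by
      change fderiv ℝ (fun w : Jet => u (w 5)) w v = _
      rw [du.fderiv]
      simp [dc]
    have e1 : ∀ v, fderiv ℝ (y 1) w v = p v + (u (w 5) * (a₀ * c₂ * p v + c₁ * q v) +
        deriv u (w 5) * v 5 * (a₀ * c₂ * intP r w + c₁ * intQ t w)) := fun v => by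
      change fderiv ℝ ξ₁ w v = _
      rw [d1.fderiv]
      simp [dc, hDP, hDQ]
      ring
    have e2 : ∀ v, fderiv ℝ (y 2) w v = q v + (u (w 5) * (c₂ * p v + b₀ * c₁ * q v) +
        deriv u (w 5) * v 5 * (c₂ * intP r w + b₀ * c₁ * intQ t w)) := fun v => by
      change fderiv ℝ ξ₂ w v = _
      rw [d2.fderiv]
      simp [dc, hDP, hDQ]
      ring
    have e3 : ∀ v, fderiv ℝ (y 3) w v = (1 - a₀ * b₀) * (DZ v +
        (c₂ * (intP r w * fderiv ℝ (y 1) w v + p v * ξ₁ w) +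
          c₁ * (intQ t w * fderiv ℝ (y 2) w v + q v * ξ₂ w)) / 4) := fun v => by
      change fderiv ℝ z w v = (1 - a₀ * b₀) * (DZ v +
        (c₂ * (intP r w * fderiv ℝ ξ₁ w v + p v * ξ₁ w) +
          c₁ * (intQ t w * fderiv ℝ ξ₂ w v + q v * ξ₂ w)) / 4)
      rw [d1.differentiableAt.hasFDerivAt.unique d1, d2.differentiableAt.hasFDerivAt.unique d2,
        d3.fderiv]
      simp only [add_apply, smul_apply, smul_eq_mul, hDP, hDQ]
      ring
    have halg := flat_coordinates_algebra (deriv r (w 5)) (deriv t (w 5)) a₀ b₀ c₁ c₂ (u (w 5))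
      (deriv u (w 5)) (μ (w 5)) (lamFun r t (w 5)) (intP r w) (intQ t w) (p v) (q v) (DZ v) (v 5)
      (p v') (q v') (DZ v') (v' 5) hρ hb hμe ha
    -- Plane wave form of g₀: dP and dQ differ from ω₄ and ω₁ by multiples of ds, and the resulting
    -- cross terms -2L ds (x dP + y dQ) and ds² term go into dZ.
    have hzero : gZero r t w v v' = lamFun r t (w 5) * (v 5 * DZ v' + v' 5 * DZ v) +
        deriv t (w 5) * (p v * p v') - p v * q v' - q v * p v' + deriv r (w 5) * (q v * q v') := by
      simp [gZero, symProd, dc, hDZ, hp, hq, lamFun]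
      ring
    have hsum : ∑ a, ∑ b, η a b * (fderiv ℝ (y a) w v * fderiv ℝ (y b) w v') =
        μ (w 5) * gZero r t w v v' / 2 := by
      rw [hzero, halg]
      simp only [Fin.sum_univ_four, hη, Matrix.of_apply, Matrix.cons_val, e3]
      rw [e0, e0, e1, e1, e2, e2]
      ring
    rw [hsum, hexp, gConf]
    have := hμ0.ne'
    field_simp
  refine ⟨jetDomain J, isOpen_jetDomain hJ, hxJ, hVI, φ, y, η, hφs,
    forall_fin_four hu' hξ₁s hξ₂s hzs, ?_, ?_, fun w hw => ⟨?_, key w hw⟩⟩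
  · ext i j
    revert i j
    refine forall_fin_four ?_ ?_ ?_ ?_ <;> refine forall_fin_four ?_ ?_ ?_ ?_ <;> rfl
  · have : η.det = (1 - a₀ * b₀) / 4 := by
      simp [hη, Matrix.det_succ_row_zero, Fin.sum_univ_succ, Fin.succAbove]
      ring
    rw [this]
    exact div_ne_zero hL₀ (by norm_num)
  · exact linearIndependent_of_gram (H.det_gram_ne_zero (hVI hw)) (η := η) (e := jetFrame)
      fun i j => by rw [← gConf_jetFrame, key w hw]

end Admissible

/-! ### Linear algebra of the Petrov types. -/

/-- Over ℤ the individual values can be settled by `decide`. -/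
theorem leviCivita_eq_intCast (i j k l : Fin 4) : leviCivita i j k l =
    ((Matrix.of fun a b : Fin 4 => if ![i, j, k, l] a = b then (1 : ℤ) else 0).det : ℝ) := by
  have hdet := (Int.castRingHom ℝ).map_det
    (Matrix.of fun a b : Fin 4 => if ![i, j, k, l] a = b then (1 : ℤ) else 0)
  simp only [eq_intCast] at hdet
  rw [leviCivita, hdet]
  congr 1
  ext a b
  simp

set_option maxRecDepth 100000 in
theorem leviCivita_two_zero (k l : Fin 4) : leviCivita 2 0 k l =
    ((!![0, 0, 0, 0; 0, 0, 0, 1; 0, 0, 0, 0; 0, -1, 0, 0] : Matrix (Fin 4) (Fin 4) ℤ) k l : ℝ) := by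
  rw [leviCivita_eq_intCast]
  congr 1
  revert k l
  refine forall_fin_four ?_ ?_ ?_ ?_ <;> refine forall_fin_four ?_ ?_ ?_ ?_ <;> decide

set_option maxRecDepth 100000 in
theorem leviCivita_two_three (k l : Fin 4) : leviCivita 2 3 k l =
    ((!![0, 1, 0, 0; -1, 0, 0, 0; 0, 0, 0, 0; 0, 0, 0, 0] : Matrix (Fin 4) (Fin 4) ℤ) k l : ℝ) := by
  rw [leviCivita_eq_intCast]
  congr 1
  revert k l
  refine forall_fin_four ?_ ?_ ?_ ?_ <;> refine forall_fin_four ?_ ?_ ?_ ?_ <;> decide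

set_option maxRecDepth 100000 in
theorem leviCivita_zero_one (i j : Fin 4) : leviCivita i j 0 1 =
    ((!![0, 0, 0, 0; 0, 0, 0, 0; 0, 0, 0, 1; 0, 0, -1, 0] : Matrix (Fin 4) (Fin 4) ℤ) i j : ℝ) := by
  rw [leviCivita_eq_intCast]
  congr 1
  revert i j
  refine forall_fin_four ?_ ?_ ?_ ?_ <;> refine forall_fin_four ?_ ?_ ?_ ?_ <;> decide

set_option maxRecDepth 100000 in
theorem leviCivita_one_zero (i j : Fin 4) : leviCivita i j 1 0 =
    ((!![0, 0, 0, 0; 0, 0, 0, 0; 0, 0, 0, -1; 0, 0, 1, 0] : Matrix (Fin 4) (Fin 4) ℤ) i j : ℝ) := by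
  rw [leviCivita_eq_intCast]
  congr 1
  revert i j
  refine forall_fin_four ?_ ?_ ?_ ?_ <;> refine forall_fin_four ?_ ?_ ?_ ?_ <;> decide

set_option maxRecDepth 100000 in
theorem leviCivita_one_three (i j : Fin 4) : leviCivita i j 1 3 =
    ((!![0, 0, -1, 0; 0, 0, 0, 0; 1, 0, 0, 0; 0, 0, 0, 0] : Matrix (Fin 4) (Fin 4) ℤ) i j : ℝ) := by
  rw [leviCivita_eq_intCast]
  congr 1
  revert i j
  refine forall_fin_four ?_ ?_ ?_ ?_ <;> refine forall_fin_four ?_ ?_ ?_ ?_ <;> decide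

set_option maxRecDepth 100000 in
theorem leviCivita_three_one (i j : Fin 4) : leviCivita i j 3 1 =
    ((!![0, 0, 1, 0; 0, 0, 0, 0; -1, 0, 0, 0; 0, 0, 0, 0] : Matrix (Fin 4) (Fin 4) ℤ) i j : ℝ) := by
  rw [leviCivita_eq_intCast]
  congr 1
  revert i j
  refine forall_fin_four ?_ ?_ ?_ ?_ <;> refine forall_fin_four ?_ ?_ ?_ ?_ <;> decide

/-- The Gram matrix `E (2 L ω₁ ω₂ + a ω₀² - 2 ω₀ ω₃ + b ω₃²)`. -/
def nullGram (E a b L : ℝ) : Matrix (Fin 4) (Fin 4) ℝ :=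
  E • !![a, 0, 0, -1; 0, 0, L, 0; 0, L, 0, 0; -1, 0, 0, b]

/-- The components of the two-form `u ω₀ ∧ ω₁ + v ω₁ ∧ ω₃`. -/
def nullSkew {R : Type*} [Ring R] (u v : R) : Matrix (Fin 4) (Fin 4) R :=
  !![0, u, 0, 0; -u, 0, 0, v; 0, 0, 0, 0; 0, -v, 0, 0]

/-- The components of the two-form `x ω₂ ∧ ω₀ + y ω₂ ∧ ω₃`. -/
def transSkew {R : Type*} [Ring R] (x y : R) : Matrix (Fin 4) (Fin 4) R :=
  !![0, 0, -x, 0; 0, 0, 0, 0; x, 0, 0, y; 0, 0, -y, 0]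

/-- The quadratic form `q, s, p` on the two-forms spanned by `ω₀ ∧ ω₁` and `ω₁ ∧ ω₃`. -/
def nullWeyl (E p q s : ℝ) (i j k l : Fin 4) : ℝ :=
  E * (nullSkew q s i j * nullSkew 0 1 k l + nullSkew p q i j * nullSkew 1 0 k l)

variable {E a b L p q s : ℝ}

theorem nullGram_inv (hE : E ≠ 0) (hL : L ≠ 0) (hab : L = 1 - a * b) : (nullGram E a b L)⁻¹ =
    (E * L)⁻¹ • !![-b, 0, 0, -1; 0, 0, 1, 0; 0, 1, 0, 0; -1, 0, 0, -a] := by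
  apply Matrix.inv_eq_left_inv
  rw [nullGram, Matrix.smul_mul, Matrix.mul_smul, smul_smul]
  have : (!![-b, 0, 0, -1; 0, 0, 1, 0; 0, 1, 0, 0; -1, 0, 0, -a] : Matrix (Fin 4) (Fin 4) ℝ) *
      !![a, 0, 0, -1; 0, 0, L, 0; 0, L, 0, 0; -1, 0, 0, b] = L • 1 := by
    ext i j
    revert i j
    refine forall_fin_four ?_ ?_ ?_ ?_ <;> refine forall_fin_four ?_ ?_ ?_ ?_ <;>
      simp [Matrix.mul_apply, Fin.sum_univ_four, hab] <;> ring
  rw [this, smul_smul, show (E * L)⁻¹ * E * L = 1 by field_simp, one_smul]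

section Raise

variable {K : Type*} [RCLike K]

theorem raise_one_three (hE : E ≠ 0) (hL : L ≠ 0) (hab : L = 1 - a * b)
    (F : Matrix (Fin 4) (Fin 4) K) : raise (nullGram E a b L) F 1 3 =
      -(((E * L) ^ 2)⁻¹ : ℝ) * (F 2 0 + a * F 2 3) := by
  simp [raise, nullGram_inv hE hL hab, Fin.sum_univ_four]
  field_simp
  ring

theorem raise_three_one (hE : E ≠ 0) (hL : L ≠ 0) (hab : L = 1 - a * b)
    (F : Matrix (Fin 4) (Fin 4) K) : raise (nullGram E a b L) F 3 1 =
      -(((E * L) ^ 2)⁻¹ : ℝ) * (F 0 2 + a * F 3 2) := by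
  simp [raise, nullGram_inv hE hL hab, Fin.sum_univ_four]
  field_simp
  ring

theorem raise_zero_one (hE : E ≠ 0) (hL : L ≠ 0) (hab : L = 1 - a * b)
    (F : Matrix (Fin 4) (Fin 4) K) : raise (nullGram E a b L) F 0 1 =
      -(((E * L) ^ 2)⁻¹ : ℝ) * (b * F 0 2 + F 3 2) := by
  simp [raise, nullGram_inv hE hL hab, Fin.sum_univ_four]
  field_simp
  ring

theorem raise_one_zero (hE : E ≠ 0) (hL : L ≠ 0) (hab : L = 1 - a * b)
    (F : Matrix (Fin 4) (Fin 4) K) : raise (nullGram E a b L) F 1 0 =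
      -(((E * L) ^ 2)⁻¹ : ℝ) * (b * F 2 0 + F 2 3) := by
  simp [raise, nullGram_inv hE hL hab, Fin.sum_univ_four]
  field_simp
  ring

theorem raise_transSkew (hE : E ≠ 0) (hL : L ≠ 0) (hab : L = 1 - a * b) (x y : K) :
    raise (nullGram E a b L) (transSkew x y) =
      ((((E * L) ^ 2)⁻¹ : ℝ) : K) • nullSkew (b * x + y) (-(x + a * y)) := by
  ext i j
  revert i j
  refine forall_fin_four ?_ ?_ ?_ ?_ <;> refine forall_fin_four ?_ ?_ ?_ ?_ <;>
    simp [raise, nullGram_inv hE hL hab, Fin.sum_univ_four, transSkew, nullSkew] <;>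
    try (field_simp; try ring)

/-- A two-form enters only through its raised components 13 and 01, which for `nullGram` involve
only the components 20 and 23 up to order. -/
theorem weylOp_nullWeyl (G : Matrix (Fin 4) (Fin 4) ℝ) (F : Matrix (Fin 4) (Fin 4) K)
    (i j : Fin 4) : weylOp G (nullWeyl E p q s) F i j =
      E / 2 * ((raise G F 1 3 - raise G F 3 1) * (nullSkew q s i j : ℝ)
        + (raise G F 0 1 - raise G F 1 0) * (nullSkew p q i j : ℝ)) := by
  simp only [weylOp, Fin.sum_univ_four, nullWeyl]
  generalize nullSkew q s i j = m
  generalize nullSkew p q i j = n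
  simp [nullSkew]
  ring

end Raise

variable {E a b L p q s : ℝ}

theorem nullGram_det (hab : L = 1 - a * b) : (nullGram E a b L).det = E ^ 4 * L ^ 3 := by
  rw [nullGram, Matrix.det_smul]
  simp [Matrix.det_succ_row_zero, Fin.sum_univ_succ, Fin.succAbove]
  rw [hab]
  ring_nf
  simp

/-- With m = √|L|, the root of |det| is E²m³, while (EL)² = E²m⁴. -/
theorem sqrt_nullGram_det (hE : E ≠ 0) (hL : L ≠ 0) (hab : L = 1 - a * b) :
    √|(nullGram E a b L).det| * ((E * L) ^ 2)⁻¹ = (√|L|)⁻¹ := by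
  have hm : 0 < √|L| := Real.sqrt_pos.2 (abs_pos.2 hL)
  have hm2 : √|L| ^ 2 = |L| := Real.sq_sqrt (abs_nonneg _)
  have h3 : |(L ^ 3)| = √|L| ^ 6 := by rw [abs_pow, show √|L| ^ 6 = (√|L| ^ 2) ^ 3 by ring, hm2]
  have h4 : L ^ 2 = √|L| ^ 4 := by rw [← sq_abs, show √|L| ^ 4 = (√|L| ^ 2) ^ 2 by ring, hm2]
  have h1 : |(nullGram E a b L).det| = (E ^ 2 * √|L| ^ 3) ^ 2 := by
    rw [nullGram_det hab, abs_mul, h3, abs_of_nonneg (by positivity : 0 ≤ E ^ 4)]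
    ring
  have h2 : (E * L) ^ 2 = E ^ 2 * √|L| ^ 4 := by rw [mul_pow, h4]
  rw [h1, h2, Real.sqrt_sq (by positivity)]
  field_simp

section Hodge

variable {K : Type*} [RCLike K]

theorem hodge_two_zero (G : Matrix (Fin 4) (Fin 4) ℝ) (F : Matrix (Fin 4) (Fin 4) K) :
    hodge G F 2 0 = ((√|G.det| / 2 : ℝ) : K) * (raise G F 1 3 - raise G F 3 1) := by
  simp only [hodge, Fin.sum_univ_four, leviCivita_two_zero]
  simp
  left
  ring

theorem hodge_two_three (G : Matrix (Fin 4) (Fin 4) ℝ) (F : Matrix (Fin 4) (Fin 4) K) :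
    hodge G F 2 3 = ((√|G.det| / 2 : ℝ) : K) * (raise G F 0 1 - raise G F 1 0) := by
  simp only [hodge, Fin.sum_univ_four, leviCivita_two_three]
  simp
  left
  ring

/-- The star preserves forms of this type, so eigenforms can be sought among them by solving a 2 × 2
system. -/
theorem hodge_transSkew (hE : E ≠ 0) (hL : L ≠ 0) (hab : L = 1 - a * b) (x y : K) :
    hodge (nullGram E a b L) (transSkew x y) =
      (((√|L|)⁻¹ : ℝ) : K) • transSkew (-(x + a * y)) (b * x + y) := by
  rw [← sqrt_nullGram_det hE hL hab]
  ext i j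
  have key : hodge (nullGram E a b L) (transSkew x y) i j =
      ((√|(nullGram E a b L).det| / 2 : ℝ) : K) * ((((E * L) ^ 2)⁻¹ : ℝ) : K) *
        ((b * x + y) * ((leviCivita i j 0 1 : ℝ) - (leviCivita i j 1 0 : ℝ))
          + -(x + a * y) * ((leviCivita i j 1 3 : ℝ) - (leviCivita i j 3 1 : ℝ))) := by
    simp only [hodge, Fin.sum_univ_four, raise_transSkew hE hL hab]
    simp [nullSkew]
    ring
  rw [key, leviCivita_zero_one, leviCivita_one_zero, leviCivita_one_three, leviCivita_three_one]
  clear key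
  generalize √|(nullGram E a b L).det| = m
  generalize ((E * L) ^ 2)⁻¹ = k
  revert i j
  refine forall_fin_four ?_ ?_ ?_ ?_ <;> refine forall_fin_four ?_ ?_ ?_ ?_ <;>
    simp [transSkew, map_ofNat] <;> ring

theorem transpose_transSkew (x y : K) : (transSkew x y).transpose = -transSkew x y := by
  ext i j
  revert i j
  refine forall_fin_four ?_ ?_ ?_ ?_ <;> refine forall_fin_four ?_ ?_ ?_ ?_ <;>
    simp [transSkew]

variable {c : K}

theorem isHodgeEigen_transSkew (hE : E ≠ 0) (hL : L ≠ 0) (hab : L = 1 - a * b) {x y : K}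
    (h1 : (1 + c * (√|L| : ℝ)) * x + a * y = 0) (h2 : b * x + (1 - c * (√|L| : ℝ)) * y = 0) :
    IsHodgeEigen (nullGram E a b L) c (transSkew x y) := by
  have hm : ((√|L| : ℝ) : K) ≠ 0 :=
    RCLike.ofReal_ne_zero.2 (Real.sqrt_pos.2 (abs_pos.2 hL)).ne'
  refine ⟨transpose_transSkew x y, ?_⟩
  rw [hodge_transSkew hE hL hab, show -(x + a * y) = (√|L| : ℝ) * (c * x) by linear_combination -h1,
    show b * x + y = (√|L| : ℝ) * (c * y) by linear_combination h2]
  ext i j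
  revert i j
  refine forall_fin_four ?_ ?_ ?_ ?_ <;> refine forall_fin_four ?_ ?_ ?_ ?_ <;>
    simp [transSkew, hm]

theorem IsHodgeEigen.apply_swap {G : Matrix (Fin 4) (Fin 4) ℝ} {F : Matrix (Fin 4) (Fin 4) K}
    (hF : IsHodgeEigen G c F) (i j : Fin 4) : F i j = -F j i := by
  simpa using congrFun (congrFun hF.1 j) i

/-- Components 20 and 23 of ⋆F = cF involve no other components of F, so every eigenform satisfies
the same 2 × 2 system as the transversal ones. -/
theorem IsHodgeEigen.linear_eqs (hE : E ≠ 0) (hL : L ≠ 0) (hab : L = 1 - a * b)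
    {F : Matrix (Fin 4) (Fin 4) K} (hF : IsHodgeEigen (nullGram E a b L) c F) :
    (1 + c * (√|L| : ℝ)) * F 2 0 + a * F 2 3 = 0 ∧
      b * F 2 0 + (1 - c * (√|L| : ℝ)) * F 2 3 = 0 := by
  have hm : ((√|L| : ℝ) : K) ≠ 0 :=
    RCLike.ofReal_ne_zero.2 (Real.sqrt_pos.2 (abs_pos.2 hL)).ne'
  have hmm := congrArg (fun z : ℝ => (z : K)) (sqrt_nullGram_det hE hL hab)
  have h1 : hodge (nullGram E a b L) F 2 0 = c * F 2 0 := by rw [hF.2]; rfl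
  have h2 : hodge (nullGram E a b L) F 2 3 = c * F 2 3 := by rw [hF.2]; rfl
  rw [hodge_two_zero, raise_one_three hE hL hab, raise_three_one hE hL hab, hF.apply_swap 0 2,
    hF.apply_swap 3 2] at h1
  rw [hodge_two_three, raise_zero_one hE hL hab, raise_one_zero hE hL hab, hF.apply_swap 0 2,
    hF.apply_swap 3 2] at h2
  generalize √|(nullGram E a b L).det| = d at h1 h2 hmm
  generalize ((E * L) ^ 2)⁻¹ = k at h1 h2 hmm
  generalize √|L| = m at *
  simp only [map_mul, map_inv₀, map_div₀, map_ofNat] at h1 h2 hmm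
  have h3 : (d : K) * k * m = 1 := by rw [hmm, inv_mul_cancel₀ hm]
  constructor
  · linear_combination (-m : K) * h1 - (F 2 0 + a * F 2 3) * h3
  · linear_combination (m : K) * h2 - (b * F 2 0 + F 2 3) * h3

/-- The eigenform equations replace the raised components by c√|L| times the components 20 and 23,
up to sign and scale. -/
theorem weylOp_eq (hE : E ≠ 0) (hL : L ≠ 0) (hab : L = 1 - a * b)
    {F : Matrix (Fin 4) (Fin 4) K} (hF : IsHodgeEigen (nullGram E a b L) c F) :
    weylOp (nullGram E a b L) (nullWeyl E p q s) F =
      ((E * ((E * L) ^ 2)⁻¹ * √|L| : ℝ) * c) •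
        nullSkew (q * F 2 0 + p * F 2 3) (s * F 2 0 + q * F 2 3) := by
  obtain ⟨h1, h2⟩ := hF.linear_eqs hE hL hab
  ext i j
  rw [weylOp_nullWeyl, raise_one_three hE hL hab, raise_three_one hE hL hab,
    raise_zero_one hE hL hab, raise_one_zero hE hL hab, hF.apply_swap 0 2, hF.apply_swap 3 2]
  generalize ((E * L) ^ 2)⁻¹ = k
  generalize √|L| = m at *
  have key : ∀ u v : K, E / 2 * ((-(k : K) * (F 2 0 + a * F 2 3)
      - -(k : K) * (-F 2 0 + a * -F 2 3)) * u + (-(k : K) * (b * -F 2 0 + -F 2 3)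
      - -(k : K) * (b * F 2 0 + F 2 3)) * v) =
      E * k * m * c * (F 2 0 * u + F 2 3 * v) := fun u v => by
    linear_combination (-E * k * u) * h1 + (E * k * v) * h2
  rw [key]
  revert i j
  refine forall_fin_four ?_ ?_ ?_ ?_ <;> refine forall_fin_four ?_ ?_ ?_ ?_ <;>
    simp [nullSkew] <;> exact Or.inl (by ring)

/-- The operator depends only on the components 20, 23 and their transposes, and every two-form in
its image has these equal to zero. -/
theorem weylOp_weylOp (hE : E ≠ 0) (hL : L ≠ 0) (hab : L = 1 - a * b)
    (F : Matrix (Fin 4) (Fin 4) K) :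
    weylOp (nullGram E a b L) (nullWeyl E p q s)
      (weylOp (nullGram E a b L) (nullWeyl E p q s) F) = 0 := by
  have h0 : ∀ u v : ℝ, nullSkew u v 2 0 = 0 ∧ nullSkew u v 2 3 = 0 ∧ nullSkew u v 0 2 = 0 ∧
      nullSkew u v 3 2 = 0 := fun u v => by simp [nullSkew]
  have hz : ∀ i j, (∀ u v : ℝ, nullSkew u v i j = 0) →
      weylOp (nullGram E a b L) (nullWeyl E p q s) F i j = 0 := fun i j h => by
    rw [weylOp_nullWeyl, h, h]
    simp
  ext i j
  rw [weylOp_nullWeyl, raise_one_three hE hL hab, raise_three_one hE hL hab,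
    raise_zero_one hE hL hab, raise_one_zero hE hL hab, hz 2 0 fun u v => (h0 u v).1,
    hz 2 3 fun u v => (h0 u v).2.1, hz 0 2 fun u v => (h0 u v).2.2.1,
    hz 3 2 fun u v => (h0 u v).2.2.2]
  simp

theorem halfTypeN_or_halfTypeO (hE : E ≠ 0) (hL : L ≠ 0) (hab : L = 1 - a * b) (c : K) :
    HalfTypeN (nullGram E a b L) (nullWeyl E p q s) c ∨
      HalfTypeO (nullGram E a b L) (nullWeyl E p q s) c := by
  by_cases h : HalfTypeO (nullGram E a b L) (nullWeyl E p q s) c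
  · exact Or.inr h
  · rw [HalfTypeO] at h
    push Not at h
    exact Or.inl ⟨h, fun F _ => weylOp_weylOp hE hL hab F⟩

/-- As the square always vanishes, only nonvanishing matters: the half is nonzero iff some solution
(x, y) of the eigenform system is not killed by the matrix of the quadratic form s x² + 2q x y + p
y². -/
theorem halfTypeN_iff (hE : E ≠ 0) (hL : L ≠ 0) (hab : L = 1 - a * b) (hc : c ≠ 0) :
    HalfTypeN (nullGram E a b L) (nullWeyl E p q s) c ↔
      ∃ x y : K, (1 + c * (√|L| : ℝ)) * x + a * y = 0 ∧
        b * x + (1 - c * (√|L| : ℝ)) * y = 0 ∧ (q * x + p * y ≠ 0 ∨ s * x + q * y ≠ 0) := by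
  have hm : √|L| ≠ 0 := (Real.sqrt_pos.2 (abs_pos.2 hL)).ne'
  constructor
  · rintro ⟨⟨F, hF, hne⟩, -⟩
    obtain ⟨h1, h2⟩ := hF.linear_eqs hE hL hab
    refine ⟨F 2 0, F 2 3, h1, h2, ?_⟩
    contrapose! hne
    rw [weylOp_eq hE hL hab hF, hne.1, hne.2]
    ext i j
    revert i j
    refine forall_fin_four ?_ ?_ ?_ ?_ <;> refine forall_fin_four ?_ ?_ ?_ ?_ <;>
      simp [nullSkew]
  · rintro ⟨x, y, h1, h2, hne⟩
    have hF := isHodgeEigen_transSkew (E := E) hE hL hab h1 h2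
    refine ⟨⟨transSkew x y, hF, ?_⟩, fun F _ => weylOp_weylOp hE hL hab F⟩
    rw [weylOp_eq hE hL hab hF]
    have hk : ((E * ((E * L) ^ 2)⁻¹ * √|L| : ℝ) : K) * c ≠ 0 := mul_ne_zero
      (RCLike.ofReal_ne_zero.2 (mul_ne_zero (mul_ne_zero hE
        (inv_ne_zero (pow_ne_zero _ (mul_ne_zero hE hL)))) hm)) hc
    rw [smul_ne_zero_iff]
    refine ⟨hk, fun h0 => ?_⟩
    have e1 : q * x + p * y = 0 := by
      simpa [nullSkew, transSkew] using congrFun (congrFun h0 0) 1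
    have e2 : s * x + q * y = 0 := by
      simpa [nullSkew, transSkew] using congrFun (congrFun h0 1) 3
    exact hne.elim (· e1) (· e2)

/-- Both halves are of type `N` exactly where the quadratic form `p, q, s` is nondegenerate. -/
theorem halfTypeN_and_halfTypeN_neg_iff (hE : E ≠ 0) (hL : L ≠ 0) (hab : L = 1 - a * b)
    (hq : 2 * q = b * p + a * s) (hc : (c * (√|L| : ℝ)) ^ 2 = (L : K)) :
    HalfTypeN (nullGram E a b L) (nullWeyl E p q s) c ∧
        HalfTypeN (nullGram E a b L) (nullWeyl E p q s) (-c) ↔ p * s - q ^ 2 ≠ 0 := by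
  have hLK : (L : K) ≠ 0 := RCLike.ofReal_ne_zero.2 hL
  have hc0 : c ≠ 0 := by
    rintro rfl
    apply hLK
    rw [← hc]
    simp
  have hν0 : c * (√|L| : ℝ) ≠ 0 := by
    intro h0
    rw [h0] at hc
    apply hLK
    rw [← hc]
    simp
  have habK : (L : K) = 1 - a * b := by rw [hab]; simp
  have hqK : (2 : K) * q = b * p + a * s := by exact_mod_cast congrArg (fun z : ℝ => (z : K)) hq
  rw [halfTypeN_iff hE hL hab hc0, halfTypeN_iff hE hL hab (neg_ne_zero.2 hc0), neg_mul]
  generalize c * (√|L| : ℝ) = ν at hc hν0 ⊢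
  constructor
  · rintro ⟨⟨x, y, h1, h2, hne⟩, ⟨x', y', h1', h2', hne'⟩⟩ hd
    have hdK : (p : K) * s - q ^ 2 = 0 := by
      exact_mod_cast congrArg (fun z : ℝ => (z : K)) hd
    -- The trace relation `hq` makes the eigenlines of c and -c conjugate for the quadratic form.
    have w1 : x' * (s * x + q * y) + y' * (q * x + p * y) = 0 := by
      linear_combination (1 / 2 : K) * (x * y' + x' * y) * hqK + (s / 2 : K) * x' * h1
        + (s / 2 : K) * x * h1' + (p / 2 : K) * y' * h2 + (p / 2 : K) * y * h2'
    have w2 : x * (s * x' + q * y') + y * (q * x' + p * y') = 0 := by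
      linear_combination w1
    have w3 : (q * x + p * y) * (s * x' + q * y') = (q * x' + p * y') * (s * x + q * y) := by
      linear_combination (x' * y - x * y') * hdK
    have hne1 : ∀ z : K, (q * x + p * y) * z = 0 → (s * x + q * y) * z = 0 → z = 0 :=
      fun z k1 k2 => hne.elim (fun h => (mul_eq_zero.1 k1).resolve_left h)
        (fun h => (mul_eq_zero.1 k2).resolve_left h)
    have hne2 : ∀ z : K, (q * x' + p * y') * z = 0 → (s * x' + q * y') * z = 0 → z = 0 :=
      fun z k1 k2 => hne'.elim (fun h => (mul_eq_zero.1 k1).resolve_left h)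
        (fun h => (mul_eq_zero.1 k2).resolve_left h)
    -- A degenerate form has proportional images `w3`, so conjugacy to the second vector makes the
    -- first one isotropic as well.
    have w4 : x * (s * x + q * y) + y * (q * x + p * y) = 0 := by
      apply hne2
      · linear_combination (q * x + p * y) * w2 - x * w3
      · linear_combination (s * x + q * y) * w2 + y * w3
    -- Both vectors are annihilated by the nonzero image of the first, so they are parallel. As they
    -- belong to the distinct values ν and -ν, all products of their components vanish below and one
    -- of them is zero.
    have w5 : x * y' - x' * y = 0 := by
      apply hne1
      · linear_combination x * w1 - x' * w4
      · linear_combination y' * w4 - y * w1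
    have two : (2 : K) * ν ≠ 0 := mul_ne_zero two_ne_zero hν0
    have k1 : x * x' = 0 := by
      refine (mul_eq_zero.1 ?_).resolve_left two
      linear_combination x' * h1 - x * h1' + a * w5
    have k2 : y * y' = 0 := by
      refine (mul_eq_zero.1 ?_).resolve_left two
      linear_combination y * h2' - y' * h2 + b * w5
    have k3 : x * y' = 0 := by
      refine (mul_eq_zero.1 ?_).resolve_left two
      linear_combination y' * h1 - y * h1' - (1 - ν) * w5
    have k4 : x' * y = 0 := by linear_combination k3 - w5
    rcases eq_or_ne x 0 with hx | hx
    · rcases eq_or_ne y 0 with hy | hy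
      · simp [hx, hy] at hne
      · have e1 : x' = 0 := (mul_eq_zero.1 k4).resolve_right hy
        have e2 : y' = 0 := (mul_eq_zero.1 k2).resolve_left hy
        simp [e1, e2] at hne'
    · have e1 : x' = 0 := (mul_eq_zero.1 k1).resolve_left hx
      have e2 : y' = 0 := (mul_eq_zero.1 k3).resolve_left hx
      simp [e1, e2] at hne'
  · intro hd
    have hdK : (p : K) * s - q ^ 2 ≠ 0 := by exact_mod_cast RCLike.ofReal_ne_zero.2 hd
    have key : ∀ μ : K, μ ^ 2 = L → ∃ x y : K, (1 + μ) * x + a * y = 0 ∧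
        b * x + (1 - μ) * y = 0 ∧ (q * x + p * y ≠ 0 ∨ s * x + q * y ≠ 0) := by
      intro μ hμ
      -- The system has determinant 1 - μ² - ab = L - μ² = 0; the case split picks a null vector
      -- that is visibly nonzero.
      have hxy : ∃ x y : K, (1 + μ) * x + a * y = 0 ∧ b * x + (1 - μ) * y = 0 ∧
          (x ≠ 0 ∨ y ≠ 0) := by
        by_cases h1 : 1 + μ = 0
        · refine ⟨μ - 1, b, ?_, by ring, Or.inl fun h => ?_⟩
          · linear_combination hμ + habK
          · apply two_ne_zero (α := K)
            linear_combination h1 - h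
        · refine ⟨a, -(1 + μ), by ring, ?_, Or.inr (neg_ne_zero.2 h1)⟩
          linear_combination hμ + habK
      obtain ⟨x, y, h1, h2, hne⟩ := hxy
      refine ⟨x, y, h1, h2, ?_⟩
      contrapose! hne
      obtain ⟨e1, e2⟩ := hne
      constructor
      · refine (mul_eq_zero.1 ?_).resolve_left hdK
        linear_combination p * e2 - q * e1
      · refine (mul_eq_zero.1 ?_).resolve_left hdK
        linear_combination s * e1 - q * e2
    exact ⟨key ν hc, key (-ν) (by rw [neg_sq, hc])⟩

end Hodge

/-! ### Signature of the Gram matrix. -/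

section Signature

variable {E a b L : ℝ}

theorem exists_of_diagonal_comp_perm {G S : Matrix (Fin 4) (Fin 4) ℝ} {d d' : Fin 4 → ℝ}
    (hS : S.transpose * G * S = Matrix.diagonal d) (σ : Equiv.Perm (Fin 4)) (hd : d ∘ σ = d')
    (hne : ∀ i, d i ≠ 0) : ∃ S' : Matrix (Fin 4) (Fin 4) ℝ, S'.det ≠ 0 ∧
      S'.transpose * G * S' = Matrix.diagonal d' := by
  have h1 : (S.submatrix id σ).transpose * G * S.submatrix id σ = Matrix.diagonal d' := by
    have h2 := congrArg (fun M : Matrix (Fin 4) (Fin 4) ℝ => M.submatrix σ σ) hS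
    simp only [Matrix.submatrix_diagonal_equiv, hd] at h2
    rw [← h2]
    ext i j
    simp [Matrix.mul_apply]
  refine ⟨S.submatrix id σ, fun h0 => ?_, h1⟩
  have h3 := congrArg Matrix.det h1
  rw [Matrix.det_mul, h0, mul_zero, Matrix.det_diagonal] at h3
  refine Finset.prod_ne_zero_iff.2 (fun i _ => ?_) h3.symm
  rw [← hd]
  exact hne _

theorem exists_diagonalizing (hE : E ≠ 0) (hL : L ≠ 0) {x₀ x₃ y₀ y₃ ε ε' : ℝ}
    (hx : E * (a * x₀ ^ 2 - 2 * x₀ * x₃ + b * x₃ ^ 2) = ε)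
    (hy : E * (a * y₀ ^ 2 - 2 * y₀ * y₃ + b * y₃ ^ 2) = ε')
    (hxy : a * x₀ * y₀ - x₀ * y₃ - x₃ * y₀ + b * x₃ * y₃ = 0) :
    ∃ S : Matrix (Fin 4) (Fin 4) ℝ,
      S.transpose * nullGram E a b L * S = Matrix.diagonal ![ε, 1, -1, ε'] := by
  -- The middle columns are e₁ ± e₂/(2EL) in the hyperbolic plane of the null vectors e₁, e₂, with
  -- squares 1 and -1.
  refine ⟨!![x₀, 0, 0, y₀; 0, 1, 1, 0; 0, (2 * E * L)⁻¹, -(2 * E * L)⁻¹, 0; x₃, 0, 0, y₃], ?_⟩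
  have hn : 2 * (E * L * (2 * E * L)⁻¹) = 1 := by field_simp
  generalize (2 * E * L)⁻¹ = n at *
  ext i j
  revert i j
  refine forall_fin_four ?_ ?_ ?_ ?_ <;> refine forall_fin_four ?_ ?_ ?_ ?_ <;>
    simp [nullGram, Matrix.mul_apply, Fin.sum_univ_four]
  · linear_combination hx
  · linear_combination E * hxy
  · linear_combination hn
  · ring
  · ring
  · linear_combination -hn
  · linear_combination E * hxy
  · linear_combination hy

theorem exists_quadratic_ne_zero (a b : ℝ) :
    ∃ x y : ℝ, a * x ^ 2 - 2 * x * y + b * y ^ 2 ≠ 0 := by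
  by_contra! h0
  have h1 := h0 1 0
  have h2 := h0 0 1
  have h3 := h0 1 1
  norm_num at h1 h2 h3
  norm_num [h1, h2] at h3

/-- In the plane of e₀, e₃ take a vector (x, y) with value Q ≠ 0. The vector (x - by, ax - y) is
orthogonal to it and has value -LQ, so the sign of L decides whether the two signs agree; the
complementary hyperbolic plane contributes 1 and -1. -/
theorem exists_diagonal_signs (hE : 0 < E) (hL : L ≠ 0) (hab : L = 1 - a * b) :
    ∃ (S : Matrix (Fin 4) (Fin 4) ℝ) (ε : ℝ), (ε = 1 ∨ ε = -1) ∧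
      S.transpose * nullGram E a b L * S =
        Matrix.diagonal ![ε, 1, -1, -ε * SignType.sign L] := by
  obtain ⟨x, y, hQ⟩ := exists_quadratic_ne_zero a b
  set Q := a * x ^ 2 - 2 * x * y + b * y ^ 2 with hQdef
  have hεQ : (SignType.sign Q : ℝ) * |Q| = Q := sign_mul_abs Q
  have hLL : (SignType.sign L : ℝ) * |L| = L := sign_mul_abs L
  have hQ' : 0 < |Q| := abs_pos.2 hQ
  have hL' : 0 < |L| := abs_pos.2 hL
  have hk : (√(E * |Q|))⁻¹ ^ 2 * (E * |Q|) = 1 := by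
    rw [inv_pow, Real.sq_sqrt (by positivity), inv_mul_cancel₀ (by positivity)]
  have hk' : (√(E * |Q| * |L|))⁻¹ ^ 2 * (E * |Q| * |L|) = 1 := by
    rw [inv_pow, Real.sq_sqrt (by positivity), inv_mul_cancel₀ (by positivity)]
  generalize (√(E * |Q|))⁻¹ = k at hk
  generalize (√(E * |Q| * |L|))⁻¹ = k' at hk'
  have hx : E * (a * (k * x) ^ 2 - 2 * (k * x) * (k * y) + b * (k * y) ^ 2) =
      SignType.sign Q := by
    linear_combination -(E * k ^ 2) * hQdef - (E * k ^ 2) * hεQ + (SignType.sign Q : ℝ) * hk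
  have hy : E * (a * (k' * (x - b * y)) ^ 2 - 2 * (k' * (x - b * y)) * (k' * (a * x - y))
      + b * (k' * (a * x - y)) ^ 2) = -SignType.sign Q * SignType.sign L := by
    have h1 : a * (k' * (x - b * y)) ^ 2 - 2 * (k' * (x - b * y)) * (k' * (a * x - y))
        + b * (k' * (a * x - y)) ^ 2 = -k' ^ 2 * (L * Q) := by
      rw [hab, hQdef]
      ring
    linear_combination E * h1 + E * k' ^ 2 * L * hεQ
      + E * k' ^ 2 * (SignType.sign Q : ℝ) * |Q| * hLL
      - (SignType.sign Q : ℝ) * SignType.sign L * hk'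
  obtain ⟨S, hS⟩ := exists_diagonalizing (L := L) hE.ne' hL hx hy (by ring)
  refine ⟨S, SignType.sign Q, ?_, hS⟩
  rcases hQ.lt_or_gt with h | h
  · right; simp [h]
  · left; simp [h]

theorem isSplit_nullGram (hE : 0 < E) (hL : 0 < L) (hab : L = 1 - a * b) :
    IsSplit (nullGram E a b L) := by
  obtain ⟨S, ε, hε, hS⟩ := exists_diagonal_signs hE hL.ne' hab
  simp only [hL, sign_pos, SignType.coe_one, mul_one] at hS
  rcases hε with rfl | rfl
  · exact exists_of_diagonal_comp_perm hS 1 (by simp) (by simp [Fin.forall_fin_succ])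
  · refine exists_of_diagonal_comp_perm hS (Equiv.swap 0 3) ?_ (by simp [Fin.forall_fin_succ])
    funext i
    revert i
    refine forall_fin_four ?_ ?_ ?_ ?_ <;> simp [Equiv.swap_apply_def]

theorem isLorentzian_nullGram (hE : 0 < E) (hL : L < 0) (hab : L = 1 - a * b) :
    IsLorentzian (nullGram E a b L) := by
  obtain ⟨S, ε, hε, hS⟩ := exists_diagonal_signs hE hL.ne hab
  simp only [hL, sign_neg, SignType.coe_neg_one, mul_neg, mul_one, neg_neg] at hS
  rcases hε with rfl | rfl
  · obtain ⟨S', h1, h2⟩ := exists_of_diagonal_comp_perm (d' := ![1, 1, 1, -1]) hS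
      (Equiv.swap 2 3) (by
        funext i
        revert i
        refine forall_fin_four ?_ ?_ ?_ ?_ <;> simp [Equiv.swap_apply_def])
      (by simp [Fin.forall_fin_succ])
    exact ⟨S', h1, Or.inl h2⟩
  · obtain ⟨S', h1, h2⟩ := exists_of_diagonal_comp_perm (d' := ![-1, -1, -1, 1]) hS
      (Equiv.swap 1 3) (by
        funext i
        revert i
        refine forall_fin_four ?_ ?_ ?_ ?_ <;> simp [Equiv.swap_apply_def])
      (by simp [Fin.forall_fin_succ])
    exact ⟨S', h1, Or.inr h2⟩

theorem IsSplit.det_pos {G : Matrix (Fin 4) (Fin 4) ℝ} (hG : IsSplit G) : 0 < G.det := by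
  obtain ⟨S, h1, h2⟩ := hG
  have h3 := congrArg Matrix.det h2
  rw [Matrix.det_mul, Matrix.det_mul, Matrix.det_transpose, Matrix.det_diagonal] at h3
  simp [Fin.prod_univ_four] at h3
  have h4 : 0 < S.det ^ 2 := by positivity
  by_contra! h5
  nlinarith

theorem IsLorentzian.det_neg {G : Matrix (Fin 4) (Fin 4) ℝ} (hG : IsLorentzian G) :
    G.det < 0 := by
  obtain ⟨S, h1, h2⟩ := hG
  have h3 : S.det * G.det * S.det = -1 := by
    rcases h2 with h2 | h2 <;>
    · have h3 := congrArg Matrix.det h2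
      rw [Matrix.det_mul, Matrix.det_mul, Matrix.det_transpose, Matrix.det_diagonal] at h3
      simpa [Fin.prod_univ_four] using h3
  have h4 : 0 < S.det ^ 2 := by positivity
  by_contra! h5
  nlinarith

theorem isSplit_nullGram_iff (hE : 0 < E) (hab : L = 1 - a * b) :
    IsSplit (nullGram E a b L) ↔ 0 < L := by
  refine ⟨fun h => ?_, fun h => isSplit_nullGram hE h hab⟩
  have h1 := h.det_pos
  rw [nullGram_det hab] at h1
  have h2 : 0 < L ^ 3 := pos_of_mul_pos_right h1 (by positivity)
  exact (Odd.pow_pos_iff (by decide)).1 h2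

theorem isLorentzian_nullGram_iff (hE : 0 < E) (hab : L = 1 - a * b) :
    IsLorentzian (nullGram E a b L) ↔ L < 0 := by
  refine ⟨fun h => ?_, fun h => isLorentzian_nullGram hE h hab⟩
  have h1 := h.det_neg
  rw [nullGram_det hab] at h1
  have h2 : L ^ 3 < 0 := by
    by_contra! h3
    exact absurd h1 (not_lt.2 (by positivity))
  exact (Odd.pow_neg_iff (by decide)).1 h2

end Signature

/-! ### Genericity of D ≠ 0. -/

section Generic

/-- The expression is quadratic in c with nonzero leading form. If it vanished near a point, its
second difference there in a direction (d₁, d₂) on which the leading form is nonzero would vanish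
too, and that is a nonzero multiple of the leading form. -/
theorem dense_quadratic_ne_zero {a b m : ℝ} (hm : m ≠ 0) (u v : ℝ) :
    Dense {c : ℝ × ℝ | (a * (v - m * c.2) + b * (u - m * c.1)) ^ 2
      + 4 * (1 - a * b) * (u - m * c.1) * (v - m * c.2) ≠ 0} := by
  obtain ⟨d₁, d₂, hd⟩ : ∃ d₁ d₂ : ℝ, (a * d₂ + b * d₁) ^ 2 + 4 * (1 - a * b) * d₁ * d₂ ≠ 0 := by
    by_contra! h0
    have h1 := h0 1 0
    have h2 := h0 0 1
    have h3 := h0 1 1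
    norm_num at h1 h2 h3
    norm_num [h1, h2] at h3
  intro c
  rw [mem_closure_iff_frequently]
  intro hev
  simp only [Set.mem_ofPred_eq, not_not] at hev
  have key : ∀ e : ℝ, Filter.Tendsto (fun τ : ℝ => (c.1 + e * τ * d₁, c.2 + e * τ * d₂)) (nhds 0)
      (nhds c) := fun e => by
    have : Continuous fun τ : ℝ => (c.1 + e * τ * d₁, c.2 + e * τ * d₂) := by fun_prop
    simpa using this.tendsto 0
  have h1 := ((key 1).eventually hev).and (((key (-1)).eventually hev).and
    ((key 0).eventually hev))
  obtain ⟨τ, ⟨e1, e2, e3⟩, hτ⟩ :=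
    ((h1.filter_mono nhdsWithin_le_nhds).and (self_mem_nhdsWithin (s := {(0 : ℝ)}ᶜ))).exists
  have h2 : 2 * (m * τ) ^ 2 * ((a * d₂ + b * d₁) ^ 2 + 4 * (1 - a * b) * d₁ * d₂) = 0 := by
    linear_combination e1 + e2 - 2 * e3
  exact mul_ne_zero (mul_ne_zero two_ne_zero (pow_ne_zero _ (mul_ne_zero hm hτ))) hd h2

variable {I : Set ℝ} {f r t : ℝ → ℝ} {s : ℝ}

theorem contDiffOn_add_cubic (hf : ContDiffOn ℝ ∞ f I) (c s : ℝ) :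
    ContDiffOn ℝ ∞ (fun σ => f σ + c * (σ - s) ^ 3) I :=
  hf.add (ContDiff.contDiffOn (by fun_prop))

theorem iteratedDeriv_add_cubic (hI : IsOpen I) (hf : ContDiffOn ℝ ∞ f I) (hs : s ∈ I) (c : ℝ)
    (n : ℕ) : iteratedDeriv n (fun σ => f σ + c * (σ - s) ^ 3) s =
      iteratedDeriv n f s + iteratedDeriv n (fun σ => c * (σ - s) ^ 3) s := by
  have h1 : ContDiffAt ℝ n f s := (hf.contDiffAt (hI.mem_nhds hs)).of_le (by exact_mod_cast le_top)
  exact iteratedDeriv_fun_add h1 (by fun_prop)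

theorem deriv_cubic (c s : ℝ) :
    deriv (fun σ : ℝ => c * (σ - s) ^ 3) = fun σ => 3 * c * (σ - s) ^ 2 := by
  funext σ
  have h1 : HasDerivAt (fun σ : ℝ => σ - s) 1 σ := (hasDerivAt_id σ).sub_const s
  refine ((h1.pow 3).const_mul c).deriv.trans ?_
  push_cast
  ring

theorem deriv_deriv_cubic (c s : ℝ) :
    deriv (deriv (fun σ : ℝ => c * (σ - s) ^ 3)) = fun σ => 6 * c * (σ - s) := by
  funext σ
  have h1 : HasDerivAt (fun σ : ℝ => σ - s) 1 σ := (hasDerivAt_id σ).sub_const s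
  rw [deriv_cubic]
  refine ((h1.pow 2).const_mul (3 * c)).deriv.trans ?_
  push_cast
  ring

theorem deriv_deriv_deriv_cubic (c s : ℝ) :
    deriv (deriv (deriv (fun σ : ℝ => c * (σ - s) ^ 3))) = fun _ => 6 * c := by
  funext σ
  have h1 : HasDerivAt (fun σ : ℝ => σ - s) 1 σ := (hasDerivAt_id σ).sub_const s
  rw [deriv_deriv_cubic, (h1.const_mul (6 * c)).deriv, mul_one]

theorem deriv_mul_deriv (hI : IsOpen I) (hr : ContDiffOn ℝ ∞ r I) (ht : ContDiffOn ℝ ∞ t I)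
    (hs : s ∈ I) : deriv (fun σ => deriv t σ * deriv r σ) s =
      iteratedDeriv 2 t s * deriv r s + deriv t s * iteratedDeriv 2 r s := by
  have hd : ∀ {f : ℝ → ℝ}, ContDiffOn ℝ ∞ f I → DifferentiableAt ℝ (deriv f) s := fun hf =>
    Admissible.differentiableAt hI (hf.deriv_of_isOpen hI (by simp)) hs
  rw [deriv_fun_mul (hd ht) (hd hr)]
  simp [iteratedDeriv_succ]

/-- A cubic centred at `s` fixes the derivatives of order up to two there and shifts the third by
6c, which moves Z by 2(-L)(6c)/(4L²) = -3c/L. -/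
theorem zInv_add_cubic (hI : IsOpen I) (hf : ContDiffOn ℝ ∞ f I) (hr : ContDiffOn ℝ ∞ r I)
    (ht : ContDiffOn ℝ ∞ t I) (hs : s ∈ I) (hrt : 1 - deriv r s * deriv t s ≠ 0)
    (c c₁ c₂ : ℝ) :
    zInv (fun σ => f σ + c * (σ - s) ^ 3) (fun σ => r σ + c₁ * (σ - s) ^ 3)
      (fun σ => t σ + c₂ * (σ - s) ^ 3) s =
      zInv f r t s - 3 / (1 - deriv r s * deriv t s) * c := by
  have h1 : ∀ {f : ℝ → ℝ}, ContDiffOn ℝ ∞ f I → ∀ c,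
      deriv (fun σ => f σ + c * (σ - s) ^ 3) s = deriv f s := fun hf c => by
    simpa [deriv_cubic] using iteratedDeriv_add_cubic hI hf hs c 1
  have h2 : ∀ {f : ℝ → ℝ}, ContDiffOn ℝ ∞ f I → ∀ c,
      iteratedDeriv 2 (fun σ => f σ + c * (σ - s) ^ 3) s = iteratedDeriv 2 f s := fun hf c => by
    rw [iteratedDeriv_add_cubic hI hf hs c 2]
    simp only [iteratedDeriv_succ, iteratedDeriv_zero, deriv_deriv_cubic, sub_self, mul_zero,
      add_zero]
  have h3 : iteratedDeriv 3 (fun σ => f σ + c * (σ - s) ^ 3) s = iteratedDeriv 3 f s + 6 * c := by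
    rw [iteratedDeriv_add_cubic hI hf hs c 3]
    simp only [iteratedDeriv_succ, iteratedDeriv_zero, deriv_deriv_deriv_cubic]
  rw [zInv, zInv, deriv_mul_deriv hI (contDiffOn_add_cubic hr _ _) (contDiffOn_add_cubic ht _ _) hs,
    deriv_mul_deriv hI hr ht hs, h1 hr, h1 ht, h2 hr, h2 ht, h2 hf, h3]
  field_simp
  ring

theorem genericity_add_cubic (hI : IsOpen I) (hr : ContDiffOn ℝ ∞ r I) (ht : ContDiffOn ℝ ∞ t I)
    (hs : s ∈ I) (hrt : 1 - deriv r s * deriv t s ≠ 0) (c₁ c₂ : ℝ) :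
    genericity (fun σ => r σ + c₁ * (σ - s) ^ 3) (fun σ => t σ + c₂ * (σ - s) ^ 3) s =
      (deriv r s * (Z₂ r t s - 3 / (1 - deriv r s * deriv t s) * c₂)
        + deriv t s * (Z₁ r t s - 3 / (1 - deriv r s * deriv t s) * c₁)) ^ 2
      + 4 * (1 - deriv r s * deriv t s) * (Z₁ r t s - 3 / (1 - deriv r s * deriv t s) * c₁)
        * (Z₂ r t s - 3 / (1 - deriv r s * deriv t s) * c₂) := by
  have h1 : ∀ {f : ℝ → ℝ}, ContDiffOn ℝ ∞ f I → ∀ c,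
      deriv (fun σ => f σ + c * (σ - s) ^ 3) s = deriv f s := fun hf c => by
    simpa [deriv_cubic] using iteratedDeriv_add_cubic hI hf hs c 1
  rw [genericity, h1 hr, h1 ht, Z₁, Z₂, zInv_add_cubic hI hr hr ht hs hrt,
    zInv_add_cubic hI ht hr ht hs hrt, ← Z₁, ← Z₂]

theorem zInv_eq_zero_iff (hrt : 1 - deriv r s * deriv t s ≠ 0) :
    zInv f r t s = 0 ↔ iteratedDeriv 3 f s = -3 * iteratedDeriv 2 f s *
      deriv (fun σ => deriv r σ * deriv t σ) s / (2 * (1 - deriv r s * deriv t s)) := by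
  simp only [zInv, mul_comm (deriv t _)]
  rw [div_eq_zero_iff, or_iff_left (by positivity), eq_div_iff (by positivity)]
  constructor <;> intro h <;> linear_combination -h

end Generic

/-! ### Petrov type of the metric. -/

namespace Admissible

variable {I : Set ℝ} {r t h : ℝ → ℝ} {A : Matrix (Fin 6) (Fin 6) (Jet → Jet →L[ℝ] ℝ)}
  {w : Jet} {e : Fin 4 → Jet}

/-- The curvature sees the frame only through the values of the ω_i, so the dual frame chosen does
not matter. Lowering the first index gives the coefficients p, q, s of the quadratic form. -/
theorem weyl_conn (H : Admissible I r t h) (hw : w ∈ jetDomain I)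
    (he : IsDualFrame (omega4 r t) w e) :
    weyl (conn r t h) (gram r t h w) w e = nullWeyl (scaleFun h (w 5))
      ((2 * Z₁ r t (w 5) - Z₁ r t (w 5) * deriv r (w 5) * deriv t (w 5)
        + Z₂ r t (w 5) * deriv r (w 5) ^ 2) / 2)
      ((Z₂ r t (w 5) * deriv r (w 5) + Z₁ r t (w 5) * deriv t (w 5)) / 2)
      ((2 * Z₂ r t (w 5) - Z₂ r t (w 5) * deriv r (w 5) * deriv t (w 5)
        + Z₁ r t (w 5) * deriv t (w 5) ^ 2) / 2) := by
  have hL : lamFun r t (w 5) ≠ 0 := H.lam _ hw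
  have hab : lamFun r t (w 5) = 1 - deriv r (w 5) * deriv t (w 5) := rfl
  funext i j k l
  have h13 : wedge (omega r t 1) (omega r t 3) w (e k) (e l) = nullSkew 0 1 k l := by
    have h1 : ∀ k, omega r t 1 w (e k) = if 1 = k then 1 else 0 := fun k => he 1 k
    have h3 : ∀ k, omega r t 3 w (e k) = if 3 = k then 1 else 0 := fun k => he 3 k
    rw [wedge, h1, h1, h3, h3]
    revert k l
    refine forall_fin_four ?_ ?_ ?_ ?_ <;> refine forall_fin_four ?_ ?_ ?_ ?_ <;> simp [nullSkew]
  have h01 : wedge (omega r t 0) (omega r t 1) w (e k) (e l) = nullSkew 1 0 k l := by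
    have h1 : ∀ k, omega r t 1 w (e k) = if 1 = k then 1 else 0 := fun k => he 1 k
    have h0 : ∀ k, omega r t 0 w (e k) = if 0 = k then 1 else 0 := fun k => he 0 k
    rw [wedge, h1, h1, h0, h0]
    revert k l
    refine forall_fin_four ?_ ?_ ?_ ?_ <;> refine forall_fin_four ?_ ?_ ?_ ?_ <;> simp [nullSkew]
  simp only [weyl, H.curvature_conn hw, h13, h01, nullWeyl]
  generalize (nullSkew 0 1 k l : ℝ) = m
  generalize (nullSkew 1 0 k l : ℝ) = n
  simp only [Fin.sum_univ_four, mid_zero, mid_one, mid_two, mid_three, gram_eq, curvMatrix₂₄,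
    curvMatrix₁₂, ← hab]
  revert i j
  refine forall_fin_four ?_ ?_ ?_ ?_ <;> refine forall_fin_four ?_ ?_ ?_ ?_ <;>
    simp [nullSkew, mid_zero, mid_one, mid_two, mid_three] <;> try (field_simp; try ring)

theorem gram_eq_nullGram : gram r t h w = nullGram (scaleFun h (w 5)) (deriv r (w 5))
    (deriv t (w 5)) (lamFun r t (w 5)) := rfl

theorem halfTypeN_or_halfTypeO {K : Type*} [RCLike K] (H : Admissible I r t h)
    (hw : w ∈ jetDomain I) (he : IsDualFrame (omega4 r t) w e) (c : K) :
    HalfTypeN (gram r t h w) (weyl (conn r t h) (gram r t h w) w e) c ∨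
      HalfTypeO (gram r t h w) (weyl (conn r t h) (gram r t h w) w e) c := by
  rw [H.weyl_conn hw he]
  exact ConfMetric.halfTypeN_or_halfTypeO (Real.exp_pos _).ne' (H.lam _ hw) rfl c

theorem halfTypeN_and_halfTypeN_neg_iff {K : Type*} [RCLike K] (H : Admissible I r t h)
    (hw : w ∈ jetDomain I) (he : IsDualFrame (omega4 r t) w e) {c : K}
    (hc : (c * (√|lamFun r t (w 5)| : ℝ)) ^ 2 = (lamFun r t (w 5) : K)) :
    HalfTypeN (gram r t h w) (weyl (conn r t h) (gram r t h w) w e) c ∧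
        HalfTypeN (gram r t h w) (weyl (conn r t h) (gram r t h w) w e) (-c) ↔
      genericity r t (w 5) ≠ 0 := by
  have hL : lamFun r t (w 5) ≠ 0 := H.lam _ hw
  rw [H.weyl_conn hw he, gram_eq_nullGram,
    ConfMetric.halfTypeN_and_halfTypeN_neg_iff (E := scaleFun h (w 5))
      (Real.exp_pos _).ne' hL rfl (by ring) hc, not_iff_not]
  -- The determinant ps - q² of the form equals LD/4.
  have key : ∀ p q : ℝ, p = lamFun r t (w 5) * q / 4 → (p = 0 ↔ q = 0) := by
    rintro p q rfl
    simp [hL]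
  apply key
  rw [lamFun, genericity]
  ring

theorem hasTypeNN'_iff (H : Admissible I r t h) (hw : w ∈ jetDomain I)
    (he : IsDualFrame (omega4 r t) w e) (hs : IsSplit (gram r t h w)) :
    HasTypeNN' (gram r t h w) (weyl (conn r t h) (gram r t h w) w e) ↔
      genericity r t (w 5) ≠ 0 := by
  have hL : 0 < lamFun r t (w 5) := (isSplit_nullGram_iff (Real.exp_pos _) rfl).1 hs
  rw [HasTypeNN', and_iff_right hs, ← H.halfTypeN_and_halfTypeN_neg_iff (K := ℝ) hw he]
  simp [abs_of_pos hL, Real.sq_sqrt hL.le]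

theorem hasTypeNNbar_iff (H : Admissible I r t h) (hw : w ∈ jetDomain I)
    (he : IsDualFrame (omega4 r t) w e) (hs : IsLorentzian (gram r t h w)) :
    HasTypeNNbar (gram r t h w) (weyl (conn r t h) (gram r t h w) w e) ↔
      genericity r t (w 5) ≠ 0 := by
  have hL : lamFun r t (w 5) < 0 := (isLorentzian_nullGram_iff (Real.exp_pos _) rfl).1 hs
  rw [HasTypeNNbar, and_iff_right hs, ← H.halfTypeN_and_halfTypeN_neg_iff (K := ℂ) hw he]
  -- In Lorentzian signature c = i, and (i√|L|)² = L because L < 0.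
  rw [mul_pow, Complex.I_sq, ← RCLike.ofReal_pow, Real.sq_sqrt (abs_nonneg _), abs_of_neg hL]
  simp

end Admissible

/-- Here ab > 1, so b ≠ 0, and b²D = (b²Z₁ + (2 - ab)Z₂)² + 4(ab - 1)Z₂² is positive definite. -/
theorem genericity_ne_zero_iff_of_neg {r t : ℝ → ℝ} {s : ℝ}
    (hL : 1 - deriv r s * deriv t s < 0) :
    genericity r t s ≠ 0 ↔ Z₁ r t s ≠ 0 ∨ Z₂ r t s ≠ 0 := by
  rw [genericity]
  generalize Z₁ r t s = z₁
  generalize Z₂ r t s = z₂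
  generalize deriv r s = a at *
  generalize deriv t s = b at *
  have hb : b ≠ 0 := by
    rintro rfl
    norm_num at hL
  refine ⟨fun h0 => ?_, fun h0 h1 => ?_⟩
  · contrapose! h0
    simp [h0.1, h0.2]
  · have h2 : (b ^ 2 * z₁ + (2 - a * b) * z₂) ^ 2 + 4 * (a * b - 1) * z₂ ^ 2 = 0 := by
      linear_combination b ^ 2 * h1
    have h3 : z₂ = 0 := by
      by_contra h4
      have : 0 < 4 * (a * b - 1) * z₂ ^ 2 := mul_pos (by linarith) (by positivity)
      nlinarith [sq_nonneg (b ^ 2 * z₁ + (2 - a * b) * z₂)]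
    have h4 : z₁ = 0 := by
      rw [h3] at h1
      have : b ^ 2 * z₁ ^ 2 = 0 := by linear_combination h1
      simpa [hb] using this
    simp [h3, h4] at h0

end ConfMetric

theorem mainTheorem11 (I : Set ℝ) (hI : IsOpen I) (r t h : ℝ → ℝ)
    (hr : ContDiffOn ℝ ∞ r I) (ht : ContDiffOn ℝ ∞ t I) (hh : ContDiffOn ℝ ∞ h I)
    (hrt : ∀ s ∈ I, 1 - deriv r s * deriv t s ≠ 0) :
    -- the coframe and the metric written in it
    (∀ w ∈ ConfMetric.jetDomain I,
      LinearIndependent ℝ (fun i => ConfMetric.omega r t i w) ∧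
      ∀ u v, ConfMetric.gConf r t h w u v = ∑ i, ∑ j, ConfMetric.gram r t h w i j *
        (ConfMetric.omega4 r t i w u * ConfMetric.omega4 r t j w v)) ∧
    -- the signature
    (∀ w ∈ ConfMetric.jetDomain I,
      (ConfMetric.IsSplit (ConfMetric.gram r t h w) ↔
        0 < 1 - deriv r (w 5) * deriv t (w 5)) ∧
      (ConfMetric.IsLorentzian (ConfMetric.gram r t h w) ↔
        1 - deriv r (w 5) * deriv t (w 5) < 0)) ∧
    -- the Cartan normal conformal connection exists, is unique, and has the stated curvature
    (∃ A : Matrix (Fin 6) (Fin 6) (ConfMetric.Jet → ConfMetric.Jet →L[ℝ] ℝ),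
      ConfMetric.IsNormalConformalConnection (ConfMetric.jetDomain I)
        (ConfMetric.omega4 r t) (ConfMetric.gram r t h) A ∧
      (∀ B : Matrix (Fin 6) (Fin 6) (ConfMetric.Jet → ConfMetric.Jet →L[ℝ] ℝ),
        ConfMetric.IsNormalConformalConnection (ConfMetric.jetDomain I)
          (ConfMetric.omega4 r t) (ConfMetric.gram r t h) B →
        ∀ i j, Set.EqOn (B i j) (A i j) (ConfMetric.jetDomain I)) ∧
      (∀ w ∈ ConfMetric.jetDomain I, ∀ u v i j,
        ConfMetric.curvature A i j w u v =
          ConfMetric.curvMatrix₂₄ r t (w 5) i j *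
            ConfMetric.wedge (ConfMetric.omega r t 1) (ConfMetric.omega r t 3) w u v
          + ConfMetric.curvMatrix₁₂ r t (w 5) i j *
            ConfMetric.wedge (ConfMetric.omega r t 0) (ConfMetric.omega r t 1) w u v) ∧
      -- the Petrov type
      (∀ w ∈ ConfMetric.jetDomain I, ∀ e : Fin 4 → ConfMetric.Jet,
        ConfMetric.IsDualFrame (ConfMetric.omega4 r t) w e →
        (ConfMetric.IsSplit (ConfMetric.gram r t h w) →
          (∀ c : ℝ, c = 1 ∨ c = -1 →
            ConfMetric.HalfTypeN (ConfMetric.gram r t h w)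
              (ConfMetric.weyl A (ConfMetric.gram r t h w) w e) c ∨
            ConfMetric.HalfTypeO (ConfMetric.gram r t h w)
              (ConfMetric.weyl A (ConfMetric.gram r t h w) w e) c) ∧
          (ConfMetric.HasTypeNN' (ConfMetric.gram r t h w)
              (ConfMetric.weyl A (ConfMetric.gram r t h w) w e) ↔
            ConfMetric.genericity r t (w 5) ≠ 0)) ∧
        (ConfMetric.IsLorentzian (ConfMetric.gram r t h w) →
          (ConfMetric.HasTypeNNbar (ConfMetric.gram r t h w)
              (ConfMetric.weyl A (ConfMetric.gram r t h w) w e) ↔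
            (ConfMetric.Z₁ r t (w 5) ≠ 0 ∨ ConfMetric.Z₂ r t (w 5) ≠ 0)) ∧
          (ConfMetric.genericity r t (w 5) ≠ 0 ↔
            (ConfMetric.Z₁ r t (w 5) ≠ 0 ∨ ConfMetric.Z₂ r t (w 5) ≠ 0))))) ∧
    -- conformal flatness
    (ConfMetric.IsConformallyFlat (ConfMetric.jetDomain I) (ConfMetric.gConf r t h) ↔
      ∀ s ∈ I, ConfMetric.Z₁ r t s = 0 ∧ ConfMetric.Z₂ r t s = 0) ∧
    ((∀ s ∈ I, ConfMetric.Z₁ r t s = 0 ∧ ConfMetric.Z₂ r t s = 0) ↔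
      ∀ s ∈ I,
        iteratedDeriv 3 r s = -3 * iteratedDeriv 2 r s *
          deriv (fun σ => deriv r σ * deriv t σ) s / (2 * (1 - deriv r s * deriv t s)) ∧
        iteratedDeriv 3 t s = -3 * iteratedDeriv 2 t s *
          deriv (fun σ => deriv r σ * deriv t σ) s / (2 * (1 - deriv r s * deriv t s))) ∧
    -- the condition for the types `N ⊕ N'` and `N ⊕ N̄` holds for generic third derivatives
    (∀ s ∈ I,
      IsOpen {c : ℝ × ℝ | ConfMetric.genericity (fun σ => r σ + c.1 * (σ - s) ^ 3)
        (fun σ => t σ + c.2 * (σ - s) ^ 3) s ≠ 0} ∧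
      Dense {c : ℝ × ℝ | ConfMetric.genericity (fun σ => r σ + c.1 * (σ - s) ^ 3)
        (fun σ => t σ + c.2 * (σ - s) ^ 3) s ≠ 0}) := by
  have H : ConfMetric.Admissible I r t h := ⟨hI, hr, ht, hh, hrt⟩
  refine ⟨fun w _ => ⟨ConfMetric.linearIndependent_omega w, ConfMetric.gConf_eq w⟩,
    fun w _ => ⟨ConfMetric.isSplit_nullGram_iff (Real.exp_pos _) rfl,
      ConfMetric.isLorentzian_nullGram_iff (Real.exp_pos _) rfl⟩,
    ⟨ConfMetric.conn r t h, H.isNormalConformalConnection,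
      fun B hB => H.connection_eqOn (hI.preimage (continuous_apply 5)) subset_rfl hB,
      fun w hw => H.curvature_conn hw,
      fun w hw e he => ⟨fun hs => ⟨fun c _ => H.halfTypeN_or_halfTypeO hw he c,
        H.hasTypeNN'_iff hw he hs⟩, fun hs => ?_⟩⟩,
    ⟨fun hflat s hs => H.zInv_eq_zero_of_flat hflat hs, H.isConformallyFlat⟩,
    forall₂_congr fun s hs => and_congr (ConfMetric.zInv_eq_zero_iff (hrt s hs))
      (ConfMetric.zInv_eq_zero_iff (hrt s hs)), fun s hs => ?_⟩
  · have hL := (ConfMetric.isLorentzian_nullGram_iff (Real.exp_pos _) rfl).1 hs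
    exact ⟨(H.hasTypeNNbar_iff hw he hs).trans (ConfMetric.genericity_ne_zero_iff_of_neg hL),
      ConfMetric.genericity_ne_zero_iff_of_neg hL⟩
  · simp only [ConfMetric.genericity_add_cubic hI hr ht hs (hrt s hs)]
    exact ⟨isOpen_ne_fun (by fun_prop) continuous_const,
      ConfMetric.dense_quadratic_ne_zero (div_ne_zero three_ne_zero (hrt s hs)) _ _⟩
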